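/- **Proposition 8.4 (Explicit relations for $\mathcal Q_{Gr(\mathbf P^k,\mathbf P^n)}$).** Let $0\le k<n$ and $X=Gr(\mathbf P^k,\mathbf P^n)=SL(n+1,\mathbf C)/P(\alpha_{k+1})$. Write $\mathrm{Lie}\,P=\mathcal R\oplus\mathcal N$, where $\mathcal R$ consists of the traceless block diagonal matrices (blocks of sizes $k+1$, $n-k$) and $\mathcal N$, the fibre of $\Omega^1_X=U\otimes Q^*$, of the matrices supported in the lower left block. For $1\le p\le k+1$, $1\le q\le n-k$ let $n_{p,q}\in\mathcal N$ be the elementary matrix in row $k+1+q$ and column $k+2-p$; denote its weight $-\sum_{i=k+2-p}^{k+q}\alpha_i$ by $n_{p,q}$ too. Let $D_1$ be the set of integral weights $\lambda=\sum_{i=1}^n c_i\lambda_i$ ($\lambda_i$ the fundamental weights) with $c_i\ge 0$ for $i\ne k+1$. For each $\lambda\in D_1$ let $E_\lambda$ be an irreducible finite dimensional $\mathcal R$-module (equivalently, irreducible homogeneous bundle on $X$) with maximal weight $\lambda$ and let $v_\lambda\in E_\lambda$ be a maximal vector. Put $\lambda_{p,q}:=\lambda+n_{p,q}$; we say that $\lambda_{p,q}$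 exists if it lies in $D_1$. If $E_\lambda=\mathcal S^\alpha U\otimes\mathcal S^\beta Q^*(t)$, then $\lambda_{p,q}$ is obtained by adding a box to row $p$ of $\alpha$ and a box to row $q$ of $\beta$. For $i=1,2$ write $\mathrm{Ext}^i(E_\lambda,E_\mu)^G=\mathrm{Hom}(E_\lambda\otimes\Omega^i_X,E_\mu)^G=\mathrm{Hom}_{\mathcal R}(\Lambda^i\mathcal N\otimes E_\lambda,E_\mu)$. There is a unique family $m_{\mu\lambda}\in\mathrm{Ext}^1(E_\lambda,E_\mu)^G$ ($\lambda,\mu\in D_1$) such that $m_{\mu\lambda}(n_{p,q}\otimes v_\lambda)=v_\mu$ whenever $\mu=\lambda_{p,q}$. For $\lambda,\mu,\nu\in D_1$ let $m_{\nu\mu}\wedge m_{\mu\lambda}\in\mathrm{Ext}^2(E_\lambda,E_\nu)^G$ be the product $$(m_{\nu\mu}\wedge m_{\mu\lambda})(x\wedge y\otimes e)=m_{\nu\mu}(x\otimes m_{\mu\lambda}(y\otimes e))-m_{\nu\mu}(y\otimes m_{\mu\lambda}(x\otimes e)).$$ For complex vector spaces $V_\lambda$ and linear maps $g_{\mu\lambda}:V_\lambda\to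 V_\mu$, the quadratic relation of $\mathcal Q_X$ from $\lambda$ to $\nu$ is $$\sum_{\mu\in D_1}(g_{\nu\mu}g_{\mu\lambda})\otimes(m_{\nu\mu}\wedge m_{\mu\lambda})=0\quad\text{in } \mathrm{Hom}(V_\lambda,V_\nu)\otimes\mathrm{Ext}^2(E_\lambda,E_\nu)^G. \tag{6}$$ (Here $m_{\mu\lambda}=0$ unless there is an arrow $\lambda\to\mu$.) Write $g_{\lambda,p,q}:=g_{\lambda_{p,q}\lambda}$, and $g_{\lambda_{p,q},p'q'}$ for the map from $V_{\lambda_{p,q}}$ to $V_{\lambda''}$ when $\lambda''=\lambda_{p,q}+n_{p',q'}$. If $\mathrm{Ext}^2(E_\lambda,E_{\lambda''})^G\ne0$, then $\lambda''=\lambda+n_{p_1,q_1}+n_{p_2,q_2}$ for some $p_1\le p_2$, $q_1\le q_2$ with $(p_1,q_1)\neq(p_2,q_2)$. Now let $\lambda,\lambda''\in D_1$ with $\lambda''=\lambda+n_{p_1,q_1}+n_{p_2,q_2}$, and let $$\tilde p=\sum_{i=p_1}^{p_2-1}c_{k+1-i}+p_2-p_1,\qquad \tilde q=\sum_{i=q_1}^{q_2-1}c_{k+1+i}+q_2-q_1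 .$$ Then (6) from $\lambda$ to $\lambda''$ is equivalent to the following equations, and $\dim\mathrm{Ext}^2(E_\lambda,E_{\lambda''})^G$ is the number of equations listed. (i) $p_1<p_2$, $q_1<q_2$. (i1) If $\tilde p\ne1$, $\tilde q\ne1$, then $\lambda_{p_1,q_1},\lambda_{p_1,q_2},\lambda_{p_2,q_1},\lambda_{p_2,q_2}$ exist and there are the two equations $$g_{\lambda_{p_1,q_1},p_2q_2}g_{\lambda,p_1,q_1}\Big(\tfrac1{\tilde q}-\tfrac1{\tilde p}\Big)-g_{\lambda_{p_1,q_2},p_2q_1}g_{\lambda,p_1,q_2}+g_{\lambda_{p_2,q_1},p_1q_2}g_{\lambda,p_2,q_1}=0,$$ $$g_{\lambda_{p_1,q_1},p_2q_2}g_{\lambda,p_1,q_1}\Big(\tfrac1{\tilde p\tilde q}-1\Big)-g_{\lambda_{p_1,q_2},p_2q_1}g_{\lambda,p_1,q_2}\tfrac1{\tilde p}-g_{\lambda_{p_2,q_1},p_1q_2}g_{\lambda,p_2,q_1}\tfrac1{\tilde q}+g_{\lambda_{p_2,q_2},p_1q_1}g_{\lambda,p_2,q_2}=0.$$ (i2)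 If $\tilde p=1$, $\tilde q\ne1$, then $\lambda_{p_1,q_1},\lambda_{p_1,q_2}$ exist, $\lambda_{p_2,q_1},\lambda_{p_2,q_2}$ do not, and there is the single equation $$g_{\lambda_{p_1,q_1},p_2q_2}g_{\lambda,p_1,q_1}\Big(\tfrac1{\tilde q}-1\Big)-g_{\lambda_{p_1,q_2},p_2q_1}g_{\lambda,p_1,q_2}=0.$$ (i3) If $\tilde p\ne1$, $\tilde q=1$, then $\lambda_{p_1,q_1},\lambda_{p_2,q_1}$ exist, $\lambda_{p_1,q_2},\lambda_{p_2,q_2}$ do not, and there is the single equation $$g_{\lambda_{p_1,q_1},p_2q_2}g_{\lambda,p_1,q_1}\Big(1-\tfrac1{\tilde p}\Big)+g_{\lambda_{p_2,q_1},p_1q_2}g_{\lambda,p_2,q_1}=0.$$ (i4) If $\tilde p=\tilde q=1$, then of the four only $\lambda_{p_1,q_1}$ exists, and there are no equations. (ii) $p_1=p_2$, $q_1<q_2$. (ii1) If $\tilde q\ne1$, then $\lambda_{p_1,q_1},\lambda_{p_1,q_2}$ exist and there is the equation $$g_{\lambda_{p_1,q_1},p_1q_2}g_{\lambda,p_1,q_1}\Big(\tfrac{1+\tilde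 q}{\tilde q}\Big)-g_{\lambda_{p_1,q_2},p_1q_1}g_{\lambda,p_1,q_2}=0.$$ (ii2) If $\tilde q=1$, then $\lambda_{p_1,q_1}$ exists, $\lambda_{p_1,q_2}$ does not, and there is the equation $g_{\lambda_{p_1,q_1},p_1q_2}g_{\lambda,p_1,q_1}=0$. (iii) $p_1<p_2$, $q_1=q_2$ (symmetric to (ii)). If $\tilde p\ne1$, then $\lambda_{p_1,q_1},\lambda_{p_2,q_1}$ exist and there is the equation $$g_{\lambda_{p_1,q_1},p_2q_1}g_{\lambda,p_1,q_1}\Big(\tfrac{1+\tilde p}{\tilde p}\Big)-g_{\lambda_{p_2,q_1},p_1q_1}g_{\lambda,p_2,q_1}=0;$$ if $\tilde p=1$, then $\lambda_{p_1,q_1}$ exists, $\lambda_{p_2,q_1}$ does not, and there is the equation $g_{\lambda_{p_1,q_1},p_2q_1}g_{\lambda,p_1,q_1}=0$. If $p_1=p_2$ and $q_1=q_2$, then $\mathrm{Ext}^2(E_\lambda,E_{\lambda''})^G=0$ and there are no equations. -/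

import Mathlib

open scoped TensorProduct

namespace GrassmannQuiver

noncomputable section

attribute [local instance 100] LieRing.ofAssociativeRing

/-! ### The parabolic data of `Gr(ℙ^k, ℙ^n) = SL(n+1) / P(α_{k+1})`

Matrix rows and columns are indexed by `Fin (n+1)`, so an index `i ∈ {1, …, n+1}` (counted from one) is
the element `i - 1`; the first block consists of the indices `≤ k` (there are `k+1` of them) and the
second block of the `n - k` indices `> k`. Likewise `p : Fin (k+1)` and `q : Fin (n-k)` stand for
the rows `p + 1` and `q + 1` of the two Young diagrams. -/

/-- The Levi subalgebra `𝓡` of the Lie algebra of `P(α_{k+1})` in `sl(n+1, ℂ)`: the traceless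
block diagonal matrices. -/
def levi (k n : ℕ) : LieSubalgebra ℂ (Matrix (Fin (n + 1)) (Fin (n + 1)) ℂ) where
  carrier := {M | M.trace = 0 ∧
    ∀ i j : Fin (n + 1), ¬((i : ℕ) ≤ k ↔ (j : ℕ) ≤ k) → M i j = 0}
  zero_mem' := by simp
  add_mem' := by
    rintro a b ⟨ha, ha'⟩ ⟨hb, hb'⟩
    refine ⟨by simp [Matrix.trace_add, ha, hb], fun i j h => ?_⟩
    simp [ha' i j h, hb' i j h]
  smul_mem' := by
    rintro c a ⟨ha, ha'⟩
    refine ⟨by simp [Matrix.trace_smul, ha], fun i j h => ?_⟩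
    simp [ha' i j h]
  lie_mem' := by
    rintro a b ⟨-, ha⟩ ⟨-, hb⟩
    have key : ∀ x y : Matrix (Fin (n + 1)) (Fin (n + 1)) ℂ,
        (∀ i j : Fin (n + 1), ¬((i : ℕ) ≤ k ↔ (j : ℕ) ≤ k) → x i j = 0) →
        (∀ i j : Fin (n + 1), ¬((i : ℕ) ≤ k ↔ (j : ℕ) ≤ k) → y i j = 0) →
        ∀ i j : Fin (n + 1), ¬((i : ℕ) ≤ k ↔ (j : ℕ) ≤ k) → (x * y) i j = 0 := by
      intro x y hx hy i j h
      rw [Matrix.mul_apply]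
      refine Finset.sum_eq_zero fun l _ => ?_
      by_cases hl : ((i : ℕ) ≤ k ↔ (l : ℕ) ≤ k)
      · rw [hy l j (by tauto), mul_zero]
      · rw [hx i l hl, zero_mul]
    refine ⟨?_, fun i j h => ?_⟩
    · rw [Ring.lie_def, Matrix.trace_sub, Matrix.trace_mul_comm, sub_self]
    · rw [Ring.lie_def, Matrix.sub_apply, key a b ha hb i j h, key b a hb ha i j h, sub_self]

/-- The nilradical `𝓝` of the Lie algebra of `P(α_{k+1})` (which contains the negative root
spaces): the matrices supported in the lower left block. It is an `𝓡`-module under the adjoint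
action, and the corresponding homogeneous bundle is `Ω¹ = U ⊗ Q^*`. -/
def nilradical (k n : ℕ) :
    LieSubmodule ℂ (levi k n) (Matrix (Fin (n + 1)) (Fin (n + 1)) ℂ) where
  carrier := {M | ∀ i j : Fin (n + 1), ¬((j : ℕ) ≤ k ∧ k < (i : ℕ)) → M i j = 0}
  zero_mem' := by simp
  add_mem' := by
    intro a b ha hb i j h
    simp [ha i j h, hb i j h]
  smul_mem' := by
    intro c a ha i j h
    simp [ha i j h]
  lie_mem := by
    intro x a ha i j h
    have hx := x.2.2
    change (⁅(x : Matrix (Fin (n + 1)) (Fin (n + 1)) ℂ), a⁆ :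
      Matrix (Fin (n + 1)) (Fin (n + 1)) ℂ) i j = 0
    rw [Ring.lie_def, Matrix.sub_apply, Matrix.mul_apply, Matrix.mul_apply,
      Finset.sum_eq_zero, Finset.sum_eq_zero, sub_self]
    · intro l _
      by_cases hl : ((l : ℕ) ≤ k ↔ (j : ℕ) ≤ k)
      · rw [ha i l (by omega), zero_mul]
      · rw [hx l j hl, mul_zero]
    · intro l _
      by_cases hl : ((i : ℕ) ≤ k ↔ (l : ℕ) ≤ k)
      · rw [ha l j (by omega), mul_zero]
      · rw [hx i l hl, zero_mul]

/-- The simple coroot `h_i = E_{i,i} - E_{i+1,i+1}`, an element of the Cartan subalgebra of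
diagonal matrices. -/
def coroot (k n : ℕ) (i : Fin n) : levi k n :=
  ⟨Matrix.diagonal (Pi.single i.castSucc 1 - Pi.single i.succ 1), by
    refine ⟨?_, fun a b h => ?_⟩
    · simp [Matrix.trace_diagonal, Finset.sum_sub_distrib]
    · exact Matrix.diagonal_apply_ne _ (fun hab => h (by rw [hab]))⟩

/-- The root vector `n_{p,q} = u_p ⊗ q_q ∈ 𝓝 = U ⊗ Q^*`: the elementary matrix in row `k+1+q` and
column `k+2-p` (for the indices `p, q` counted from one). -/
def rootVector (k n : ℕ) (p : Fin (k + 1)) (q : Fin (n - k)) : nilradical k n :=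
  ⟨Matrix.single (⟨k + 1 + q, by omega⟩ : Fin (n + 1))
    (⟨k - p, by have := q.isLt; omega⟩ : Fin (n + 1)) (1 : ℂ), by
    intro i j h
    apply Matrix.single_apply_of_ne
    rintro ⟨rfl, rfl⟩
    exact h ⟨by simp, by simp; omega⟩⟩

/-- The simple root `α_i`, in the coordinates given by the fundamental weights. -/
def simpleRoot (n : ℕ) (i : Fin n) : Fin n → ℤ := fun j => CartanMatrix.A n i j

/-- The weight `n_{p,q} = - ∑ α_i`, the sum over `k+1-(p-1) ≤ i ≤ k+1+(q-1)` (all indices counted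
from one), of the root vector `rootVector k n p q`. -/
def rootWeight (k n : ℕ) (p : Fin (k + 1)) (q : Fin (n - k)) : Fin n → ℤ :=
  -∑ i ∈ Finset.univ.filter (fun i : Fin n => k - (p : ℕ) ≤ (i : ℕ) ∧ (i : ℕ) ≤ k + (q : ℕ)),
    simpleRoot n i

/-- The weight `λ = ∑ c_i λ_i` lies in the fundamental Weyl chamber `D₁` of `P(α_{k+1})`. -/
def IsDominant (k n : ℕ) (c : Fin n → ℤ) : Prop := ∀ i : Fin n, (i : ℕ) ≠ k → 0 ≤ c i

/-- The points of the quiver `𝓠_X`: the integral weights in `D₁`. -/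
abbrev Vertex (k n : ℕ) : Type := {c : Fin n → ℤ // IsDominant k n c}

/-- The point `λ_{p,q} = λ + n_{p,q}`, when this weight lies in `D₁` (otherwise it does not exist). -/
def Vertex.add {k n : ℕ} (c : Vertex k n) (p : Fin (k + 1)) (q : Fin (n - k))
    (h : IsDominant k n (c.1 + rootWeight k n p q)) : Vertex k n :=
  ⟨c.1 + rootWeight k n p q, h⟩

/-- `p̃ = ∑_{i=p₁}^{p₂-1} c_{k+1-i} + p₂ - p₁` (indices counted from one in this formula). -/
def pTilde {k n : ℕ} (c : Vertex k n) (p₁ p₂ : Fin (k + 1)) : ℤ :=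
  (∑ j ∈ Finset.univ.filter (fun j : Fin n => k - (p₂ : ℕ) ≤ (j : ℕ) ∧ (j : ℕ) < k - (p₁ : ℕ)), c.1 j)
    + ((p₂ : ℤ) - (p₁ : ℤ))

/-- `q̃ = ∑_{i=q₁}^{q₂-1} c_{k+1+i} + q₂ - q₁` (indices counted from one in this formula). -/
def qTilde {k n : ℕ} (c : Vertex k n) (q₁ q₂ : Fin (n - k)) : ℤ :=
  (∑ j ∈ Finset.univ.filter
      (fun j : Fin n => k + 1 + (q₁ : ℕ) ≤ (j : ℕ) ∧ (j : ℕ) < k + 1 + (q₂ : ℕ)), c.1 j)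
    + ((q₂ : ℤ) - (q₁ : ℤ))

/-- `E` is a finite dimensional irreducible representation of `𝓡` with maximal weight
`λ = ∑ c_i λ_i`, and `v` is a maximal vector of it. -/
structure IsIrrepWithMaximalVector (k n : ℕ) (c : Fin n → ℤ) (E : Type*) [AddCommGroup E]
    [Module ℂ E] [LieRingModule (levi k n) E] [LieModule ℂ (levi k n) E] (v : E) : Prop where
  finiteDimensional : FiniteDimensional ℂ E
  irreducible : LieModule.IsIrreducible ℂ (levi k n) E
  ne_zero : v ≠ 0
  /-- the positive root spaces of `𝓡` kill `v` -/
  maximal : ∀ x : levi k n, (∀ i j : Fin (n + 1), j ≤ i → x.1 i j = 0) → ⁅x, v⁆ = 0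
  weight : ∀ i : Fin n, ⁅coroot k n i, v⁆ = (c i : ℂ) • v

/-! ### Invariant extensions between completely reducible bundles -/

section Ext

variable (k n : ℕ) (E F H : Type*)
  [AddCommGroup E] [Module ℂ E] [LieRingModule (levi k n) E] [LieModule ℂ (levi k n) E]
  [AddCommGroup F] [Module ℂ F] [LieRingModule (levi k n) F] [LieModule ℂ (levi k n) F]
  [AddCommGroup H] [Module ℂ H] [LieRingModule (levi k n) H] [LieModule ℂ (levi k n) H]

/-- `Ext¹(E, F)^G = Hom(E ⊗ Ω¹, F)^G = Hom_𝓡(𝓝 ⊗ E, F)` for `𝓡`-modules `E`, `F`, in curried form: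
the `𝓡`-equivariant linear maps `𝓝 → Hom(E, F)`. -/
abbrev Ext1 : Type _ := nilradical k n →ₗ⁅ℂ, levi k n⁆ (E →ₗ[ℂ] F)

/-- `Ext²(E, F)^G = Hom(E ⊗ Ω², F)^G = Hom_𝓡(Λ²𝓝 ⊗ E, F)` for `𝓡`-modules `E`, `F`, in curried
form: the `𝓡`-equivariant alternating bilinear maps `𝓝 × 𝓝 → Hom(E, F)`. -/
def Ext2 : Submodule ℂ (nilradical k n →ₗ⁅ℂ, levi k n⁆ nilradical k n →ₗ[ℂ] E →ₗ[ℂ] F) where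
  carrier := {ω | ∀ x, ω x x = 0}
  zero_mem' := by intro x; simp
  add_mem' := by intro a b ha hb x; simp [ha x, hb x]
  smul_mem' := by intro c a ha x; simp [ha x]

variable {k n E F H}

/-- The Yoneda product `m' ∧ m ∈ Ext²(E, H)^G` of `m' ∈ Ext¹(F, H)^G` and `m ∈ Ext¹(E, F)^G`:
`(m' ∧ m)(x ∧ y ⊗ e) = m'(x ⊗ m(y ⊗ e)) - m'(y ⊗ m(x ⊗ e))`. -/
def wedge (m' : Ext1 k n F H) (m : Ext1 k n E F) : Ext2 k n E H :=
  ⟨{ toFun := fun x =>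
      { toFun := fun y => m' x ∘ₗ m y - m' y ∘ₗ m x
        map_add' := by
          intro y z
          simp only [map_add, LinearMap.comp_add, LinearMap.add_comp]
          abel
        map_smul' := by
          intro c y
          simp only [map_smul, LinearMap.comp_smul, LinearMap.smul_comp, smul_sub,
            RingHom.id_apply] }
     map_add' := by
      intro x z
      ext y e
      simp
      abel
     map_smul' := by
      intro c x
      ext y e
      simp [smul_sub]
     map_lie' := by
      intro r x
      ext y e
      simp [LieHom.lie_apply]
      abel },
    by intro x; ext e; simp⟩

end Ext

/-! ### The relations of the quiver -/

section Relations

variable {k n : ℕ} {E : Vertex k n → Type*}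
  [∀ a, AddCommGroup (E a)] [∀ a, Module ℂ (E a)]
  [∀ a, LieRingModule (levi k n) (E a)] [∀ a, LieModule ℂ (levi k n) (E a)]

/-- The family `m_{μλ} ∈ Ext¹(E_λ, E_μ)^G` is normalized with respect to the maximal vectors `v_λ`
and the root vectors `n_{p,q}`: if `μ = λ_{p,q}` then `m_{μλ}` takes `n_{p,q} ⊗ v_λ` to `v_μ`.
The element `m_{μλ}` is written `m λ μ`. -/
def IsNormalized (v : ∀ a, E a) (m : ∀ a b, Ext1 k n (E a) (E b)) : Prop :=
  ∀ (a b : Vertex k n) (p : Fin (k + 1)) (q : Fin (n - k)),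
    b.1 = a.1 + rootWeight k n p q → m a b (rootVector k n p q) (v a) = v b

variable {V : Vertex k n → Type*} [∀ a, AddCommGroup (V a)] [∀ a, Module ℂ (V a)]

/-- The composition `g_{νμ} g_{μλ} : V_λ → V_ν` along the path `λ → μ → ν`. -/
def path (g : ∀ a b, V a →ₗ[ℂ] V b) (a b c : Vertex k n) : V a →ₗ[ℂ] V c := g b c ∘ₗ g a b

/-- The quadratic relation from the point `λ` to the point `ν`, for a representation of the quiver
given by vector spaces `V_λ` and linear maps `g_{μλ} : V_λ → V_μ` (written `g λ μ`):
`∑_μ (g_{νμ} g_{μλ}) (m_{νμ} ∧ m_{μλ}) = 0` in `Hom(V_λ, V_ν) ⊗ Ext²(E_λ, E_ν)^G`.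
Only the `μ` with arrows `λ → μ → ν` contribute, since `m_{μλ} ∈ Ext¹(E_λ, E_μ)^G` is zero if there
is no arrow `λ → μ`; so the values of `g` at pairs of points without an arrow play no role. -/
def Relation (m : ∀ a b, Ext1 k n (E a) (E b)) (g : ∀ a b, V a →ₗ[ℂ] V b)
    (a c : Vertex k n) : Prop :=
  ∑ᶠ b : Vertex k n, path g a b c ⊗ₜ[ℂ] wedge (m b c) (m a b) = 0

end Relations

end

end GrassmannQuiver

/-! The `𝓡`-modules are treated as modules over `gl(k+1) × gl(n-k)`, through the traceless parts of
the elementary matrices of the two blocks, in such a way that the root vectors `n_{p,q}` become the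
standard basis of `ℂ^{k+1} ⊗ ℂ^{n-k}`. An element of `Ext¹` or `Ext²` is then a family of operators
indexed by one or two pairs `(p, q)` and compatible with the action.

*Singular vectors.* Evaluated at a maximal vector `v`, such a family is killed by the raising
operators up to terms with smaller indices. Since an irreducible module has only one singular vector
up to scalars (`IsHighest.exists_eq_smul`), the family is determined by those of its values on `v`
that have the maximal weight of the target. This bounds `Ext¹` by one dimension, and `Ext²` by the
two values `ω(n_{p₁,q₁} ∧ n_{p₂,q₂} ⊗ v)` and `ω(n_{p₁,q₂} ∧ n_{p₂,q₁} ⊗ v)`, which are multiples of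
the maximal vector (`ext2_eq_zero`). If `p̃ = 1` or `q̃ = 1`, a simple lowering operator kills `v`, and
this yields a linear relation between the two values (`IsBiFamily.swap_first`).

*Existence of the generators.* A singular vector of `Hom(ℂ^a ⊗ ℂ^b, F)` with prescribed leading
entry is written down by a recursion for its entries (`lowering_raise`). The operator `omegaA`, a
Casimir tensor, separates it from the other singular vectors, so the graph construction of
`IsHighest.exists_linearMap` extends it to an equivariant map on the irreducible module `E`.

*Coefficients.* The eigenvalue of `omegaA` also expresses the entry `φ(n_{p₂,q}) v` of a
singular vector by lowering operators applied to the entries above it. Composed with a second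
equivariant map only one term survives, and interchanging `p₁` and `p₂` multiplies the composition by
`-1 / p̃` (`IsFamily.two_step`). Together with the vanishing of `φ(n_{p,q}) v` for `p` above the row of
the added box, this gives the two values for each product `m ∧ m` (`GLAction.IsPath`). The
products that exist span as large a space as the upper bound allows, which gives the dimension of
`Ext²`, and reading the relation in the coordinates given by the two values gives the equations. -/

namespace GrassmannQuiver

/-! ### Modules over `gl(a) × gl(b)` -/

/-- The operators `A i j` satisfy the commutation relations of the elementary matrices `E_{i,j}`. -/
def IsGLFamily {a : ℕ} {E : Type*} [AddCommGroup E] [Module ℂ E]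
    (A : Fin a → Fin a → Module.End ℂ E) : Prop :=
  ∀ i j k l x, A i j (A k l x) =
    A k l (A i j x) + ((if j = k then A i l x else 0) - (if i = l then A k j x else 0))

/-- An action of `gl(a) × gl(b)` on `E`, given by the operators of the elementary matrices of the
two factors. -/
structure GLAction (a b : ℕ) (E : Type*) [AddCommGroup E] [Module ℂ E] where
  /-- the operators of the elementary matrices of `gl(a)` -/
  A : Fin a → Fin a → Module.End ℂ E
  /-- the operators of the elementary matrices of `gl(b)` -/
  B : Fin b → Fin b → Module.End ℂ E
  relA : IsGLFamily A
  relB : IsGLFamily B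
  comm : ∀ i j k l x, A i j (B k l x) = B k l (A i j x)

namespace GLAction

variable {a b : ℕ} {E F : Type*} [AddCommGroup E] [Module ℂ E] [AddCommGroup F] [Module ℂ F]

/-- The same action, with the two factors interchanged. It transfers statements about the first
factor to the second one. -/
@[simps] def swap (ρ : GLAction a b E) : GLAction b a E where
  A := ρ.B
  B := ρ.A
  relA := ρ.relB
  relB := ρ.relA
  comm i j k l x := (ρ.comm k l i j x).symm

/-- `y` is a weight vector (or zero) of weight `(α, β)`. -/
structure IsWeight (ρ : GLAction a b E) (α : Fin a → ℂ) (β : Fin b → ℂ) (y : E) : Prop where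
  wtA : ∀ i, ρ.A i i y = α i • y
  wtB : ∀ i, ρ.B i i y = β i • y

/-- `y` is a weight vector (or zero) of weight `(α, β)` that is killed by the raising operators. -/
structure IsSingular (ρ : GLAction a b E) (α : Fin a → ℂ) (β : Fin b → ℂ) (y : E) : Prop
    extends ρ.IsWeight α β y where
  raiseA : ∀ i j, i < j → ρ.A i j y = 0
  raiseB : ∀ i j, i < j → ρ.B i j y = 0

/-- `K` is a submodule for the action of `gl(a) × gl(b)`. -/
structure Invariant (ρ : GLAction a b E) (K : Submodule ℂ E) : Prop where
  invA : ∀ i j, ∀ x ∈ K, ρ.A i j x ∈ K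
  invB : ∀ i j, ∀ x ∈ K, ρ.B i j x ∈ K

/-- `E` is irreducible (nonzero, since it contains `v ≠ 0`, and without proper nonzero submodules),
and `v` is a maximal vector of it, of weight `(α, β)`. -/
structure IsHighest (ρ : GLAction a b E) (α : Fin a → ℂ) (β : Fin b → ℂ) (v : E) : Prop
    extends ρ.IsSingular α β v where
  ne_zero : v ≠ 0
  irred : ∀ K, ρ.Invariant K → K = ⊥ ∨ K = ⊤

theorem IsWeight.swap {ρ : GLAction a b E} {α β y} (h : ρ.IsWeight α β y) :
    ρ.swap.IsWeight β α y := ⟨h.wtB, h.wtA⟩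

theorem IsSingular.swap {ρ : GLAction a b E} {α β y} (h : ρ.IsSingular α β y) :
    ρ.swap.IsSingular β α y := ⟨h.toIsWeight.swap, h.raiseB, h.raiseA⟩

theorem Invariant.swap {ρ : GLAction a b E} {K} (h : ρ.Invariant K) : ρ.swap.Invariant K :=
  ⟨h.invB, h.invA⟩

theorem IsHighest.swap {ρ : GLAction a b E} {α β y} (h : ρ.IsHighest α β y) :
    ρ.swap.IsHighest β α y :=
  ⟨h.toIsSingular.swap, h.ne_zero, fun K hK => h.irred K hK.swap⟩

theorem IsSingular.sub_smul {ρ : GLAction a b E} {α β x y} (hx : ρ.IsSingular α β x)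
    (hy : ρ.IsSingular α β y) (c : ℂ) : ρ.IsSingular α β (x - c • y) where
  wtA i := by rw [map_sub, map_smul, hx.wtA, hy.wtA, smul_sub, smul_comm]
  wtB i := by rw [map_sub, map_smul, hx.wtB, hy.wtB, smul_sub, smul_comm]
  raiseA i j h := by rw [map_sub, map_smul, hx.raiseA i j h, hy.raiseA i j h, smul_zero, sub_zero]
  raiseB i j h := by rw [map_sub, map_smul, hx.raiseB i j h, hy.raiseB i j h, smul_zero, sub_zero]

/-! ### Highest weight modules -/

/-- The vectors obtained from `x` by applying lowering operators successively. -/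
inductive Word (ρ : GLAction a b E) (x : E) : E → Prop
  | base : Word ρ x x
  | lowerA (i j : Fin a) (h : j < i) (y : E) : Word ρ x y → Word ρ x (ρ.A i j y)
  | lowerB (i j : Fin b) (h : j < i) (y : E) : Word ρ x y → Word ρ x (ρ.B i j y)

/-- The span of the vectors obtained from `x` by applying lowering operators. -/
def gen (ρ : GLAction a b E) (x : E) : Submodule ℂ E := Submodule.span ℂ {y | ρ.Word x y}

theorem mem_gen_self (ρ : GLAction a b E) (x : E) : x ∈ ρ.gen x :=
  Submodule.subset_span Word.base

theorem gen_lowerA (ρ : GLAction a b E) (x : E) {i j : Fin a} (h : j < i) {y : E}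
    (hy : y ∈ ρ.gen x) : ρ.A i j y ∈ ρ.gen x := by
  have : ρ.gen x ≤ (ρ.gen x).comap (ρ.A i j) :=
    Submodule.span_le.2 fun z hz => Submodule.subset_span (Word.lowerA i j h z hz)
  exact this hy

theorem gen_lowerB (ρ : GLAction a b E) (x : E) {i j : Fin b} (h : j < i) {y : E}
    (hy : y ∈ ρ.gen x) : ρ.B i j y ∈ ρ.gen x := by
  have : ρ.gen x ≤ (ρ.gen x).comap (ρ.B i j) :=
    Submodule.span_le.2 fun z hz => Submodule.subset_span (Word.lowerB i j h z hz)
  exact this hy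

/-- A singular vector generates a submodule under the lowering operators alone. -/
theorem IsSingular.invariant_gen {ρ : GLAction a b E} {α β x} (hx : ρ.IsSingular α β x) :
    ρ.Invariant (ρ.gen x) := by
  have key : ∀ y, ρ.Word x y → (∀ i j, ρ.A i j y ∈ ρ.gen x) ∧ (∀ i j, ρ.B i j y ∈ ρ.gen x) := by
    intro y hy
    induction hy with
    | base =>
      refine ⟨fun i j => ?_, fun i j => ?_⟩
      · rcases lt_trichotomy i j with h | rfl | h
        · rw [hx.raiseA i j h]; exact zero_mem _
        · rw [hx.wtA]; exact Submodule.smul_mem _ _ (ρ.mem_gen_self x)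
        · exact ρ.gen_lowerA x h (ρ.mem_gen_self x)
      · rcases lt_trichotomy i j with h | rfl | h
        · rw [hx.raiseB i j h]; exact zero_mem _
        · rw [hx.wtB]; exact Submodule.smul_mem _ _ (ρ.mem_gen_self x)
        · exact ρ.gen_lowerB x h (ρ.mem_gen_self x)
    | lowerA i j h y hy ih =>
      refine ⟨fun l m => ?_, fun l m => ?_⟩
      · rw [ρ.relA l m i j y]
        refine add_mem (ρ.gen_lowerA x h (ih.1 l m)) (sub_mem ?_ ?_)
        · split_ifs
          · exact ih.1 _ _
          · exact zero_mem _
        · split_ifs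
          · exact ih.1 _ _
          · exact zero_mem _
      · rw [← ρ.comm]
        exact ρ.gen_lowerA x h (ih.2 l m)
    | lowerB i j h y hy ih =>
      refine ⟨fun l m => ?_, fun l m => ?_⟩
      · rw [ρ.comm]
        exact ρ.gen_lowerB x h (ih.1 l m)
      · rw [ρ.relB l m i j y]
        refine add_mem (ρ.gen_lowerB x h (ih.2 l m)) (sub_mem ?_ ?_)
        · split_ifs
          · exact ih.2 _ _
          · exact zero_mem _
        · split_ifs
          · exact ih.2 _ _
          · exact zero_mem _
  constructor
  · intro i j
    have : ρ.gen x ≤ (ρ.gen x).comap (ρ.A i j) :=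
      Submodule.span_le.2 fun z hz => (key z hz).1 i j
    exact fun y hy => this hy
  · intro i j
    have : ρ.gen x ≤ (ρ.gen x).comap (ρ.B i j) :=
      Submodule.span_le.2 fun z hz => (key z hz).2 i j
    exact fun y hy => this hy

/-- The operator `s ∑ i A_{ii} + t ∑ q B_{qq}` of the Cartan subalgebra. For `s, t ∈ ℕ`, lowering
operators increase its eigenvalues by natural numbers. -/
noncomputable def depth (ρ : GLAction a b E) (s t : ℕ) : Module.End ℂ E :=
  (s : ℂ) • ∑ i : Fin a, (i : ℂ) • ρ.A i i + (t : ℂ) • ∑ i : Fin b, (i : ℂ) • ρ.B i i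

/-- The eigenvalue of `depth` on vectors of weight `(α, β)`. -/
noncomputable def depthValue (s t : ℕ) (α : Fin a → ℂ) (β : Fin b → ℂ) : ℂ :=
  (s : ℂ) * ∑ i : Fin a, (i : ℂ) * α i + (t : ℂ) * ∑ i : Fin b, (i : ℂ) * β i

theorem IsWeight.depth {ρ : GLAction a b E} {α β y} (h : ρ.IsWeight α β y) (s t : ℕ) :
    ρ.depth s t y = depthValue s t α β • y := by
  simp [GLAction.depth, depthValue, h.wtA, h.wtB, add_smul, smul_smul, Finset.sum_smul,
    Finset.smul_sum, Finset.mul_sum, mul_assoc]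

theorem depth_A (ρ : GLAction a b E) (s t : ℕ) (i j : Fin a) (x : E) :
    ρ.depth s t (ρ.A i j x) = ρ.A i j (ρ.depth s t x) + ((s : ℂ) * (i - j)) • ρ.A i j x := by
  have h1 : ∀ k : Fin a, ρ.A k k (ρ.A i j x) = ρ.A i j (ρ.A k k x) +
      ((if k = i then ρ.A i j x else 0) - (if k = j then ρ.A i j x else 0)) := by
    intro k
    rw [ρ.relA k k i j x]
    congr 2
    · split_ifs with h
      · rw [h]
      · rfl
    · split_ifs with h
      · rw [h]
      · rfl
  simp only [depth, LinearMap.add_apply, LinearMap.smul_apply, LinearMap.sum_apply, h1, ← ρ.comm,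
    map_add, map_smul, map_sum, smul_add, smul_sub, Finset.sum_add_distrib,
    Finset.sum_sub_distrib]
  simp only [smul_ite, smul_zero, Finset.sum_ite_eq', Finset.mem_univ, if_true]
  module

theorem depth_B (ρ : GLAction a b E) (s t : ℕ) (i j : Fin b) (x : E) :
    ρ.depth s t (ρ.B i j x) = ρ.B i j (ρ.depth s t x) + ((t : ℂ) * (i - j)) • ρ.B i j x := by
  have h := ρ.swap.depth_A t s i j x
  simp only [depth, swap_A, swap_B] at h ⊢
  rw [add_comm ((s : ℂ) • _), h]

theorem Word.depth {ρ : GLAction a b E} {x y : E} (hy : ρ.Word x y) {s t : ℕ} {d : ℂ}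
    (hx : ρ.depth s t x = d • x) :
    ∃ r : ℕ, ρ.depth s t y = (d + r) • y ∧ (0 < s → 0 < t → r = 0 → y = x) := by
  induction hy with
  | base => exact ⟨0, by simpa using hx, fun _ _ _ => rfl⟩
  | lowerA i j h y hy ih =>
    obtain ⟨r, hr, -⟩ := ih
    refine ⟨r + s * (i - j), ?_, ?_⟩
    · rw [depth_A, hr, map_smul, ← add_smul]
      have h' : (j : ℕ) ≤ i := h.le
      push_cast [h']
      ring_nf
    · intro h1 _ h2
      have h' : (j : ℕ) < i := h
      have := Nat.mul_pos h1 (Nat.sub_pos_of_lt h')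
      omega
  | lowerB i j h y hy ih =>
    obtain ⟨r, hr, -⟩ := ih
    refine ⟨r + t * (i - j), ?_, ?_⟩
    · rw [depth_B, hr, map_smul, ← add_smul]
      have h' : (j : ℕ) ≤ i := h.le
      push_cast [h']
      ring_nf
    · intro _ h1 h2
      have h' : (j : ℕ) < i := h
      have := Nat.mul_pos h1 (Nat.sub_pos_of_lt h')
      omega

/-- The depths that occur in a highest weight module exceed the depth of the generator by natural
numbers. -/
theorem exists_depth_eq {ρ : GLAction a b E} {x y : E} {s t : ℕ} {d e : ℂ}
    (hx : ρ.depth s t x = d • x) (hy : y ∈ ρ.gen x) (hy0 : y ≠ 0) (hye : ρ.depth s t y = e • y) :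
    ∃ r : ℕ, e = d + r := by
  by_contra! hr
  have hle : ρ.gen x ≤ ⨆ μ, ⨆ (_ : μ ≠ e), (ρ.depth s t).eigenspace μ := by
    refine Submodule.span_le.2 fun z hz => ?_
    obtain ⟨r, hzr, -⟩ := Word.depth hz hx
    exact Submodule.mem_iSup_of_mem (d + r) (Submodule.mem_iSup_of_mem (hr r).symm
      (Module.End.mem_eigenspace_iff.2 hzr))
  have hdis := (Module.End.eigenspaces_iSupIndep (ρ.depth s t)) e
  exact hy0 (Submodule.disjoint_def.1 hdis y (Module.End.mem_eigenspace_iff.2 hye) (hle hy))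

/-- In a highest weight module, the vectors of the same depth as the generator are its
multiples. -/
theorem exists_eq_smul_of_depth {ρ : GLAction a b E} {x y : E} {d : ℂ}
    (hx : ρ.depth 1 1 x = d • x) (hy : y ∈ ρ.gen x) (hyd : ρ.depth 1 1 y = d • y) :
    ∃ c : ℂ, y = c • x := by
  have hle : ρ.gen x ≤ Submodule.span ℂ {x} ⊔ ⨆ μ, ⨆ (_ : μ ≠ d), (ρ.depth 1 1).eigenspace μ := by
    refine Submodule.span_le.2 fun z hz => ?_
    obtain ⟨r, hzr, h0⟩ := Word.depth hz hx
    rcases Nat.eq_zero_or_pos r with hr | hr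
    · rw [h0 one_pos one_pos hr]
      exact Submodule.mem_sup_left (Submodule.mem_span_singleton_self x)
    · refine Submodule.mem_sup_right (Submodule.mem_iSup_of_mem (d + r)
        (Submodule.mem_iSup_of_mem ?_ (Module.End.mem_eigenspace_iff.2 hzr)))
      simpa using hr.ne'
  obtain ⟨y₁, h₁, y₂, h₂, rfl⟩ := Submodule.mem_sup.1 (hle hy)
  obtain ⟨c, rfl⟩ := Submodule.mem_span_singleton.1 h₁
  refine ⟨c, ?_⟩
  have hdis := (Module.End.eigenspaces_iSupIndep (ρ.depth 1 1)) d
  have h3 : y₂ ∈ (ρ.depth 1 1).eigenspace d := by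
    rw [Module.End.mem_eigenspace_iff]
    rw [map_add, map_smul, hx, smul_add, smul_comm d c] at hyd
    exact add_left_cancel hyd
  rw [Submodule.disjoint_def.1 hdis y₂ h3 h₂, add_zero]

variable {ρ : GLAction a b E} {α α' : Fin a → ℂ} {β β' : Fin b → ℂ} {v y : E}

theorem IsHighest.gen_eq_top (hv : ρ.IsHighest α β v) {w : E} (hw : ρ.IsSingular α' β' w)
    (hw0 : w ≠ 0) : ρ.gen w = ⊤ := by
  refine (hv.irred _ hw.invariant_gen).resolve_left fun h => hw0 ?_
  have := ρ.mem_gen_self w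
  rwa [h, Submodule.mem_bot] at this

/-- An irreducible module has only one singular vector up to scalars. -/
theorem IsHighest.exists_eq_smul (hv : ρ.IsHighest α β v) {w : E} (hw : ρ.IsSingular α' β' w) :
    ∃ c : ℂ, w = c • v := by
  by_cases hw0 : w = 0
  · exact ⟨0, by simp [hw0]⟩
  have h1 := hv.gen_eq_top hv.toIsSingular hv.ne_zero
  have h2 := hv.gen_eq_top hw hw0
  have d1 := hv.toIsWeight.depth 1 1
  have d2 := hw.toIsWeight.depth 1 1
  obtain ⟨r, hr⟩ := exists_depth_eq d1 (h1 ▸ Submodule.mem_top) hw0 d2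
  obtain ⟨r', hr'⟩ := exists_depth_eq d2 (h2 ▸ Submodule.mem_top) hv.ne_zero d1
  have h3 : ((r + r' : ℕ) : ℂ) = 0 := by
    push_cast
    linear_combination -hr - hr'
  have h4 : r = 0 := by
    have := Nat.cast_eq_zero.1 h3
    omega
  rw [hr, h4, Nat.cast_zero, add_zero] at d2
  exact exists_eq_smul_of_depth d1 (h1 ▸ Submodule.mem_top) d2

/-- The weight space of the maximal weight is one-dimensional. -/
theorem IsHighest.exists_eq_smul_of_isWeight (hv : ρ.IsHighest α β v) (hy : ρ.IsWeight α β y) :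
    ∃ c : ℂ, y = c • v :=
  exists_eq_smul_of_depth (hv.toIsWeight.depth 1 1)
    (hv.gen_eq_top hv.toIsSingular hv.ne_zero ▸ Submodule.mem_top) (hy.depth 1 1)

theorem sum_mul_single (α : Fin a → ℂ) (k : Fin a) :
    ∑ i : Fin a, (i : ℂ) * (α + Pi.single k 1 : Fin a → ℂ) i = ∑ i : Fin a, (i : ℂ) * α i + k := by
  simp [mul_add, Finset.sum_add_distrib, Pi.single_apply]

/-- A weight vector vanishes if its weight exceeds the maximal one on the first factor. -/
theorem IsHighest.eq_zero_of_lt (hv : ρ.IsHighest α β v) {γ : Fin a → ℂ} {j k : Fin a}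
    (hα : α = γ + Pi.single j 1) (hα' : α' = γ + Pi.single k 1) (hkj : k < j)
    (hy : ρ.IsWeight α' β' y) : y = 0 := by
  by_contra hy0
  obtain ⟨r, hr⟩ := exists_depth_eq (hv.toIsWeight.depth 1 0)
    (hv.gen_eq_top hv.toIsSingular hv.ne_zero ▸ Submodule.mem_top) hy0 (hy.depth 1 0)
  rw [hα, hα', depthValue, depthValue, sum_mul_single, sum_mul_single] at hr
  have h1 : ((k : ℕ) : ℂ) = ((j + r : ℕ) : ℂ) := by
    push_cast at hr ⊢
    linear_combination hr
  have h2 := Nat.cast_injective h1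
  have h3 : (k : ℕ) < j := hkj
  omega

/-! ### Singular vectors in finite dimensional modules -/

/-- Commuting operators have a common eigenvector on every nonzero finite dimensional space that
they preserve. -/
theorem exists_common_eigenvector [FiniteDimensional ℂ E] {ι : Type*} (t : Finset ι)
    (T : ι → Module.End ℂ E) (hT : ∀ i j x, T i (T j x) = T j (T i x)) :
    ∀ P : Submodule ℂ E, P ≠ ⊥ → (∀ i, ∀ x ∈ P, T i x ∈ P) →
      ∃ x ∈ P, x ≠ 0 ∧ ∀ i ∈ t, ∃ c : ℂ, T i x = c • x := by
  classical
  induction t using Finset.induction_on with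
  | empty =>
    intro P hP _
    obtain ⟨x, hx, hx0⟩ := Submodule.exists_mem_ne_zero_of_ne_bot hP
    exact ⟨x, hx, hx0, by simp⟩
  | insert i t _ ih =>
    intro P hP hPT
    have : Nontrivial P := Submodule.nontrivial_iff_ne_bot.2 hP
    obtain ⟨c, hc⟩ := Module.End.exists_eigenvalue ((T i).restrict (hPT i))
    obtain ⟨y, hy⟩ := hc.exists_hasEigenvector
    have hy1 : T i y = c • (y : E) := congrArg Subtype.val hy.apply_eq_smul
    obtain ⟨x, hx, hx0, hxt⟩ := ih (P ⊓ (T i).eigenspace c)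
      (fun h => hy.2 (Subtype.ext ((Submodule.mem_bot ℂ).1
        (h ▸ ⟨y.2, Module.End.mem_eigenspace_iff.2 hy1⟩))))
      (fun j z hz => ⟨hPT j z hz.1, Module.End.mem_eigenspace_iff.2 (by
        rw [hT, Module.End.mem_eigenspace_iff.1 hz.2, map_smul])⟩)
    refine ⟨x, hx.1, hx0, fun j hj => ?_⟩
    rcases Finset.mem_insert.1 hj with rfl | hj
    · exact ⟨c, Module.End.mem_eigenspace_iff.1 hx.2⟩
    · exact hxt j hj

theorem A_diag_comm (ρ : GLAction a b E) (i j : Fin a) (x : E) :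
    ρ.A i i (ρ.A j j x) = ρ.A j j (ρ.A i i x) := by
  rw [ρ.relA i i j j x]
  split_ifs with h
  · subst h; simp
  · simp

theorem depth_diagA (ρ : GLAction a b E) (s t : ℕ) (i : Fin a) (x : E) :
    ρ.depth s t (ρ.A i i x) = ρ.A i i (ρ.depth s t x) := by
  rw [depth_A]; simp

theorem depth_diagB (ρ : GLAction a b E) (s t : ℕ) (i : Fin b) (x : E) :
    ρ.depth s t (ρ.B i i x) = ρ.B i i (ρ.depth s t x) := by
  rw [depth_B]; simp

/-- Every nonzero submodule of a finite dimensional module contains a nonzero singular vector. -/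
theorem Invariant.exists_isSingular [FiniteDimensional ℂ E] {K : Submodule ℂ E}
    (hK : ρ.Invariant K) (hK0 : K ≠ ⊥) :
    ∃ (α : Fin a → ℂ) (β : Fin b → ℂ) (x : E), x ∈ K ∧ x ≠ 0 ∧ ρ.IsSingular α β x := by
  have hKD : ∀ x ∈ K, ρ.depth 1 1 x ∈ K := by
    intro x hx
    simp only [depth, LinearMap.add_apply, LinearMap.smul_apply, LinearMap.sum_apply]
    exact add_mem (K.smul_mem _ (sum_mem fun i _ => K.smul_mem _ (hK.invA i i x hx)))
      (K.smul_mem _ (sum_mem fun i _ => K.smul_mem _ (hK.invB i i x hx)))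
  let D : Module.End ℂ K := (ρ.depth 1 1).restrict hKD
  have : Nontrivial K := Submodule.nontrivial_iff_ne_bot.2 hK0
  -- the raising operators kill the part of `K` of minimal depth
  obtain ⟨z, hz, hzmin⟩ := Set.exists_min_image {μ | D.HasEigenvalue μ} Complex.re
    D.finite_hasEigenvalue (Module.End.exists_eigenvalue D)
  obtain ⟨y, hy⟩ := Module.End.HasEigenvalue.exists_hasEigenvector hz
  have hy1 : ρ.depth 1 1 y = z • (y : E) := congrArg Subtype.val hy.apply_eq_smul
  have hmin : ∀ x ∈ K, ∀ e : ℂ, e.re < z.re → ρ.depth 1 1 x = e • x → x = 0 := by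
    intro x hx e he hxe
    by_contra hx0
    refine absurd (hzmin e ?_) (not_le.2 he)
    refine Module.End.hasEigenvalue_of_hasEigenvector (x := ⟨x, hx⟩) ⟨?_, ?_⟩
    · exact Module.End.mem_eigenspace_iff.2 (Subtype.ext hxe)
    · exact fun h => hx0 (congrArg Subtype.val h)
  obtain ⟨x, hx, hx0, hxe⟩ := exists_common_eigenvector Finset.univ
    (fun i : Fin a ⊕ Fin b => Sum.elim (fun i => ρ.A i i) (fun i => ρ.B i i) i)
    (by
      rintro (i | i) (j | j) x
      · exact ρ.A_diag_comm i j x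
      · exact ρ.comm i i j j x
      · exact (ρ.comm j j i i x).symm
      · exact ρ.swap.A_diag_comm i j x)
    (K ⊓ (ρ.depth 1 1).eigenspace z)
    (fun h => hy.2 (Subtype.ext ((Submodule.mem_bot ℂ).1
      (h ▸ ⟨y.2, Module.End.mem_eigenspace_iff.2 hy1⟩))))
    (by
      rintro (i | i) x hx
      · refine ⟨hK.invA i i x hx.1, Module.End.mem_eigenspace_iff.2 ?_⟩
        simp only [Sum.elim_inl]
        rw [depth_diagA, Module.End.mem_eigenspace_iff.1 hx.2, map_smul]
      · refine ⟨hK.invB i i x hx.1, Module.End.mem_eigenspace_iff.2 ?_⟩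
        simp only [Sum.elim_inr]
        rw [depth_diagB, Module.End.mem_eigenspace_iff.1 hx.2, map_smul])
  have hxz := Module.End.mem_eigenspace_iff.1 hx.2
  choose c hc using fun i => hxe i (Finset.mem_univ i)
  refine ⟨fun i => c (.inl i), fun i => c (.inr i), x, hx.1, hx0,
    ⟨fun i => hc (.inl i), fun i => hc (.inr i)⟩, fun i j hij => ?_, fun i j hij => ?_⟩
  · refine hmin _ (hK.invA i j x hx.1) (z + (i - j)) ?_ ?_
    · have : ((i : ℕ) : ℝ) < (j : ℕ) := Nat.cast_lt.2 hij
      simpa using this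
    · rw [depth_A, hxz, map_smul]
      module
  · refine hmin _ (hK.invB i j x hx.1) (z + (i - j)) ?_ ?_
    · have : ((i : ℕ) : ℝ) < (j : ℕ) := Nat.cast_lt.2 hij
      simpa using this
    · rw [depth_B, hxz, map_smul]
      module

end GLAction

namespace GLAction

variable {a b : ℕ} {E F : Type*} [AddCommGroup E] [Module ℂ E] [AddCommGroup F] [Module ℂ F]
  {ρ : GLAction a b E} {α α' : Fin a → ℂ} {β β' : Fin b → ℂ} {v : E}

/-- A family of weight vectors of an irreducible module, graded by natural numbers in such a way
that raising operators lower the degree, vanishes if no member has the maximal weight. -/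
theorem IsHighest.exists_of_ne_zero (hv : ρ.IsHighest α β v) {I : Type*} {s : I → E} (h : I → ℕ)
    {wA : I → Fin a → ℂ} {wB : I → Fin b → ℂ} (hw : ∀ i, ρ.IsWeight (wA i) (wB i) (s i))
    (hA : ∀ i l m, l < m → (∀ j, h j < h i → s j = 0) → ρ.A l m (s i) = 0)
    (hB : ∀ i l m, l < m → (∀ j, h j < h i → s j = 0) → ρ.B l m (s i) = 0)
    (hs : ∃ i, s i ≠ 0) : ∃ i, s i ≠ 0 ∧ α = wA i ∧ β = wB i := by
  obtain ⟨i, hi, hmin⟩ := WellFounded.has_min (measure h).wf {i | s i ≠ 0} hs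
  have hmin' : ∀ j, h j < h i → s j = 0 := fun j hj => by
    by_contra hj0
    exact hmin j hj0 hj
  obtain ⟨c, hc⟩ := hv.exists_eq_smul
    (⟨hw i, fun l m hlm => hA i l m hlm hmin', fun l m hlm => hB i l m hlm hmin'⟩ :
      ρ.IsSingular (wA i) (wB i) (s i))
  have hi' : s i ≠ 0 := hi
  refine ⟨i, hi, funext fun l => ?_, funext fun l => ?_⟩
  · have h1 := (hw i).wtA l
    rw [hc, map_smul, hv.wtA, smul_comm, ← hc] at h1
    exact smul_left_injective ℂ hi' h1
  · have h1 := (hw i).wtB l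
    rw [hc, map_smul, hv.wtB, smul_comm, ← hc] at h1
    exact smul_left_injective ℂ hi' h1

/-! ### The module `Hom(ℂ^a ⊗ ℂ^b, E)` -/

/-- The action on the space `Hom(ℂ^a ⊗ ℂ^b, E)`; a linear map is given by its values on the
standard basis. -/
@[simps] def hom (ρ : GLAction a b E) : GLAction a b (Fin a → Fin b → E) where
  A i j :=
    { toFun := fun s p q => ρ.A i j (s p q) - if p = j then s i q else 0
      map_add' := by
        intro s t
        ext p q
        simp only [Pi.add_apply, map_add]
        split_ifs <;> abel
      map_smul' := by
        intro c s
        ext p q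
        simp only [Pi.smul_apply, map_smul, RingHom.id_apply, smul_sub, smul_ite, smul_zero] }
  B i j :=
    { toFun := fun s p q => ρ.B i j (s p q) - if q = j then s p i else 0
      map_add' := by
        intro s t
        ext p q
        simp only [Pi.add_apply, map_add]
        split_ifs <;> abel
      map_smul' := by
        intro c s
        ext p q
        simp only [Pi.smul_apply, map_smul, RingHom.id_apply, smul_sub, smul_ite, smul_zero] }
  relA := by
    intro i j k l s
    ext p q
    simp only [LinearMap.coe_mk, AddHom.coe_mk, Pi.add_apply, Pi.sub_apply, map_sub, ite_apply,
      Pi.zero_apply, ρ.relA i j k l, apply_ite (ρ.A i j), apply_ite (ρ.A k l), map_zero,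
      eq_comm (a := k) (b := j)]
    split_ifs <;> abel
  relB := by
    intro i j k l s
    ext p q
    simp only [LinearMap.coe_mk, AddHom.coe_mk, Pi.add_apply, Pi.sub_apply, map_sub, ite_apply,
      Pi.zero_apply, ρ.relB i j k l, apply_ite (ρ.B i j), apply_ite (ρ.B k l), map_zero,
      eq_comm (a := k) (b := j)]
    split_ifs <;> abel
  comm := by
    intro i j k l s
    ext p q
    simp only [LinearMap.coe_mk, AddHom.coe_mk, map_sub, ρ.comm i j k l]
    by_cases h3 : p = j <;> by_cases h4 : q = l <;> (simp [h3, h4]; try abel)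

theorem isSingular_hom_iff {s : Fin a → Fin b → E} :
    ρ.hom.IsSingular α' β' s ↔
      (∀ p q, ρ.IsWeight (α' + Pi.single p 1) (β' + Pi.single q 1) (s p q)) ∧
      (∀ i j p q, i < j → ρ.A i j (s p q) = if p = j then s i q else 0) ∧
      (∀ i j p q, i < j → ρ.B i j (s p q) = if q = j then s p i else 0) := by
  constructor
  · intro h
    refine ⟨fun p q => ⟨fun i => ?_, fun i => ?_⟩, fun i j p q hij => ?_, fun i j p q hij => ?_⟩
    · have := congrFun (congrFun (h.wtA i) p) q
      simp only [hom_A_apply, Pi.smul_apply, sub_eq_iff_eq_add] at this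
      rw [this, Pi.add_apply, add_smul, Pi.single_apply]
      by_cases hi : p = i <;> simp [hi, eq_comm]
    · have := congrFun (congrFun (h.wtB i) p) q
      simp only [hom_B_apply, Pi.smul_apply, sub_eq_iff_eq_add] at this
      rw [this, Pi.add_apply, add_smul, Pi.single_apply]
      by_cases hi : q = i <;> simp [hi, eq_comm]
    · have := congrFun (congrFun (h.raiseA i j hij) p) q
      exact sub_eq_zero.1 this
    · have := congrFun (congrFun (h.raiseB i j hij) p) q
      exact sub_eq_zero.1 this
  · rintro ⟨h1, h2, h3⟩
    refine ⟨⟨fun i => ?_, fun i => ?_⟩, fun i j hij => ?_, fun i j hij => ?_⟩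
    · ext p q
      simp only [hom_A_apply, Pi.smul_apply, sub_eq_iff_eq_add]
      rw [(h1 p q).wtA, Pi.add_apply, add_smul, Pi.single_apply]
      by_cases hi : p = i <;> simp [hi, eq_comm]
      simp [Ne.symm hi]
    · ext p q
      simp only [hom_B_apply, Pi.smul_apply, sub_eq_iff_eq_add]
      rw [(h1 p q).wtB, Pi.add_apply, add_smul, Pi.single_apply]
      by_cases hi : q = i <;> simp [hi, eq_comm]
      simp [Ne.symm hi]
    · ext p q
      exact sub_eq_zero.2 (h2 i j p q hij)
    · ext p q
      exact sub_eq_zero.2 (h3 i j p q hij)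

/-- A nonzero singular vector of `Hom(ℂ^a ⊗ ℂ^b, E)` is nonzero on a basis vector whose image has
the maximal weight of `E`. -/
theorem IsHighest.hom_exists (hv : ρ.IsHighest α β v) {s : Fin a → Fin b → E}
    (hs : ρ.hom.IsSingular α' β' s) (hs0 : s ≠ 0) :
    ∃ p q, s p q ≠ 0 ∧ α = α' + Pi.single p 1 ∧ β = β' + Pi.single q 1 := by
  obtain ⟨h1, h2, h3⟩ := isSingular_hom_iff.1 hs
  obtain ⟨i, hi⟩ := hv.exists_of_ne_zero (s := fun i : Fin a × Fin b => s i.1 i.2)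
    (fun i => (i.1 : ℕ) + i.2) (fun i => h1 i.1 i.2)
    (fun i l m hlm hj => by
      rw [h2 l m i.1 i.2 hlm]
      split_ifs with h
      · exact hj (l, i.2) (by have : (l : ℕ) < m := hlm; simp only [h]; omega)
      · rfl)
    (fun i l m hlm hj => by
      rw [h3 l m i.1 i.2 hlm]
      split_ifs with h
      · exact hj (i.1, l) (by have : (l : ℕ) < m := hlm; simp only [h]; omega)
      · rfl)
    (by
      by_contra! h
      exact hs0 (funext fun p => funext fun q => h (p, q)))
  exact ⟨i.1, i.2, hi⟩

theorem single_one_injective : Function.Injective fun p : Fin a => (Pi.single p 1 : Fin a → ℂ) := by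
  intro p p' h
  have := congrFun h p
  simp only [Pi.single_eq_same, Pi.single_apply] at this
  by_contra hne
  simp [hne] at this

theorem IsHighest.hom_eq_zero (hv : ρ.IsHighest α β v) {s : Fin a → Fin b → E}
    (hs : ρ.hom.IsSingular α' β' s) {p : Fin a} {q : Fin b} (hα : α = α' + Pi.single p 1)
    (hβ : β = β' + Pi.single q 1) (h0 : s p q = 0) : s = 0 := by
  by_contra hs0
  obtain ⟨p', q', h1, h2, h3⟩ := hv.hom_exists hs hs0
  have hp : p = p' := single_one_injective (add_left_cancel (hα.symm.trans h2))
  have hq : q = q' := single_one_injective (add_left_cancel (hβ.symm.trans h3))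
  subst hp hq
  exact h1 h0

/-- The operator `s ↦ (p ↦ ∑ k, A p k (s k))` on `Hom(ℂ^a ⊗ ℂ^b, E)`: up to sign, the action of
the Casimir tensor of `gl(a)` on `(ℂ^a)^* ⊗ E`. -/
@[simps] def omegaA (ρ : GLAction a b E) : Module.End ℂ (Fin a → Fin b → E) where
  toFun s p q := ∑ k, ρ.A p k (s k q)
  map_add' s t := by ext; simp [Finset.sum_add_distrib]
  map_smul' c s := by ext; simp [Finset.smul_sum]

theorem omegaA_A (ρ : GLAction a b E) (l m : Fin a) (s : Fin a → Fin b → E) :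
    ρ.omegaA (ρ.hom.A l m s) = ρ.hom.A l m (ρ.omegaA s) := by
  ext p q
  simp only [omegaA_apply, hom_A_apply, map_sub, map_sum, ρ.relA l m p, Finset.sum_sub_distrib,
    Finset.sum_add_distrib]
  have h1 : ∑ k, ρ.A p k (if k = m then s l q else 0) = ρ.A p m (s l q) := by
    rw [Finset.sum_eq_single m]
    · simp
    · intro k _ hk; simp [hk]
    · simp
  have h2 : ∑ k, (if l = k then ρ.A p m (s k q) else 0) = ρ.A p m (s l q) := by simp
  have h3 : ∑ k, (if m = p then ρ.A l k (s k q) else 0) =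
      if p = m then ∑ k, ρ.A l k (s k q) else 0 := by
    by_cases h : p = m
    · simp [h]
    · simp [h, Ne.symm h]
  rw [h1, h2, h3]
  abel

theorem omegaA_B (ρ : GLAction a b E) (l m : Fin b) (s : Fin a → Fin b → E) :
    ρ.omegaA (ρ.hom.B l m s) = ρ.hom.B l m (ρ.omegaA s) := by
  ext p q
  simp only [omegaA_apply, hom_B_apply, map_sub, map_sum, ρ.comm, Finset.sum_sub_distrib]
  split_ifs <;> simp

theorem omegaA_isSingular {s : Fin a → Fin b → E} (hs : ρ.hom.IsSingular α' β' s) :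
    ρ.hom.IsSingular α' β' (ρ.omegaA s) where
  wtA i := by rw [← omegaA_A, hs.wtA, map_smul]
  wtB i := by rw [← omegaA_B, hs.wtB, map_smul]
  raiseA i j h := by rw [← omegaA_A, hs.raiseA i j h, map_zero]
  raiseB i j h := by rw [← omegaA_B, hs.raiseB i j h, map_zero]

/-- The operator `omegaA` acts by a scalar on the singular vectors of `Hom(ℂ^a ⊗ ℂ^b, E)` whose
weight is that of the maximal vector of `E` diminished by the `p`-th unit vector. -/
theorem IsHighest.omegaA_eq (hv : ρ.IsHighest α β v) {s : Fin a → Fin b → E}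
    (hs : ρ.hom.IsSingular α' β' s) {p : Fin a} {q : Fin b} (hα : α = α' + Pi.single p 1)
    (hβ : β = β' + Pi.single q 1) : ρ.omegaA s = (α p + ((a : ℂ) - 1 - p)) • s := by
  rw [← sub_eq_zero]
  refine hv.hom_eq_zero ((omegaA_isSingular hs).sub_smul hs _) hα hβ ?_
  obtain ⟨h1, h2, h3⟩ := isSingular_hom_iff.1 hs
  have key : ∀ k, ρ.A p k (s k q) =
      ((if k = p then α p else 0) + (if p < k then 1 else 0) : ℂ) • s p q := by
    intro k
    rcases lt_trichotomy k p with h | rfl | h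
    · rw [hv.eq_zero_of_lt hα rfl h (h1 k q)]
      simp [h.ne, h.not_gt]
    · rw [(h1 k q).wtA, hα]; simp
    · rw [h2 p k k q h]; simp [h.ne', h]
  have hcard : (∑ k : Fin a, if p < k then (1 : ℂ) else 0) = (a : ℂ) - 1 - p := by
    rw [Finset.sum_boole]
    have h4 : (Finset.univ.filter fun k : Fin a => p < k) = Finset.Ioi p := by ext; simp
    rw [h4, Fin.card_Ioi]
    have := p.isLt
    rw [Nat.sub_sub, Nat.cast_sub (by omega)]
    push_cast
    ring
  simp only [Pi.sub_apply, Pi.smul_apply, omegaA_apply, key]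
  rw [← Finset.sum_smul, Finset.sum_add_distrib, hcard]
  simp

/-- The entrywise form of `omegaA_eq`: a lower entry of a singular vector is obtained from the
higher ones by lowering operators. -/
theorem IsHighest.smul_entry (hv : ρ.IsHighest α β v) {s : Fin a → Fin b → E}
    (hs : ρ.hom.IsSingular α' β' s) {p i : Fin a} {q : Fin b} (hα : α = α' + Pi.single p 1)
    (hβ : β = β' + Pi.single q 1) (hpi : p < i) (u : Fin b) :
    (α' p - α' i + (i - p)) • s i u = ∑ k, if k < i then ρ.A i k (s k u) else 0 := by
  obtain ⟨h1, h2, h3⟩ := isSingular_hom_iff.1 hs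
  have h := congrFun (congrFun (hv.omegaA_eq hs hα hβ) i) u
  have key : ∀ k, ρ.A i k (s k u) = (if k < i then ρ.A i k (s k u) else 0) +
      ((if k = i then (α' i + 1) else 0) + (if i < k then 1 else 0) : ℂ) • s i u := by
    intro k
    rcases lt_trichotomy k i with h | rfl | h
    · simp [h, h.ne, h.not_gt]
    · rw [(h1 k u).wtA]; simp
    · rw [h2 i k k u h]; simp [h.ne', h, h.not_gt]
  have hcard : (∑ k : Fin a, if i < k then (1 : ℂ) else 0) = (a : ℂ) - 1 - i := by
    rw [Finset.sum_boole]
    have h4 : (Finset.univ.filter fun k : Fin a => i < k) = Finset.Ioi i := by ext; simp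
    rw [h4, Fin.card_Ioi]
    have := i.isLt
    rw [Nat.sub_sub, Nat.cast_sub (by omega)]
    push_cast
    ring
  simp only [omegaA_apply, Pi.smul_apply] at h
  rw [Finset.sum_congr rfl fun k _ => key k, Finset.sum_add_distrib, ← Finset.sum_smul,
    Finset.sum_add_distrib, hcard, hα] at h
  simp only [Finset.sum_ite_eq', Finset.mem_univ, if_true, Pi.add_apply, Pi.single_eq_same] at h
  rw [← eq_sub_iff_add_eq] at h
  rw [h, ← sub_smul]
  congr 1
  ring

end GLAction

/-! ### Construction of singular vectors -/

section Lowering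

variable {a : ℕ} {E : Type*} [AddCommGroup E] [Module ℂ E]

/-- The lowering operators `τ i` with `τ p = 1` and `d i • τ i = ∑ k < i, A i k * τ k` for `i > p`. -/
noncomputable def lowering (A : Fin a → Fin a → Module.End ℂ E) (d : Fin a → ℂ) (p i : Fin a) :
    Module.End ℂ E :=
  if i < p then 0 else if i = p then 1 else
    (d i)⁻¹ • ∑ k : Fin a, if _h : k < i then A i k * lowering A d p k else 0
termination_by i

variable {A : Fin a → Fin a → Module.End ℂ E} {d : Fin a → ℂ} {p : Fin a}

theorem lowering_of_lt {i : Fin a} (h : i < p) : lowering A d p i = 0 := by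
  rw [lowering, if_pos h]

theorem lowering_self : lowering A d p p = 1 := by
  rw [lowering, if_neg (lt_irrefl p), if_pos rfl]

theorem lowering_of_gt {i : Fin a} (h : p < i) (hd : d i ≠ 0) (x : E) :
    d i • lowering A d p i x = ∑ k : Fin a, if k < i then A i k (lowering A d p k x) else 0 := by
  rw [lowering, if_neg h.not_gt, if_neg h.ne', LinearMap.smul_apply, smul_inv_smul₀ hd,
    LinearMap.sum_apply]
  refine Finset.sum_congr rfl fun k _ => ?_
  split_ifs <;> rfl

/-- An operator commuting with all `A i j` commutes with the lowering operators. -/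
theorem lowering_comm {T : Module.End ℂ E} (hT : ∀ i j x, T (A i j x) = A i j (T x)) (i : Fin a)
    (x : E) : T (lowering A d p i x) = lowering A d p i (T x) := by
  induction i using WellFoundedLT.induction with
  | ind i ih =>
    rw [lowering]
    split_ifs with h1 h2
    · simp
    · simp
    · simp only [LinearMap.smul_apply, map_smul, LinearMap.sum_apply, map_sum]
      congr 1
      refine Finset.sum_congr rfl fun k _ => ?_
      split_ifs with h
      · rw [Module.End.mul_apply, hT, ih k h, Module.End.mul_apply]
      · simp

/-- The lowering operators shift weights by differences of unit vectors. -/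
theorem lowering_weight (hA : IsGLFamily A) {α : Fin a → ℂ} {x : E}
    (hx : ∀ i, A i i x = (α + Pi.single p 1 : Fin a → ℂ) i • x) (i l : Fin a) :
    A l l (lowering A d p i x) = (α + Pi.single i 1 : Fin a → ℂ) l • lowering A d p i x := by
  induction i using WellFoundedLT.induction with
  | ind i ih =>
    rw [lowering]
    split_ifs with h1 h2
    · simp
    · subst h2
      simpa using hx l
    · simp only [LinearMap.smul_apply, map_smul, LinearMap.sum_apply, map_sum,
        smul_comm _ (d i)⁻¹]
      congr 1
      rw [Finset.smul_sum]
      refine Finset.sum_congr rfl fun k _ => ?_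
      split_ifs with h
      · rw [Module.End.mul_apply, hA l l i k, ih k h, map_smul]
        have e1 : (if l = i then A l k (lowering A d p k x) else 0) =
            (if l = i then (1 : ℂ) else 0) • A i k (lowering A d p k x) := by
          split_ifs with hl
          · rw [hl, one_smul]
          · rw [zero_smul]
        have e2 : (if l = k then A i l (lowering A d p k x) else 0) =
            (if l = k then (1 : ℂ) else 0) • A i k (lowering A d p k x) := by
          split_ifs with hl
          · rw [hl, one_smul]
          · rw [zero_smul]
        rw [e1, e2]
        simp only [Pi.add_apply, Pi.single_apply]
        module
      · simp

/-- The vectors `lowering A d p i x` span a copy of a highest weight part of `ℂ^a`, if the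
constants `d i` are the differences of the `ρ`-shifted weights. -/
theorem lowering_raise (hA : IsGLFamily A) {α : Fin a → ℂ} {x : E}
    (hx : ∀ i, A i i x = (α + Pi.single p 1 : Fin a → ℂ) i • x)
    (hraise : ∀ i j, i < j → A i j x = 0) (hdef : ∀ i, d i = α p - α i + (i - p))
    (hd : ∀ i, p < i → d i ≠ 0) (i l m : Fin a) (hlm : l < m) :
    A l m (lowering A d p i x) = if i = m then lowering A d p l x else 0 := by
  induction i using WellFoundedLT.induction generalizing l m with
  | ind i ih =>
    rcases lt_trichotomy i p with h | rfl | h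
    · rw [lowering_of_lt h]
      split_ifs with h2
      · rw [lowering_of_lt (hlm.trans (h2 ▸ h))]
        simp
      · simp
    · rw [lowering_self, Module.End.one_apply, hraise l m hlm]
      split_ifs with h2
      · rw [lowering_of_lt (h2 ▸ hlm), LinearMap.zero_apply]
      · rfl
    · set t := fun k => lowering A d p k x with ht
      have hwt : ∀ k j, A j j (t k) = (α + Pi.single k 1 : Fin a → ℂ) j • t k := fun k j =>
        lowering_weight hA hx k j
      have hrec : ∀ i, p < i → d i • t i = ∑ k : Fin a, if k < i then A i k (t k) else 0 :=
        fun i hi => lowering_of_gt hi (hd i hi) x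
      have ih' : ∀ k, k < i → ∀ l m, l < m → A l m (t k) = if k = m then t l else 0 :=
        fun k hk l m hlm => ih k hk l m hlm
      change A l m (t i) = if i = m then t l else 0
      have hdi := hd i h
      refine smul_right_injective E hdi ?_
      change d i • _ = d i • _
      rw [← map_smul, hrec i h, map_sum]
      have key : ∀ k, A l m (if k < i then A i k (t k) else 0) =
          (if k = m then (if m < i then A i m (t l) else 0) else 0) +
          ((if m = i then (if k < i then A l k (t k) else 0) else 0) -
            (if k = l then (if l < i then A i m (t l) else 0) else 0)) := by
        intro k
        by_cases hk : k < i
        · rw [if_pos hk, hA l m i k, ih' k hk l m hlm]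
          congr 1
          · by_cases hkm : k = m
            · subst hkm; simp [hk]
            · simp [hkm]
          · congr 1
            · simp [hk]
            · by_cases hkl : k = l
              · subst hkl; simp [hk]
              · simp [hkl, Ne.symm hkl]
        · rw [if_neg hk, map_zero]
          have h1 : (if k = m then (if m < i then A i m (t l) else 0) else 0) = 0 := by
            by_cases hkm : k = m
            · subst hkm; simp [hk]
            · simp [hkm]
          have h2 : (if k = l then (if l < i then A i m (t l) else 0) else 0) = 0 := by
            by_cases hkl : k = l
            · subst hkl; simp [hk]
            · simp [hkl]
          rw [h1, h2]
          simp [hk]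
      rw [Finset.sum_congr rfl fun k _ => key k, Finset.sum_add_distrib, Finset.sum_sub_distrib]
      simp only [Finset.sum_ite_eq', Finset.mem_univ, if_true]
      rcases lt_trichotomy m i with hmi | rfl | hmi
      · simp [hmi, hlm.trans hmi, hmi.ne, hmi.ne']
      · -- the essential case, where the value of `d` matters
        simp only [lt_irrefl, if_false, if_true, zero_add, hlm]
        have hsum : ∑ k : Fin a, (if k < m then A l k (t k) else 0) =
            (∑ k : Fin a, if k < l then A l k (t k) else 0) + A l l (t l) +
              ((m : ℂ) - 1 - l) • t l := by
          have h1 : ∀ k, (if k < m then A l k (t k) else 0) =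
              (if k < l then A l k (t k) else 0) + (if k = l then A l l (t l) else 0) +
                (if l < k ∧ k < m then (1 : ℂ) else 0) • t l := by
            intro k
            rcases lt_trichotomy k l with hk | rfl | hk
            · simp [hk, hk.trans hlm, hk.ne, hk.not_gt]
            · simp [hlm]
            · by_cases hkm : k < m
              · rw [ih' k hkm l k hk]; simp [hk, hk.not_gt, hk.ne', hkm]
              · simp [hk.not_gt, hk.ne', hkm]
          rw [Finset.sum_congr rfl fun k _ => h1 k, Finset.sum_add_distrib,
            Finset.sum_add_distrib, ← Finset.sum_smul, Finset.sum_boole]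
          have h4 : (Finset.univ.filter fun k : Fin a => l < k ∧ k < m) = Finset.Ioo l m := by
            ext; simp
          have hlm' : (l : ℕ) < m := hlm
          rw [h4, Fin.card_Ioo, Nat.sub_sub, Nat.cast_sub (by omega)]
          simp only [Finset.sum_ite_eq', Finset.mem_univ, if_true]
          congr 2
          push_cast
          ring
        rw [hsum, hwt l l, hwt l m]
        rcases lt_trichotomy l p with hl | rfl | hl
        · have h0 : ∀ k, k ≤ l → t k = 0 := fun k hk => by
            simp only [ht]; rw [lowering_of_lt (hk.trans_lt hl), LinearMap.zero_apply]
          have h1 : ∑ k : Fin a, (if k < l then A l k (t k) else 0) = 0 :=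
            Finset.sum_eq_zero fun k _ => by
              split_ifs with hk
              · rw [h0 k hk.le, map_zero]
              · rfl
          rw [h1, h0 l le_rfl]
          simp
        · have h1 : ∑ k : Fin a, (if k < l then A l k (t k) else 0) = 0 :=
            Finset.sum_eq_zero fun k _ => by
              split_ifs with hk
              · simp only [ht]; rw [lowering_of_lt hk, LinearMap.zero_apply, map_zero]
              · rfl
          rw [h1, hdef]
          simp only [Pi.add_apply, Pi.single_apply, hlm.ne', if_true, if_false]
          module
        · rw [← hrec l hl, hdef, hdef]
          simp only [Pi.add_apply, Pi.single_apply, hlm.ne', if_true, if_false]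
          module
      · have him : ∀ h : l < i, A i m (t l) = 0 := fun h => by
          rw [ih' l h i m hmi, if_neg hlm.ne]
        simp only [hmi.not_gt, hmi.ne', hmi.ne, if_false, zero_add]
        split_ifs with hli
        · simp [him hli]
        · simp

end Lowering

namespace GLAction

variable {a b : ℕ} {E F : Type*} [AddCommGroup E] [Module ℂ E] [AddCommGroup F] [Module ℂ F]
  {α α' : Fin a → ℂ} {β β' : Fin b → ℂ} {v : E}

/-- Existence of singular vectors of `Hom(ℂ^a ⊗ ℂ^b, E)`. -/
theorem exists_isSingular_hom {ρ : GLAction a b E} {p : Fin a} {q : Fin b}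
    (hv : ρ.IsSingular (α' + Pi.single p 1) (β' + Pi.single q 1) v)
    (hα : ∀ i, p < i → α' p - α' i + (i - p) ≠ 0) (hβ : ∀ i, q < i → β' q - β' i + (i - q) ≠ 0) :
    ∃ s, ρ.hom.IsSingular α' β' s ∧ s p q = v := by
  set σ := lowering ρ.A (fun i => α' p - α' i + (i - p)) p with hσ
  set τ := lowering ρ.B (fun i => β' q - β' i + (i - q)) q with hτ
  have hσB : ∀ i j k x, ρ.B i j (σ k x) = σ k (ρ.B i j x) := fun i j k x =>
    lowering_comm (fun l m x => (ρ.comm l m i j x).symm) k x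
  have hτA : ∀ i j k x, ρ.A i j (τ k x) = τ k (ρ.A i j x) := fun i j k x =>
    lowering_comm (fun l m x => ρ.comm i j l m x) k x
  refine ⟨fun i u => σ i (τ u v), isSingular_hom_iff.2 ⟨fun i u => ⟨fun l => ?_, fun l => ?_⟩,
    fun l m i u hlm => ?_, fun l m i u hlm => ?_⟩, ?_⟩
  · exact lowering_weight ρ.relA (fun j => by rw [hτA, hv.wtA, map_smul]) i l
  · rw [hσB, hτ, lowering_weight ρ.relB hv.wtB u l, map_smul]
  · exact lowering_raise ρ.relA (fun j => by rw [hτA, hv.wtA, map_smul])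
      (fun i j hij => by rw [hτA, hv.raiseA i j hij, map_zero]) (fun _ => rfl) hα i l m hlm
  · rw [hσB, hτ, lowering_raise ρ.relB hv.wtB hv.raiseB (fun _ => rfl) hβ u l m hlm]
    split_ifs <;> simp
  · simp only [hσ, hτ, lowering_self, Module.End.one_apply]

/-! ### Construction of equivariant maps -/

/-- The diagonal action on `E × F`. -/
@[simps] def prod (ρ : GLAction a b E) (σ : GLAction a b F) : GLAction a b (E × F) where
  A i j := (ρ.A i j).prodMap (σ.A i j)
  B i j := (ρ.B i j).prodMap (σ.B i j)
  relA i j k l x := by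
    apply Prod.ext
    · simp only [LinearMap.prodMap_apply, Prod.fst_add, Prod.fst_sub, ρ.relA i j k l]
      split_ifs <;> simp
    · simp only [LinearMap.prodMap_apply, Prod.snd_add, Prod.snd_sub, σ.relA i j k l]
      split_ifs <;> simp
  relB i j k l x := by
    apply Prod.ext
    · simp only [LinearMap.prodMap_apply, Prod.fst_add, Prod.fst_sub, ρ.relB i j k l]
      split_ifs <;> simp
    · simp only [LinearMap.prodMap_apply, Prod.snd_add, Prod.snd_sub, σ.relB i j k l]
      split_ifs <;> simp
  comm i j k l x := by
    apply Prod.ext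
    · exact ρ.comm i j k l x.1
    · exact σ.comm i j k l x.2

theorem gen_le {ρ : GLAction a b E} {K : Submodule ℂ E} (hK : ρ.Invariant K) {x : E}
    (hx : x ∈ K) : ρ.gen x ≤ K := by
  refine Submodule.span_le.2 fun y hy => ?_
  induction hy with
  | base => exact hx
  | lowerA i j _ y _ ih => exact hK.invA i j y ih
  | lowerB i j _ y _ ih => exact hK.invB i j y ih

/-- A singular vector `s` of the same weight as the maximal vector `v` of an irreducible module is
the image of `v` under an equivariant map, if `s` is the only singular vector of the submodule
generated by it: that map is the one whose graph is generated by `(v, s)`. -/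
theorem IsHighest.exists_linearMap [FiniteDimensional ℂ F] {ρ : GLAction a b E}
    {σ : GLAction a b F} (hv : ρ.IsHighest α β v) {s : F} (hs : σ.IsSingular α β s) (hs0 : s ≠ 0)
    (h : ∀ α' β' w, w ≠ 0 → σ.IsSingular α' β' w → w ∈ σ.gen s → ∃ c : ℂ, w = c • s) :
    ∃ f : E →ₗ[ℂ] F, f v = s ∧ (∀ i j x, f (ρ.A i j x) = σ.A i j (f x)) ∧
      ∀ i j x, f (ρ.B i j x) = σ.B i j (f x) := by
  have hvs : (ρ.prod σ).IsSingular α β (v, s) :=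
    { wtA := fun i => Prod.ext (hv.wtA i) (hs.wtA i)
      wtB := fun i => Prod.ext (hv.wtB i) (hs.wtB i)
      raiseA := fun i j hij => Prod.ext (hv.raiseA i j hij) (hs.raiseA i j hij)
      raiseB := fun i j hij => Prod.ext (hv.raiseB i j hij) (hs.raiseB i j hij) }
  set K := (ρ.prod σ).gen (v, s) with hKdef
  have hK : (ρ.prod σ).Invariant K := hvs.invariant_gen
  have hKmem : (v, s) ∈ K := (ρ.prod σ).mem_gen_self _
  have hsnd : ∀ x w, (x, w) ∈ K → w ∈ σ.gen s := by
    have hinv := hs.invariant_gen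
    have hinv' : (ρ.prod σ).Invariant ((σ.gen s).comap (LinearMap.snd ℂ E F)) :=
      ⟨fun i j x hx => hinv.invA i j x.2 hx, fun i j x hx => hinv.invB i j x.2 hx⟩
    have : K ≤ (σ.gen s).comap (LinearMap.snd ℂ E F) := gen_le hinv' (σ.mem_gen_self s)
    exact fun x w hxw => this hxw
  -- the kernel of the projection of `K` to `E` vanishes
  have hker : ∀ w, ((0 : E), w) ∈ K → w = 0 := by
    set Z : Submodule ℂ F := K.comap (LinearMap.inr ℂ E F) with hZdef
    have hZ : σ.Invariant Z := by
      constructor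
      · intro i j w hw
        have := hK.invA i j _ hw
        simpa [hZdef] using this
      · intro i j w hw
        have := hK.invB i j _ hw
        simpa [hZdef] using this
    suffices hbot : Z = ⊥ from fun w hw => (Submodule.mem_bot ℂ).1 (hbot ▸ hw)
    by_contra hne
    obtain ⟨α', β', w, hw, hw0, hws⟩ := hZ.exists_isSingular hne
    obtain ⟨c, rfl⟩ := h α' β' w hw0 hws (hsnd 0 w hw)
    have hc : c ≠ 0 := fun hc => hw0 (by rw [hc, zero_smul])
    have h0s : ((0 : E), s) ∈ K := by
      have h1 := Z.smul_mem c⁻¹ hw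
      rwa [inv_smul_smul₀ hc] at h1
    have hd0 : (ρ.prod σ).IsWeight α β ((0 : E), s) :=
      { wtA := fun i => Prod.ext (by simp) (hs.wtA i)
        wtB := fun i => Prod.ext (by simp) (hs.wtB i) }
    obtain ⟨e, he⟩ := exists_eq_smul_of_depth (hvs.toIsWeight.depth 1 1) h0s (hd0.depth 1 1)
    have he1 : (0 : E) = e • v := congrArg Prod.fst he
    have he2 : s = e • s := congrArg Prod.snd he
    rcases smul_eq_zero.1 he1.symm with he0 | he0
    · rw [he0, zero_smul] at he2
      exact hs0 he2
    · exact hv.ne_zero he0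
  have hsurj : ∀ x : E, ∃ w, (x, w) ∈ K := by
    have hinv : ρ.Invariant (K.map (LinearMap.fst ℂ E F)) := by
      constructor
      · rintro i j x ⟨y, hy, rfl⟩
        exact ⟨_, hK.invA i j y hy, rfl⟩
      · rintro i j x ⟨y, hy, rfl⟩
        exact ⟨_, hK.invB i j y hy, rfl⟩
    have htop := (hv.irred _ hinv).resolve_left fun hbot => hv.ne_zero
      ((Submodule.mem_bot ℂ).1 (hbot ▸ ⟨_, hKmem, rfl⟩))
    intro x
    obtain ⟨y, hy, rfl⟩ : x ∈ K.map (LinearMap.fst ℂ E F) := htop ▸ Submodule.mem_top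
    exact ⟨y.2, hy⟩
  have huniq : ∀ x w w', (x, w) ∈ K → (x, w') ∈ K → w = w' := fun x w w' h1 h2 => by
    have h3 := K.sub_mem h1 h2
    rw [Prod.mk_sub_mk, sub_self] at h3
    exact sub_eq_zero.1 (hker _ h3)
  choose f hf using hsurj
  refine ⟨{ toFun := f, map_add' := fun x y => ?_, map_smul' := fun c x => ?_ },
    huniq _ _ _ (hf v) hKmem, fun i j x => ?_, fun i j x => ?_⟩
  · exact huniq _ _ _ (hf _) (K.add_mem (hf x) (hf y))
  · exact huniq _ _ _ (hf _) (K.smul_mem c (hf x))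
  · exact huniq _ _ _ (hf _) (hK.invA i j _ (hf x))
  · exact huniq _ _ _ (hf _) (hK.invB i j _ (hf x))

/-- The linear maps `φ p q : E → F` are the values on the standard basis of an equivariant map
`ℂ^a ⊗ ℂ^b → Hom(E, F)`. -/
structure IsFamily (ρ : GLAction a b E) (σ : GLAction a b F)
    (φ : Fin a → Fin b → E →ₗ[ℂ] F) : Prop where
  famA : ∀ i j p q x, σ.A i j (φ p q x) = φ p q (ρ.A i j x) + if p = j then φ i q x else 0
  famB : ∀ i j p q x, σ.B i j (φ p q x) = φ p q (ρ.B i j x) + if q = j then φ p i x else 0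

theorem omegaA_gen (ρ : GLAction a b E) {s : Fin a → Fin b → E} {c : ℂ}
    (hs : ρ.omegaA s = c • s) {w : Fin a → Fin b → E} (hw : w ∈ ρ.hom.gen s) :
    ρ.omegaA w = c • w := by
  have : ρ.hom.gen s ≤ ρ.omegaA.eigenspace c := gen_le
    ⟨fun i j x hx => Module.End.mem_eigenspace_iff.2 (by
        rw [omegaA_A, Module.End.mem_eigenspace_iff.1 hx, map_smul]),
      fun i j x hx => Module.End.mem_eigenspace_iff.2 (by
        rw [omegaA_B, Module.End.mem_eigenspace_iff.1 hx, map_smul])⟩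
    (Module.End.mem_eigenspace_iff.2 hs)
  exact Module.End.mem_eigenspace_iff.1 (this hw)

end GLAction

/-- The weight `α` plus the half sum of the positive roots is regular. -/
def Regular {a : ℕ} (α : Fin a → ℂ) : Prop := ∀ i j, i < j → α i - α j + (j - i) ≠ 0

namespace GLAction

variable {a b : ℕ} {E F G : Type*} [AddCommGroup E] [Module ℂ E] [AddCommGroup F] [Module ℂ F]
  [AddCommGroup G] [Module ℂ G]
  {ρ : GLAction a b E} {σ : GLAction a b F} {τ : GLAction a b G}
  {α α' : Fin a → ℂ} {β β' : Fin b → ℂ} {v : E}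

theorem IsSingular.transpose {s : Fin a → Fin b → E} (h : ρ.hom.IsSingular α β s) :
    ρ.swap.hom.IsSingular β α fun q p => s p q where
  wtA i := funext fun q => funext fun p => congrFun (congrFun (h.wtB i) p) q
  wtB i := funext fun q => funext fun p => congrFun (congrFun (h.wtA i) p) q
  raiseA i j hij := funext fun q => funext fun p => congrFun (congrFun (h.raiseB i j hij) p) q
  raiseB i j hij := funext fun q => funext fun p => congrFun (congrFun (h.raiseA i j hij) p) q

/-- The analogue of `omegaA_gen` for the second factor. -/
theorem omegaB_gen (ρ : GLAction a b E) {s : Fin a → Fin b → E} {c : ℂ}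
    (hs : ρ.swap.omegaA (fun q p => s p q) = c • fun q p => s p q) {w : Fin a → Fin b → E}
    (hw : w ∈ ρ.hom.gen s) : ρ.swap.omegaA (fun q p => w p q) = c • fun q p => w p q := by
  let T : (Fin a → Fin b → E) →ₗ[ℂ] Fin b → Fin a → E :=
    { toFun := fun s q p => s p q, map_add' := fun _ _ => rfl, map_smul' := fun _ _ => rfl }
  have hinv : ρ.hom.Invariant ((ρ.swap.omegaA.eigenspace c).comap T) := by
    constructor
    · intro i j x hx
      have hx' : ρ.swap.omegaA (T x) = c • T x := Module.End.mem_eigenspace_iff.1 hx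
      have h := ρ.swap.omegaA_B i j (T x)
      rw [hx', map_smul] at h
      exact Module.End.mem_eigenspace_iff.2 h
    · intro i j x hx
      have hx' : ρ.swap.omegaA (T x) = c • T x := Module.End.mem_eigenspace_iff.1 hx
      have h := ρ.swap.omegaA_A i j (T x)
      rw [hx', map_smul] at h
      exact Module.End.mem_eigenspace_iff.2 h
  have : ρ.hom.gen s ≤ (ρ.swap.omegaA.eigenspace c).comap T :=
    gen_le hinv (Module.End.mem_eigenspace_iff.2 hs)
  exact Module.End.mem_eigenspace_iff.1 (this hw)

theorem eq_of_regular {α : Fin a → ℂ} (hα : Regular α) {p p' : Fin a}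
    (h : α p + ((a : ℂ) - 1 - p) = α p' + ((a : ℂ) - 1 - p')) : p = p' := by
  rcases lt_trichotomy p p' with hlt | rfl | hlt
  · exact absurd (by linear_combination h) (hα p p' hlt)
  · rfl
  · exact absurd (by linear_combination -h) (hα p' p hlt)

/-- Existence of equivariant maps `ℂ^a ⊗ ℂ^b → Hom(E, F)`: the irreducible module whose weight
differs by unit vectors from that of `E` occurs in `(ℂ^a ⊗ ℂ^b) ⊗ E`. -/
theorem IsHighest.exists_isFamily [FiniteDimensional ℂ F] {w : F} {p : Fin a} {q : Fin b}
    (hv : ρ.IsHighest α β v) (hw : σ.IsHighest (α + Pi.single p 1) (β + Pi.single q 1) w)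
    (hα : Regular α) (hβ : Regular β) (hα' : Regular (α + Pi.single p 1))
    (hβ' : Regular (β + Pi.single q 1)) :
    ∃ φ, IsFamily ρ σ φ ∧ φ p q v = w := by
  obtain ⟨s, hs, hspq⟩ := exists_isSingular_hom hw.toIsSingular (fun i => hα p i) (fun i => hβ q i)
  have hs0 : s ≠ 0 := fun h => hw.ne_zero (by rw [← hspq, h]; rfl)
  have hΩA := hw.omegaA_eq hs rfl rfl
  have hΩB := hw.swap.omegaA_eq hs.transpose rfl rfl
  obtain ⟨f, hfv, hfA, hfB⟩ := hv.exists_linearMap hs hs0 (by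
    intro α' β' x hx0 hx hxs
    obtain ⟨p', q', -, hp, hq⟩ := hw.hom_exists hx hx0
    have h1 := (hw.omegaA_eq hx hp hq).symm.trans (σ.omegaA_gen hΩA hxs)
    have h2 := (hw.swap.omegaA_eq hx.transpose hq hp).symm.trans (σ.omegaB_gen hΩB hxs)
    have hxT : (fun q p => x p q) ≠ 0 := fun h0 =>
      hx0 (funext fun p => funext fun q => congrFun (congrFun h0 q) p)
    obtain rfl : p' = p := eq_of_regular hα' (smul_left_injective ℂ hx0 h1)
    obtain rfl : q' = q := eq_of_regular hβ' (smul_left_injective ℂ hxT h2)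
    obtain rfl : α = α' := add_right_cancel hp
    obtain rfl : β = β' := add_right_cancel hq
    obtain ⟨c, hc⟩ := hw.exists_eq_smul_of_isWeight ((isSingular_hom_iff.1 hx).1 p' q')
    refine ⟨c, sub_eq_zero.1 (hw.hom_eq_zero (hx.sub_smul hs c) rfl rfl ?_)⟩
    rw [Pi.sub_apply, Pi.sub_apply, Pi.smul_apply, Pi.smul_apply, hspq, hc, sub_self])
  refine ⟨fun p q => LinearMap.proj q ∘ₗ LinearMap.proj p ∘ₗ f,
    ⟨fun i j p q x => ?_, fun i j p q x => ?_⟩, ?_⟩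
  · have h := congrFun (congrFun (hfA i j x) p) q
    rw [hom_A_apply, eq_sub_iff_add_eq] at h
    exact h.symm
  · have h := congrFun (congrFun (hfB i j x) p) q
    rw [hom_B_apply, eq_sub_iff_add_eq] at h
    exact h.symm
  · exact (congrFun (congrFun hfv p) q).trans hspq

theorem IsFamily.swap {φ : Fin a → Fin b → E →ₗ[ℂ] F} (h : IsFamily ρ σ φ) :
    IsFamily ρ.swap σ.swap fun q p => φ p q :=
  ⟨fun i j p q x => h.famB i j q p x, fun i j p q x => h.famA i j q p x⟩

theorem IsFamily.sub {φ φ' : Fin a → Fin b → E →ₗ[ℂ] F} (h : IsFamily ρ σ φ)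
    (h' : IsFamily ρ σ φ') : IsFamily ρ σ fun p q => φ p q - φ' p q where
  famA i j p q x := by
    rw [LinearMap.sub_apply, map_sub, h.famA, h'.famA, LinearMap.sub_apply, LinearMap.sub_apply]
    split_ifs <;> abel
  famB i j p q x := by
    rw [LinearMap.sub_apply, map_sub, h.famB, h'.famB, LinearMap.sub_apply, LinearMap.sub_apply]
    split_ifs <;> abel

theorem IsFamily.isSingular {φ : Fin a → Fin b → E →ₗ[ℂ] F} (h : IsFamily ρ σ φ)
    (hv : ρ.IsSingular α β v) : σ.hom.IsSingular α β fun p q => φ p q v where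
  wtA i := funext fun p => funext fun q => by
    rw [hom_A_apply, h.famA, hv.wtA, add_sub_cancel_right, map_smul]; rfl
  wtB i := funext fun p => funext fun q => by
    rw [hom_B_apply, h.famB, hv.wtB, add_sub_cancel_right, map_smul]; rfl
  raiseA i j hij := funext fun p => funext fun q => by
    rw [hom_A_apply, h.famA, hv.raiseA i j hij, add_sub_cancel_right, map_zero]; rfl
  raiseB i j hij := funext fun p => funext fun q => by
    rw [hom_B_apply, h.famB, hv.raiseB i j hij, add_sub_cancel_right, map_zero]; rfl

theorem IsFamily.isWeight {φ : Fin a → Fin b → E →ₗ[ℂ] F} (h : IsFamily ρ σ φ) {x : E}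
    (hx : ρ.IsWeight α β x) (p : Fin a) (q : Fin b) :
    σ.IsWeight (α + Pi.single p 1) (β + Pi.single q 1) (φ p q x) where
  wtA i := by
    rw [h.famA, hx.wtA, map_smul, Pi.add_apply, add_smul, Pi.single_apply]
    by_cases hi : p = i
    · subst hi; simp
    · simp [hi, Ne.symm hi]
  wtB i := by
    rw [h.famB, hx.wtB, map_smul, Pi.add_apply, add_smul, Pi.single_apply]
    by_cases hi : q = i
    · subst hi; simp
    · simp [hi, Ne.symm hi]

/-- An equivariant family is determined by its values on the maximal vector. -/
theorem IsFamily.eq_zero {φ : Fin a → Fin b → E →ₗ[ℂ] F} (h : IsFamily ρ σ φ)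
    (hv : ρ.IsHighest α β v) (h0 : ∀ p q, φ p q v = 0) (p : Fin a) (q : Fin b) : φ p q = 0 := by
  have hK : ρ.Invariant (⨅ p, ⨅ q, LinearMap.ker (φ p q)) := by
    constructor
    · intro i j x hx
      simp only [Submodule.mem_iInf, LinearMap.mem_ker] at hx ⊢
      intro p q
      have := h.famA i j p q x
      rw [hx, hx, map_zero] at this
      simpa using this.symm
    · intro i j x hx
      simp only [Submodule.mem_iInf, LinearMap.mem_ker] at hx ⊢
      intro p q
      have := h.famB i j p q x
      rw [hx, hx, map_zero] at this
      simpa using this.symm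
  have hvK : v ∈ ⨅ p, ⨅ q, LinearMap.ker (φ p q) := by
    simpa only [Submodule.mem_iInf, LinearMap.mem_ker] using h0
  have htop := (hv.irred _ hK).resolve_left fun hbot =>
    hv.ne_zero ((Submodule.mem_bot ℂ).1 (hbot ▸ hvK))
  ext x
  have hx : x ∈ ⨅ p, ⨅ q, LinearMap.ker (φ p q) := htop ▸ Submodule.mem_top
  simp only [Submodule.mem_iInf, LinearMap.mem_ker] at hx
  exact hx p q

/-- `Ext¹` vanishes unless the weights differ by the weight of a root vector. -/
theorem IsFamily.exists_of_ne_zero {φ : Fin a → Fin b → E →ₗ[ℂ] F} (h : IsFamily ρ σ φ)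
    (hv : ρ.IsHighest α β v) {w : F} (hw : σ.IsHighest α' β' w) (h0 : ∃ p q, φ p q ≠ 0) :
    ∃ p q, α' = α + Pi.single p 1 ∧ β' = β + Pi.single q 1 := by
  obtain ⟨p, q, -, h1⟩ := hw.hom_exists (h.isSingular hv.toIsSingular) (fun hs => by
    obtain ⟨p, q, hpq⟩ := h0
    exact hpq (h.eq_zero hv (fun p q => congrFun (congrFun hs p) q) p q))
  exact ⟨p, q, h1⟩

/-- A family is zero if it vanishes on the maximal vector and the root vector of the right
weight. -/
theorem IsFamily.eq_zero_of_apply {φ : Fin a → Fin b → E →ₗ[ℂ] F} (h : IsFamily ρ σ φ)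
    (hv : ρ.IsHighest α β v) {w : F} {p : Fin a} {q : Fin b}
    (hw : σ.IsHighest (α + Pi.single p 1) (β + Pi.single q 1) w) (h0 : φ p q v = 0)
    (p' : Fin a) (q' : Fin b) : φ p' q' = 0 :=
  h.eq_zero hv (fun p' q' => congrFun (congrFun
    (hw.hom_eq_zero (h.isSingular hv.toIsSingular) rfl rfl h0) p') q') p' q'

/-! ### Compositions of two equivariant maps -/

theorem IsFamily.apply_eq_zero {φ : Fin a → Fin b → E →ₗ[ℂ] F} (h : IsFamily ρ σ φ)
    (hv : ρ.IsWeight α β v) {w : F} {p₁ p₂ : Fin a}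
    (hw : σ.IsHighest (α + Pi.single p₂ 1) β' w) (hp : p₁ < p₂) (u : Fin b) : φ p₁ u v = 0 :=
  hw.eq_zero_of_lt rfl rfl hp (h.isWeight hv p₁ u)

/-- The effect of interchanging the first indices in a composition of two equivariant families. It
is the source of the coefficients `1 / p̃` in the relations. -/
theorem IsFamily.two_step {φ : Fin a → Fin b → E →ₗ[ℂ] F} (h : IsFamily ρ σ φ)
    {ψ : Fin a → Fin b → F →ₗ[ℂ] G} (h' : IsFamily σ τ ψ) (hv : ρ.IsSingular α β v)
    {w : F} {z : G} {p₁ p₂ : Fin a} {q : Fin b}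
    (hw : σ.IsHighest (α + Pi.single p₁ 1) (β + Pi.single q 1) w)
    (hz : τ.IsHighest (α + Pi.single p₁ 1 + Pi.single p₂ 1) β' z) (hp : p₁ < p₂) (u u' : Fin b) :
    (α p₁ - α p₂ + (p₂ - p₁)) • ψ p₁ u' (φ p₂ u v) = -ψ p₂ u' (φ p₁ u v) := by
  have hs := h.isSingular hv
  rw [← map_smul, hw.smul_entry hs rfl rfl hp u, map_sum, Finset.sum_eq_single p₁]
  · have h1 : ψ p₁ u' (φ p₁ u v) = 0 :=
      hz.eq_zero_of_lt rfl rfl hp (h'.isWeight (h.isWeight hv.toIsWeight p₁ u) p₁ u')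
    have h2 := h'.famA p₂ p₁ p₁ u' (φ p₁ u v)
    rw [h1, map_zero, if_pos rfl] at h2
    rw [if_pos hp]
    exact eq_neg_of_add_eq_zero_left h2.symm
  · intro k _ hk
    split_ifs with hkp
    · have h1 : ψ p₁ u' (φ k u v) = 0 := by
        refine hz.eq_zero_of_lt rfl ?_ hkp (h'.isWeight (h.isWeight hv.toIsWeight k u) p₁ u')
        rw [add_right_comm]
      have h2 := h'.famA p₂ k p₁ u' (φ k u v)
      rw [h1, map_zero, if_neg hk.symm, add_zero] at h2
      exact h2.symm
    · rw [map_zero]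
  · simp

/-! ### Equivariant bilinear maps -/

/-- The linear maps `Ψ p q p' q' : E → F` are the values on the standard basis of an equivariant
bilinear map from `ℂ^a ⊗ ℂ^b` to `Hom(E, F)`. -/
structure IsBiFamily (ρ : GLAction a b E) (σ : GLAction a b F)
    (Ψ : Fin a → Fin b → Fin a → Fin b → E →ₗ[ℂ] F) : Prop where
  famA : ∀ i j p q p' q' x, σ.A i j (Ψ p q p' q' x) = Ψ p q p' q' (ρ.A i j x) +
    ((if p = j then Ψ i q p' q' x else 0) + if p' = j then Ψ p q i q' x else 0)
  famB : ∀ i j p q p' q' x, σ.B i j (Ψ p q p' q' x) = Ψ p q p' q' (ρ.B i j x) +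
    ((if q = j then Ψ p i p' q' x else 0) + if q' = j then Ψ p q p' i x else 0)

variable {Ψ : Fin a → Fin b → Fin a → Fin b → E →ₗ[ℂ] F}

theorem IsBiFamily.swap (h : IsBiFamily ρ σ Ψ) :
    IsBiFamily ρ.swap σ.swap fun q p q' p' => Ψ p q p' q' :=
  ⟨fun i j _ _ _ _ x => h.famB i j _ _ _ _ x, fun i j _ _ _ _ x => h.famA i j _ _ _ _ x⟩

theorem IsBiFamily.isWeight (h : IsBiFamily ρ σ Ψ) {x : E} (hx : ρ.IsWeight α β x)
    (p : Fin a) (q : Fin b) (p' : Fin a) (q' : Fin b) :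
    σ.IsWeight (α + Pi.single p 1 + Pi.single p' 1) (β + Pi.single q 1 + Pi.single q' 1)
      (Ψ p q p' q' x) where
  wtA i := by
    rw [h.famA, hx.wtA, map_smul]
    simp only [Pi.add_apply, add_smul, Pi.single_apply, add_assoc]
    by_cases hi : p = i <;> by_cases hi' : p' = i
    · subst hi hi'; simp
    · subst hi; simp [hi', Ne.symm hi']
    · subst hi'; simp [hi, Ne.symm hi]
    · simp [hi, Ne.symm hi, hi', Ne.symm hi']
  wtB i := by
    rw [h.famB, hx.wtB, map_smul]
    simp only [Pi.add_apply, add_smul, Pi.single_apply, add_assoc]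
    by_cases hi : q = i <;> by_cases hi' : q' = i
    · subst hi hi'; simp
    · subst hi; simp [hi', Ne.symm hi']
    · subst hi'; simp [hi, Ne.symm hi]
    · simp [hi, Ne.symm hi, hi', Ne.symm hi']

theorem IsBiFamily.eq_zero (h : IsBiFamily ρ σ Ψ) (hv : ρ.IsHighest α β v)
    (h0 : ∀ p q p' q', Ψ p q p' q' v = 0) (p : Fin a) (q : Fin b) (p' : Fin a) (q' : Fin b) :
    Ψ p q p' q' = 0 := by
  have hK : ρ.Invariant (⨅ p, ⨅ q, ⨅ p', ⨅ q', LinearMap.ker (Ψ p q p' q')) := by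
    constructor
    · intro i j x hx
      simp only [Submodule.mem_iInf, LinearMap.mem_ker] at hx ⊢
      intro p q p' q'
      have := h.famA i j p q p' q' x
      rw [hx, hx, hx, map_zero] at this
      simpa using this.symm
    · intro i j x hx
      simp only [Submodule.mem_iInf, LinearMap.mem_ker] at hx ⊢
      intro p q p' q'
      have := h.famB i j p q p' q' x
      rw [hx, hx, hx, map_zero] at this
      simpa using this.symm
  have hvK : v ∈ ⨅ p, ⨅ q, ⨅ p', ⨅ q', LinearMap.ker (Ψ p q p' q') := by
    simpa only [Submodule.mem_iInf, LinearMap.mem_ker] using h0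
  have htop := (hv.irred _ hK).resolve_left fun hbot =>
    hv.ne_zero ((Submodule.mem_bot ℂ).1 (hbot ▸ hvK))
  ext x
  have hx : x ∈ ⨅ p, ⨅ q, ⨅ p', ⨅ q', LinearMap.ker (Ψ p q p' q') := htop ▸ Submodule.mem_top
  simp only [Submodule.mem_iInf, LinearMap.mem_ker] at hx
  exact hx p q p' q'

/-- A nonzero equivariant bilinear map is nonzero on the maximal vector and a pair of basis vectors
for which the value has the maximal weight. -/
theorem IsBiFamily.exists_of_ne_zero (h : IsBiFamily ρ σ Ψ) (hv : ρ.IsHighest α β v) {w : F}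
    (hw : σ.IsHighest α' β' w) (h0 : ∃ p q p' q', Ψ p q p' q' ≠ 0) :
    ∃ p q p' q', Ψ p q p' q' v ≠ 0 ∧ α' = α + Pi.single p 1 + Pi.single p' 1 ∧
      β' = β + Pi.single q 1 + Pi.single q' 1 := by
  obtain ⟨i, hi⟩ := hw.exists_of_ne_zero
    (s := fun i : (Fin a × Fin b) × Fin a × Fin b => Ψ i.1.1 i.1.2 i.2.1 i.2.2 v)
    (fun i => (i.1.1 : ℕ) + i.1.2 + i.2.1 + i.2.2)
    (fun i => h.isWeight hv.toIsWeight i.1.1 i.1.2 i.2.1 i.2.2)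
    (fun i l m hlm hj => by
      have hlm' : (l : ℕ) < m := hlm
      rw [h.famA, hv.raiseA l m hlm, map_zero, zero_add]
      have h1 : (if i.1.1 = m then Ψ l i.1.2 i.2.1 i.2.2 v else 0) = 0 := by
        split_ifs with h
        · exact hj ((l, i.1.2), i.2) (by simp only [h]; omega)
        · rfl
      have h2 : (if i.2.1 = m then Ψ i.1.1 i.1.2 l i.2.2 v else 0) = 0 := by
        split_ifs with h
        · exact hj (i.1, (l, i.2.2)) (by simp only [h]; omega)
        · rfl
      rw [h1, h2, add_zero])
    (fun i l m hlm hj => by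
      have hlm' : (l : ℕ) < m := hlm
      rw [h.famB, hv.raiseB l m hlm, map_zero, zero_add]
      have h1 : (if i.1.2 = m then Ψ i.1.1 l i.2.1 i.2.2 v else 0) = 0 := by
        split_ifs with h
        · exact hj ((i.1.1, l), i.2) (by simp only [h]; omega)
        · rfl
      have h2 : (if i.2.2 = m then Ψ i.1.1 i.1.2 i.2.1 l v else 0) = 0 := by
        split_ifs with h
        · exact hj (i.1, (i.2.1, l)) (by simp only [h]; omega)
        · rfl
      rw [h1, h2, add_zero])
    (by
      by_contra! hs
      obtain ⟨p, q, p', q', hne⟩ := h0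
      exact hne (h.eq_zero hv (fun p q p' q' => hs ((p, q), (p', q'))) p q p' q'))
  exact ⟨_, _, _, _, hi⟩

/-- A simple lowering operator kills the maximal vector if the corresponding coordinate of the
weight vanishes. -/
theorem IsHighest.lower_eq_zero (hv : ρ.IsHighest α β v) {p₁ p₂ : Fin a}
    (hp : (p₂ : ℕ) = p₁ + 1) (hα : α p₁ = α p₂) : ρ.A p₂ p₁ v = 0 := by
  have hne : p₁ ≠ p₂ := fun h => by rw [h] at hp; omega
  have hwt : ∀ l, ρ.A l l (ρ.A p₂ p₁ v) =
      (α l + ((if l = p₂ then 1 else 0) - (if l = p₁ then 1 else 0))) • ρ.A p₂ p₁ v := by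
    intro l
    rw [ρ.relA l l p₂ p₁, hv.wtA, map_smul, add_smul, sub_smul]
    congr 2
    · split_ifs with h
      · rw [h, one_smul]
      · rw [zero_smul]
    · split_ifs with h
      · rw [h, one_smul]
      · rw [zero_smul]
  have hs : ρ.IsSingular (fun l => α l + ((if l = p₂ then 1 else 0) - (if l = p₁ then 1 else 0))) β
      (ρ.A p₂ p₁ v) :=
    { wtA := hwt
      wtB := fun l => by rw [← ρ.comm, hv.wtB, map_smul]
      raiseA := fun l m hlm => by
        have hlm' : (l : ℕ) < m := hlm
        rw [ρ.relA l m p₂ p₁, hv.raiseA l m hlm, map_zero, zero_add]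
        by_cases h1 : m = p₂ <;> by_cases h2 : l = p₁
        · subst h1 h2
          simp [hv.wtA, hα]
        · subst h1
          have h3 : l < p₁ := by
            rw [Fin.lt_def]
            have : (l : ℕ) ≠ p₁ := fun h => h2 (Fin.ext h)
            omega
          simp [h2, hv.raiseA l p₁ h3]
        · subst h2
          have h3 : p₂ < m := by
            rw [Fin.lt_def]
            have : (m : ℕ) ≠ p₂ := fun h => h1 (Fin.ext h)
            omega
          simp [h1, hv.raiseA p₂ m h3]
        · simp [h1, h2]
      raiseB := fun l m hlm => by rw [← ρ.comm, hv.raiseB l m hlm, map_zero] }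
  obtain ⟨c, hc⟩ := hv.exists_eq_smul hs
  have h1 := hwt p₁
  rw [hc, map_smul, hv.wtA, smul_comm c, ← hc, if_neg hne, if_pos rfl] at h1
  have h2 : (1 : ℂ) • ρ.A p₂ p₁ v = 0 := by
    rw [← sub_eq_zero, ← sub_smul] at h1
    rw [← h1]
    congr 1
    ring
  rwa [one_smul] at h2

/-- The linear constraint on equivariant bilinear maps in the case `p̃ = 1`. -/
theorem IsBiFamily.swap_first (h : IsBiFamily ρ σ Ψ) (hv : ρ.IsHighest α β v) {w : F}
    {p₁ p₂ : Fin a} (hw : σ.IsHighest (α + Pi.single p₁ 1 + Pi.single p₂ 1) β' w)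
    (hp : (p₂ : ℕ) = p₁ + 1) (hα : α p₁ = α p₂) (q q' : Fin b) :
    Ψ p₂ q p₁ q' v = -Ψ p₁ q p₂ q' v := by
  have h1 : Ψ p₁ q p₁ q' v = 0 :=
    hw.eq_zero_of_lt rfl rfl (by rw [Fin.lt_def]; omega) (h.isWeight hv.toIsWeight p₁ q p₁ q')
  have h2 := h.famA p₂ p₁ p₁ q p₁ q' v
  rw [h1, hv.lower_eq_zero hp hα, map_zero, map_zero, if_pos rfl, if_pos rfl, zero_add] at h2
  exact eq_neg_of_add_eq_zero_left h2.symm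

end GLAction

attribute [local instance 100] LieRing.ofAssociativeRing

variable {k n : ℕ}

/-! ### The Levi subalgebra and the nilradical -/

/-- The column in which the root vectors `n_{p,q}` are supported. -/
def colIdx (hk : k < n) (p : Fin (k + 1)) : Fin (n + 1) := ⟨k - p, by omega⟩

/-- The row in which the root vectors `n_{p,q}` are supported. -/
def rowIdx (q : Fin (n - k)) : Fin (n + 1) := ⟨k + 1 + q, by omega⟩

theorem colIdx_inj (hk : k < n) {p p' : Fin (k + 1)} : colIdx hk p = colIdx hk p' ↔ p = p' := by
  simp only [colIdx, Fin.ext_iff]; omega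

theorem rowIdx_inj {q q' : Fin (n - k)} : rowIdx q = rowIdx q' ↔ q = q' := by
  simp only [rowIdx, Fin.ext_iff]; omega

theorem colIdx_ne_rowIdx (hk : k < n) (p : Fin (k + 1)) (q : Fin (n - k)) :
    colIdx hk p ≠ rowIdx q := by
  simp only [colIdx, rowIdx, ne_eq, Fin.mk.injEq]; omega

theorem exists_idx (hk : k < n) (i : Fin (n + 1)) :
    (∃ p, colIdx hk p = i) ∨ ∃ q : Fin (n - k), rowIdx q = i := by
  rcases Nat.lt_or_ge k i with h | h
  · exact .inr ⟨⟨i - (k + 1), by omega⟩, by simp only [rowIdx, Fin.ext_iff]; omega⟩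
  · exact .inl ⟨⟨k - i, by omega⟩, by simp only [colIdx, Fin.ext_iff]; omega⟩

theorem colIdx_block (hk : k < n) (p p' : Fin (k + 1)) :
    (colIdx hk p : ℕ) ≤ k ↔ (colIdx hk p' : ℕ) ≤ k := by
  simp [colIdx]

theorem rowIdx_block (q q' : Fin (n - k)) : (rowIdx q : ℕ) ≤ k ↔ (rowIdx q' : ℕ) ≤ k := by
  simp only [rowIdx]; omega

/-- The traceless part of the elementary matrix `E_{i,j}`. -/
noncomputable def tracelessUnit (n : ℕ) (i j : Fin (n + 1)) :
    Matrix (Fin (n + 1)) (Fin (n + 1)) ℂ :=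
  Matrix.single i j 1 - (if i = j then (1 / ((n : ℂ) + 1)) else 0) • 1

theorem tracelessUnit_mem (i j : Fin (n + 1)) (h : (i : ℕ) ≤ k ↔ (j : ℕ) ≤ k) :
    tracelessUnit n i j ∈ levi k n := by
  refine ⟨?_, fun l m hlm => ?_⟩
  · have hn : (n : ℂ) + 1 ≠ 0 := Nat.cast_add_one_ne_zero n
    rw [tracelessUnit, Matrix.trace_sub, Matrix.trace_smul, Matrix.trace_one]
    by_cases hij : i = j
    · subst hij
      simp [Matrix.trace_single_eq_same, hn]
    · simp [Matrix.trace_single_eq_of_ne _ _ _ hij, hij]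
  · have h1 : l ≠ m := fun h => hlm (by rw [h])
    have h2 : ¬(i = l ∧ j = m) := by
      rintro ⟨rfl, rfl⟩
      exact hlm h
    rw [tracelessUnit, Matrix.sub_apply, Matrix.smul_apply, Matrix.one_apply_ne h1, smul_zero,
      sub_zero, Matrix.single_apply, if_neg h2]

/-- The traceless part of `E_{i,j}` as an element of the Levi subalgebra, and zero if `i` and `j`
lie in different blocks. -/
noncomputable def leviUnit (k n : ℕ) (i j : Fin (n + 1)) : levi k n :=
  if h : (i : ℕ) ≤ k ↔ (j : ℕ) ≤ k then ⟨tracelessUnit n i j, tracelessUnit_mem i j h⟩ else 0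

theorem coe_leviUnit {i j : Fin (n + 1)} (h : (i : ℕ) ≤ k ↔ (j : ℕ) ≤ k) :
    (leviUnit k n i j : Matrix (Fin (n + 1)) (Fin (n + 1)) ℂ) = tracelessUnit n i j := by
  rw [leviUnit, dif_pos h]

theorem lie_tracelessUnit (i j : Fin (n + 1)) (M : Matrix (Fin (n + 1)) (Fin (n + 1)) ℂ) :
    ⁅tracelessUnit n i j, M⁆ = Matrix.single i j 1 * M - M * Matrix.single i j 1 := by
  rw [Ring.lie_def, tracelessUnit, sub_mul, mul_sub, smul_mul_assoc, one_mul, mul_smul_comm,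
    mul_one]
  abel

theorem lie_tracelessUnit_single (i j l m : Fin (n + 1)) :
    ⁅tracelessUnit n i j, (Matrix.single l m 1 : Matrix (Fin (n + 1)) (Fin (n + 1)) ℂ)⁆ =
      (if j = l then Matrix.single i m 1 else 0) - (if i = m then Matrix.single l j 1 else 0) := by
  rw [lie_tracelessUnit]
  congr 1
  · split_ifs with h
    · subst h; simp
    · simp [Matrix.single_mul_single_of_ne, h]
  · split_ifs with h
    · subst h; simp
    · simp [Matrix.single_mul_single_of_ne, Ne.symm h]

theorem lie_leviUnit {i j l m : Fin (n + 1)} (h : (i : ℕ) ≤ k ↔ (j : ℕ) ≤ k)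
    (h' : (l : ℕ) ≤ k ↔ (m : ℕ) ≤ k) :
    ⁅leviUnit k n i j, leviUnit k n l m⁆ =
      (if j = l then leviUnit k n i m else 0) - (if i = m then leviUnit k n l j else 0) := by
  apply Subtype.ext
  rw [LieSubalgebra.coe_bracket, coe_leviUnit h, coe_leviUnit h']
  have h1 : ⁅tracelessUnit n i j, tracelessUnit n l m⁆ = ⁅tracelessUnit n i j,
      (Matrix.single l m 1 : Matrix (Fin (n + 1)) (Fin (n + 1)) ℂ)⁆ := by
    rw [tracelessUnit, tracelessUnit, lie_sub, lie_smul, Ring.lie_def _ 1, mul_one, one_mul,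
      sub_self, smul_zero, sub_zero]
  rw [h1, lie_tracelessUnit_single]
  by_cases hjl : j = l
  · subst hjl
    by_cases him : i = m
    · subst him
      simp [coe_leviUnit, tracelessUnit]
    · rw [if_pos rfl, if_pos rfl, if_neg him, if_neg him, sub_zero, sub_zero,
        coe_leviUnit (h.trans h'), tracelessUnit, if_neg him, zero_smul, sub_zero]
  · rw [if_neg hjl, if_neg hjl]
    by_cases him : i = m
    · subst him
      rw [if_pos rfl, if_pos rfl, zero_sub, zero_sub, NegMemClass.coe_neg,
        coe_leviUnit (h'.trans h), tracelessUnit, if_neg (Ne.symm hjl), zero_smul, sub_zero]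
    · simp [him]

/-- The traceless parts of the elementary matrices span the Levi subalgebra. -/
theorem levi_eq_sum (x : levi k n) : x = ∑ i, ∑ j, x.1 i j • leviUnit k n i j := by
  apply Subtype.ext
  have hsum : ((∑ i, ∑ j, x.1 i j • leviUnit k n i j : levi k n) :
      Matrix (Fin (n + 1)) (Fin (n + 1)) ℂ) = ∑ i, ∑ j, x.1 i j • tracelessUnit n i j := by
    rw [AddSubmonoidClass.coe_finsetSum]
    refine Finset.sum_congr rfl fun i _ => ?_
    rw [AddSubmonoidClass.coe_finsetSum]
    refine Finset.sum_congr rfl fun j _ => ?_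
    by_cases h : (i : ℕ) ≤ k ↔ (j : ℕ) ≤ k
    · rw [← coe_leviUnit h]; rfl
    · rw [x.2.2 i j h, zero_smul, zero_smul]; rfl
  rw [hsum]
  have htr : ∑ i, ∑ j, x.1 i j * (if i = j then (1 / ((n : ℂ) + 1)) else 0) = 0 := by
    simp only [mul_ite, mul_zero, Finset.sum_ite_eq, Finset.mem_univ, if_true]
    rw [← Finset.sum_mul]
    have : ∑ i, x.1 i i = 0 := x.2.1
    rw [this, zero_mul]
  simp only [tracelessUnit, smul_sub, smul_smul, Finset.sum_sub_distrib, ← Finset.sum_smul, htr,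
    zero_smul, sub_zero, Matrix.smul_single, smul_eq_mul, mul_one]
  exact Matrix.matrix_eq_sum_single x.1

theorem levi_submodule_eq_top (hk : k < n) (S : Submodule ℂ (levi k n))
    (hA : ∀ p p', leviUnit k n (colIdx hk p) (colIdx hk p') ∈ S)
    (hB : ∀ q q' : Fin (n - k), leviUnit k n (rowIdx q) (rowIdx q') ∈ S) : S = ⊤ := by
  refine eq_top_iff.2 fun x _ => ?_
  rw [levi_eq_sum x]
  refine sum_mem fun i _ => sum_mem fun j _ => S.smul_mem _ ?_
  rcases exists_idx hk i with ⟨p, rfl⟩ | ⟨p, rfl⟩ <;>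
    rcases exists_idx hk j with ⟨q, rfl⟩ | ⟨q, rfl⟩
  · exact hA p q
  · rw [leviUnit, dif_neg]
    · exact zero_mem _
    · simp [colIdx, rowIdx]; omega
  · rw [leviUnit, dif_neg]
    · exact zero_mem _
    · simp [colIdx, rowIdx]; omega
  · exact hB p q

/-- The root vectors span the nilradical. -/
theorem nilradical_eq_sum (hk : k < n) (x : nilradical k n) :
    x = ∑ p, ∑ q, x.1 (rowIdx q) (colIdx hk p) • rootVector k n p q := by
  apply Subtype.ext
  have hsum : ((∑ p, ∑ q, x.1 (rowIdx q) (colIdx hk p) • rootVector k n p q : nilradical k n) :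
      Matrix (Fin (n + 1)) (Fin (n + 1)) ℂ) =
      ∑ p, ∑ q : Fin (n - k),
        Matrix.single (rowIdx q) (colIdx hk p) (x.1 (rowIdx q) (colIdx hk p)) := by
    rw [AddSubmonoidClass.coe_finsetSum]
    refine Finset.sum_congr rfl fun i _ => ?_
    rw [AddSubmonoidClass.coe_finsetSum]
    refine Finset.sum_congr rfl fun j _ => ?_
    rw [LieSubmodule.coe_smul, rootVector]
    simp [Matrix.smul_single, rowIdx, colIdx]
  rw [hsum]
  ext i j
  simp only [Matrix.sum_apply, Matrix.single_apply]
  rcases exists_idx hk i with ⟨p, rfl⟩ | ⟨q, rfl⟩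
  · rw [x.2 _ _ (by simp [colIdx])]
    refine (Finset.sum_eq_zero fun p' _ => Finset.sum_eq_zero fun q' _ => ?_).symm
    rw [if_neg fun h => colIdx_ne_rowIdx hk p q' h.1.symm]
  · rcases exists_idx hk j with ⟨p, rfl⟩ | ⟨q', rfl⟩
    · rw [Finset.sum_eq_single p, Finset.sum_eq_single q]
      · simp
      · intro q' _ hq
        rw [if_neg fun h => hq (rowIdx_inj.1 h.1)]
      · simp
      · intro p' _ hp
        refine Finset.sum_eq_zero fun q' _ => ?_
        rw [if_neg fun h => hp ((colIdx_inj hk).1 h.2)]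
      · simp
    · rw [x.2 _ _ (by simp only [rowIdx]; omega)]
      refine (Finset.sum_eq_zero fun p' _ => Finset.sum_eq_zero fun q' _ => ?_).symm
      rw [if_neg fun h => colIdx_ne_rowIdx hk _ _ h.2]

theorem nilradical_linearMap_ext (hk : k < n) {X : Type*} [AddCommGroup X] [Module ℂ X]
    {f g : nilradical k n →ₗ[ℂ] X} (h : ∀ p q, f (rootVector k n p q) = g (rootVector k n p q)) :
    f = g := by
  ext x
  rw [nilradical_eq_sum hk x]
  simp only [map_sum, map_smul, h]

theorem lie_leviUnit_col_rootVector (hk : k < n) (i j p : Fin (k + 1)) (q : Fin (n - k)) :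
    ⁅leviUnit k n (colIdx hk j) (colIdx hk i), rootVector k n p q⁆ =
      -(if p = j then rootVector k n i q else 0) := by
  apply Subtype.ext
  rw [LieSubmodule.coe_bracket, LieSubalgebra.coe_bracket_of_module,
    coe_leviUnit (colIdx_block hk j i)]
  change ⁅_, Matrix.single (rowIdx q) (colIdx hk p) (1 : ℂ)⁆ = _
  rw [lie_tracelessUnit_single, if_neg (colIdx_ne_rowIdx hk i q), zero_sub, NegMemClass.coe_neg]
  simp only [colIdx_inj]
  by_cases h : p = j
  · rw [if_pos h.symm, if_pos h]; rfl
  · rw [if_neg (Ne.symm h), if_neg h]; rfl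

theorem lie_leviUnit_row_rootVector (hk : k < n) (i j : Fin (n - k)) (p : Fin (k + 1))
    (q : Fin (n - k)) :
    ⁅leviUnit k n (rowIdx i) (rowIdx j), rootVector k n p q⁆ =
      if q = j then rootVector k n p i else 0 := by
  apply Subtype.ext
  rw [LieSubmodule.coe_bracket, LieSubalgebra.coe_bracket_of_module,
    coe_leviUnit (rowIdx_block i j)]
  change ⁅_, Matrix.single (rowIdx q) (colIdx hk p) (1 : ℂ)⁆ = _
  rw [lie_tracelessUnit_single, if_neg (colIdx_ne_rowIdx hk p i).symm, sub_zero]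
  simp only [rowIdx_inj]
  by_cases h : q = j
  · rw [if_pos h.symm, if_pos h]; rfl
  · rw [if_neg (Ne.symm h), if_neg h]; rfl

/-- The action of `gl(k+1) × gl(n-k)` on an `𝓡`-module for which the root vectors `n_{p,q}` are the
standard basis vectors of `ℂ^{k+1} ⊗ ℂ^{n-k}`: on the first factor, it is the dual of the usual
action of the upper left block, with the order of the basis reversed. -/
noncomputable def leviAction (hk : k < n) (E : Type*) [AddCommGroup E] [Module ℂ E]
    [LieRingModule (levi k n) E] [LieModule ℂ (levi k n) E] : GLAction (k + 1) (n - k) E where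
  A i j := -LieModule.toEnd ℂ (levi k n) E (leviUnit k n (colIdx hk j) (colIdx hk i))
  B i j := LieModule.toEnd ℂ (levi k n) E (leviUnit k n (rowIdx i) (rowIdx j))
  relA i j l m x := by
    have h := lie_leviUnit (colIdx_block hk j i) (colIdx_block hk m l)
    have h2 := congrArg (fun y => ⁅y, x⁆) h
    simp only [lie_lie, colIdx_inj, sub_lie] at h2
    simp only [LinearMap.neg_apply, LieModule.toEnd_apply_apply, lie_neg, neg_neg]
    rw [← sub_eq_iff_eq_add', h2]
    split_ifs <;> simp [sub_eq_add_neg, add_comm]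
  relB i j l m x := by
    have h := lie_leviUnit (rowIdx_block i j) (rowIdx_block l m)
    have h2 := congrArg (fun y => ⁅y, x⁆) h
    simp only [lie_lie, rowIdx_inj, sub_lie] at h2
    simp only [LieModule.toEnd_apply_apply]
    rw [← sub_eq_iff_eq_add', h2]
    split_ifs <;> simp
  comm i j l m x := by
    have h := lie_leviUnit (colIdx_block hk j i) (rowIdx_block l m)
    rw [if_neg (colIdx_ne_rowIdx hk _ _), if_neg (colIdx_ne_rowIdx hk _ _), sub_zero] at h
    have h2 := congrArg (fun y => ⁅y, x⁆) h
    simp only [lie_lie, zero_lie, sub_eq_zero] at h2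
    simp only [LinearMap.neg_apply, LieModule.toEnd_apply_apply, lie_neg, h2]

section

variable (hk : k < n) {E F : Type*}
  [AddCommGroup E] [Module ℂ E] [LieRingModule (levi k n) E] [LieModule ℂ (levi k n) E]
  [AddCommGroup F] [Module ℂ F] [LieRingModule (levi k n) F] [LieModule ℂ (levi k n) F]

theorem leviAction_A (i j : Fin (k + 1)) (x : E) :
    (leviAction hk E).A i j x = -⁅leviUnit k n (colIdx hk j) (colIdx hk i), x⁆ := rfl

theorem leviAction_B (i j : Fin (n - k)) (x : E) :
    (leviAction hk E).B i j x = ⁅leviUnit k n (rowIdx i) (rowIdx j), x⁆ := rfl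

/-- Equivariance of an element of `Ext¹` in terms of its values on the root vectors. -/
theorem isFamily_ext1 (m : Ext1 k n E F) :
    GLAction.IsFamily (leviAction hk E) (leviAction hk F) fun p q => m (rootVector k n p q) where
  famA i j p q x := by
    have h := LinearMap.congr_fun
      (m.map_lie (leviUnit k n (colIdx hk j) (colIdx hk i)) (rootVector k n p q)) x
    rw [lie_leviUnit_col_rootVector, LieHom.lie_apply] at h
    rw [leviAction_A, leviAction_A, map_neg, ← sub_eq_iff_eq_add', neg_sub_neg, ← neg_sub, ← h]
    split_ifs <;> simp
  famB i j p q x := by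
    have h := LinearMap.congr_fun
      (m.map_lie (leviUnit k n (rowIdx i) (rowIdx j)) (rootVector k n p q)) x
    rw [lie_leviUnit_row_rootVector hk, LieHom.lie_apply] at h
    rw [leviAction_B, leviAction_B, ← sub_eq_iff_eq_add', ← h]
    split_ifs <;> simp

/-- The element of `Ext¹` given by an equivariant family. -/
theorem exists_ext1 {φ : Fin (k + 1) → Fin (n - k) → E →ₗ[ℂ] F}
    (hφ : GLAction.IsFamily (leviAction hk E) (leviAction hk F) φ) :
    ∃ m : Ext1 k n E F, ∀ p q, m (rootVector k n p q) = φ p q := by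
  let f : nilradical k n →ₗ[ℂ] E →ₗ[ℂ] F :=
    { toFun := fun x => ∑ p, ∑ q, x.1 (rowIdx q) (colIdx hk p) • φ p q
      map_add' := fun x y => by simp [add_smul, Finset.sum_add_distrib]
      map_smul' := fun c x => by simp [Finset.smul_sum, smul_smul] }
  have hf : ∀ p q, f (rootVector k n p q) = φ p q := by
    intro p q
    change ∑ p', ∑ q', Matrix.single (rowIdx q) (colIdx hk p) (1 : ℂ) (rowIdx q') (colIdx hk p') •
      φ p' q' = φ p q
    simp only [Matrix.single_apply, rowIdx_inj, colIdx_inj]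
    rw [Finset.sum_eq_single p, Finset.sum_eq_single q]
    · simp
    · intro q' _ hq; simp [Ne.symm hq]
    · simp
    · intro p' _ hp; simp [Ne.symm hp]
    · simp
  have key : ∀ (x : levi k n) (y : nilradical k n), f ⁅x, y⁆ = ⁅x, f y⁆ := by
    let S : Submodule ℂ (levi k n) :=
      { carrier := {x | ∀ p q, f ⁅x, rootVector k n p q⁆ = ⁅x, f (rootVector k n p q)⁆}
        zero_mem' := by simp
        add_mem' := by
          intro x y hx hy p q
          rw [add_lie, add_lie, map_add, hx, hy]
        smul_mem' := by
          intro c x hx p q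
          rw [smul_lie, smul_lie, map_smul, hx] }
    have hS : S = ⊤ := by
      refine levi_submodule_eq_top hk S (fun j i p q => ?_) (fun i j p q => ?_)
      · rw [lie_leviUnit_col_rootVector, hf]
        ext x
        have h := hφ.famA i j p q x
        rw [leviAction_A, leviAction_A, map_neg, ← sub_eq_iff_eq_add', neg_sub_neg, ← neg_sub] at h
        rw [LieHom.lie_apply, ← neg_eq_iff_eq_neg.2 h.symm]
        split_ifs <;> simp [hf]
      · rw [lie_leviUnit_row_rootVector hk, hf]
        ext x
        have h := hφ.famB i j p q x
        rw [leviAction_B, leviAction_B, ← sub_eq_iff_eq_add'] at h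
        rw [LieHom.lie_apply, h]
        split_ifs <;> simp [hf]
    intro x y
    have hx : x ∈ S := hS ▸ Submodule.mem_top
    have := nilradical_linearMap_ext hk (f := f ∘ₗ LieModule.toEnd ℂ (levi k n) (nilradical k n) x)
      (g := LieModule.toEnd ℂ (levi k n) (E →ₗ[ℂ] F) x ∘ₗ f) hx
    exact LinearMap.congr_fun this y
  exact ⟨{ f with map_lie' := fun {x y} => key x y }, hf⟩

theorem ext1_ext (hk : k < n) {m m' : Ext1 k n E F}
    (h : ∀ p q, m (rootVector k n p q) = m' (rootVector k n p q)) : m = m' := by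
  have := nilradical_linearMap_ext hk
    (f := (m : nilradical k n →ₗ[ℂ] E →ₗ[ℂ] F)) (g := (m' : nilradical k n →ₗ[ℂ] E →ₗ[ℂ] F)) h
  ext1 x
  exact LinearMap.congr_fun this x

end

/-! ### Weights of `𝓡` and of `gl(k+1) × gl(n-k)` -/

/-- The coefficient of the `j`-th coroot in the traceless part of `E_{i,i}`. -/
noncomputable def corootCoeff (i : Fin (n + 1)) (j : Fin n) : ℂ :=
  (if i ≤ j.castSucc then 1 else 0) - ((j : ℂ) + 1) / ((n : ℂ) + 1)

theorem sum_corootCoeff (i m : Fin (n + 1)) :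
    ∑ j : Fin n, corootCoeff i j *
      ((if m = j.castSucc then 1 else 0) - (if m = j.succ then 1 else 0)) =
      (if m = i then 1 else 0) - 1 / ((n : ℂ) + 1) := by
  have hn : (n : ℂ) + 1 ≠ 0 := Nat.cast_add_one_ne_zero n
  -- both sums become sums over `Fin (n + 1)`, since the additional terms vanish
  have h1 : ∑ j : Fin n, corootCoeff i j * (if m = j.castSucc then 1 else 0) =
      (if i ≤ m then 1 else 0) - ((m : ℂ) + 1) / ((n : ℂ) + 1) := by
    have := Fin.sum_univ_castSucc (fun j : Fin (n + 1) =>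
      ((if i ≤ j then 1 else 0) - ((j : ℂ) + 1) / ((n : ℂ) + 1)) * (if m = j then 1 else 0))
    rw [if_pos (Fin.le_last i), Fin.val_last, div_self hn, sub_self, zero_mul, add_zero] at this
    simp only [corootCoeff]
    simpa using this.symm
  have h2 : ∑ j : Fin n, corootCoeff i j * (if m = j.succ then 1 else 0) =
      (if i < m then 1 else 0) - (m : ℂ) / ((n : ℂ) + 1) := by
    have := Fin.sum_univ_succ (fun j : Fin (n + 1) =>
      ((if i < j then 1 else 0) - (j : ℂ) / ((n : ℂ) + 1)) * (if m = j then 1 else 0))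
    rw [if_neg (Fin.not_lt_zero i), Fin.val_zero, Nat.cast_zero, zero_div, sub_self, zero_mul,
      zero_add] at this
    simp only [corootCoeff, Fin.le_castSucc_iff]
    simpa using this.symm
  simp only [mul_sub, Finset.sum_sub_distrib, h1, h2]
  rcases lt_trichotomy i m with h | rfl | h
  · simp only [h.le, h, h.ne', if_true, if_false]; ring
  · simp only [le_rfl, lt_irrefl, if_true, if_false]; ring
  · simp only [h.not_ge, h.not_gt, h.ne, if_false]; ring

theorem leviUnit_diag (i : Fin (n + 1)) :
    leviUnit k n i i = ∑ j, corootCoeff i j • coroot k n j := by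
  apply Subtype.ext
  rw [coe_leviUnit Iff.rfl, AddSubmonoidClass.coe_finsetSum]
  ext l m
  have h : ∀ j : Fin n, ((corootCoeff i j • coroot k n j : levi k n) :
      Matrix (Fin (n + 1)) (Fin (n + 1)) ℂ) l m = if l = m then corootCoeff i j *
      ((if m = j.castSucc then 1 else 0) - (if m = j.succ then 1 else 0)) else 0 := by
    intro j
    change corootCoeff i j * Matrix.diagonal _ l m = _
    rw [Matrix.diagonal_apply]
    split_ifs with hlm <;> simp_all
  rw [Matrix.sum_apply, Finset.sum_congr rfl fun j _ => h j]
  by_cases hlm : l = m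
  · subst hlm
    simp only [if_true]
    rw [sum_corootCoeff, tracelessUnit, if_pos rfl, Matrix.sub_apply, Matrix.smul_apply,
      Matrix.one_apply_eq, Matrix.single_apply, smul_eq_mul, mul_one]
    congr 1
    by_cases hi : i = l <;> simp [hi, eq_comm]
  · simp only [hlm, if_false, Finset.sum_const_zero]
    rw [tracelessUnit, if_pos rfl, Matrix.sub_apply, Matrix.smul_apply, Matrix.one_apply_ne hlm,
      smul_zero, sub_zero, Matrix.single_apply, if_neg fun h => hlm (h.1.symm.trans h.2)]

/-- The coordinates of the weight `∑ c_j λ_j` with respect to the diagonal entries: the eigenvalue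
of the traceless part of `E_{i,i}`. -/
noncomputable def diagWeight (c : Fin n → ℤ) (i : Fin (n + 1)) : ℂ :=
  ∑ j : Fin n, corootCoeff i j * c j

theorem diagWeight_sub (c : Fin n → ℤ) {i i' : Fin (n + 1)} (h : i ≤ i') :
    diagWeight c i - diagWeight c i' = ((∑ j ∈ Finset.univ.filter
      (fun j : Fin n => (i : ℕ) ≤ (j : ℕ) ∧ (j : ℕ) < (i' : ℕ)), c j : ℤ) : ℂ) := by
  rw [diagWeight, diagWeight, ← Finset.sum_sub_distrib, Finset.sum_filter]
  push_cast
  refine Finset.sum_congr rfl fun j _ => ?_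
  have h' : (i : ℕ) ≤ i' := h
  simp only [corootCoeff, Fin.le_def, Fin.val_castSucc]
  by_cases h1 : (i : ℕ) ≤ j <;> by_cases h2 : (i' : ℕ) ≤ j
  · simp [h1, h2, not_lt.2 h2]
  · simp only [h1, h2, if_true, if_false, not_le.1 h2, and_self]; ring
  · omega
  · simp [h1, h2]

theorem diagWeight_castSucc_sub_succ (c : Fin n → ℤ) (j : Fin n) :
    diagWeight c j.castSucc - diagWeight c j.succ = c j := by
  rw [diagWeight_sub c (Fin.castSucc_lt_succ (i := j)).le, Finset.sum_eq_single_of_mem j]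
  · simp
  · intro b hb hbj
    simp only [Fin.val_castSucc, Fin.val_succ, Finset.mem_filter, Finset.mem_univ, true_and] at hb
    exact absurd (Fin.ext (by omega)) hbj

theorem rootWeight_apply (hk : k < n) (p : Fin (k + 1)) (q : Fin (n - k)) (j : Fin n) :
    rootWeight k n p q j =
      ((if rowIdx q = j.castSucc then 1 else 0) - (if rowIdx q = j.succ then 1 else 0)) -
        ((if colIdx hk p = j.castSucc then 1 else 0) - (if colIdx hk p = j.succ then 1 else 0)) := by
  have key : ∀ i : Fin n, simpleRoot n i j =
      ((if i.castSucc = j.castSucc then 1 else 0) - (if i.castSucc = j.succ then 1 else 0)) -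
        ((if i.succ = j.castSucc then 1 else 0) - (if i.succ = j.succ then 1 else 0)) := by
    intro i
    simp only [simpleRoot, CartanMatrix.A, Matrix.of_apply, Fin.ext_iff, Fin.val_castSucc,
      Fin.val_succ]
    split_ifs <;> omega
  have tele : ∀ (f : ℕ → ℤ) (s t : ℕ), s ≤ t → t ≤ n →
      ∑ i ∈ Finset.univ.filter (fun i : Fin n => s ≤ (i : ℕ) ∧ (i : ℕ) < t), (f i - f (i + 1)) =
        f s - f t := by
    intro f s t hst htn
    -- the summand is the difference of consecutive values of `f`, truncated to `[s, t]`
    have h := Finset.sum_range_sub' (fun i => f (max s (min i t))) n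
    rw [← Fin.sum_univ_eq_sum_range (fun i => f (max s (min i t)) - f (max s (min (i + 1) t)))] at h
    rw [Finset.sum_filter]
    have h0 : max s (min 0 t) = s := by omega
    have hn : max s (min n t) = t := by omega
    rw [h0, hn] at h
    rw [← h]
    refine Finset.sum_congr rfl fun i _ => ?_
    by_cases h1 : s ≤ (i : ℕ) ∧ (i : ℕ) < t
    · have e1 : max s (min (i : ℕ) t) = i := by omega
      have e2 : max s (min ((i : ℕ) + 1) t) = i + 1 := by omega
      rw [if_pos h1, e1, e2]
    · have e1 : max s (min (i : ℕ) t) = max s (min ((i : ℕ) + 1) t) := by omega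
      rw [if_neg h1, e1, sub_self]
  have h := tele (fun x => (if x = (j : ℕ) then 1 else 0) - (if x = (j : ℕ) + 1 then 1 else 0))
    (k - p) (k + q + 1) (by omega) (by omega)
  have hfil : (Finset.univ.filter fun i : Fin n => k - (p : ℕ) ≤ (i : ℕ) ∧ (i : ℕ) ≤ k + (q : ℕ)) =
      Finset.univ.filter fun i : Fin n => k - (p : ℕ) ≤ (i : ℕ) ∧ (i : ℕ) < k + (q : ℕ) + 1 := by
    ext i; simp
  have e : k + (q : ℕ) + 1 = k + 1 + q := by omega
  simp only [rootWeight, Pi.neg_apply, Finset.sum_apply, key, hfil, Fin.ext_iff, Fin.val_castSucc,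
    Fin.val_succ, rowIdx, colIdx]
  rw [h, e, neg_sub]

theorem diagWeight_add_rootWeight (hk : k < n) (c : Fin n → ℤ) (p : Fin (k + 1)) (q : Fin (n - k))
    (i : Fin (n + 1)) : diagWeight (c + rootWeight k n p q) i = diagWeight c i +
      ((if rowIdx q = i then 1 else 0) - (if colIdx hk p = i then 1 else 0)) := by
  have h1 := sum_corootCoeff i (rowIdx q)
  have h2 := sum_corootCoeff i (colIdx hk p)
  simp only [diagWeight, Pi.add_apply, rootWeight_apply hk, Int.cast_add, mul_add,
    Finset.sum_add_distrib]
  congr 1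
  push_cast
  simp only [mul_sub _ (_ - _), Finset.sum_sub_distrib, h1, h2]
  ring

/-- The weight of `∑ c_j λ_j` on the first factor of `gl(k+1) × gl(n-k)`. -/
noncomputable def weightA (hk : k < n) (c : Fin n → ℤ) (p : Fin (k + 1)) : ℂ :=
  -diagWeight c (colIdx hk p)

/-- The weight of `∑ c_j λ_j` on the second factor of `gl(k+1) × gl(n-k)`. -/
noncomputable def weightB (c : Fin n → ℤ) (q : Fin (n - k)) : ℂ := diagWeight c (rowIdx q)

theorem weightA_add (hk : k < n) (c : Fin n → ℤ) (p : Fin (k + 1)) (q : Fin (n - k)) :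
    weightA hk (c + rootWeight k n p q) = weightA hk c + Pi.single p 1 := by
  ext i
  rw [weightA, diagWeight_add_rootWeight hk, if_neg (colIdx_ne_rowIdx hk i q).symm, Pi.add_apply,
    weightA, Pi.single_apply]
  simp only [colIdx_inj, eq_comm (a := p)]
  ring

theorem weightB_add (hk : k < n) (c : Fin n → ℤ) (p : Fin (k + 1)) (q : Fin (n - k)) :
    weightB (k := k) (c + rootWeight k n p q) = weightB c + Pi.single q 1 := by
  ext i
  rw [weightB, diagWeight_add_rootWeight hk, if_neg (colIdx_ne_rowIdx hk p i), Pi.add_apply,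
    weightB, Pi.single_apply]
  simp only [rowIdx_inj, eq_comm (a := q)]
  ring

theorem weight_injective (hk : k < n) {c c' : Fin n → ℤ} (hA : weightA hk c = weightA hk c')
    (hB : weightB (k := k) c = weightB c') : c = c' := by
  have h : ∀ i, diagWeight c i = diagWeight c' i := by
    intro i
    rcases exists_idx hk i with ⟨p, rfl⟩ | ⟨q, rfl⟩
    · exact neg_injective (congrFun hA p)
    · exact congrFun hB q
  ext j
  have h1 := diagWeight_castSucc_sub_succ c j
  rw [h, h, diagWeight_castSucc_sub_succ] at h1
  exact_mod_cast h1.symm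

theorem eq_add_rootWeight_iff (hk : k < n) {c c' : Fin n → ℤ} {p : Fin (k + 1)} {q : Fin (n - k)} :
    c' = c + rootWeight k n p q ↔ weightA hk c' = weightA hk c + Pi.single p 1 ∧
      weightB c' = weightB c + Pi.single q 1 := by
  constructor
  · rintro rfl
    exact ⟨weightA_add hk c p q, weightB_add hk c p q⟩
  · rintro ⟨hA, hB⟩
    exact weight_injective hk (hA.trans (weightA_add hk c p q).symm)
      (hB.trans (weightB_add hk c p q).symm)

theorem rootWeight_injective (hk : k < n) {c : Fin n → ℤ} {p p' : Fin (k + 1)} {q q' : Fin (n - k)}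
    (h : c + rootWeight k n p q = c + rootWeight k n p' q') : p = p' ∧ q = q' := by
  obtain ⟨hA, hB⟩ := (eq_add_rootWeight_iff hk).1 h
  rw [weightA_add, add_right_inj] at hA
  rw [weightB_add hk, add_right_inj] at hB
  exact ⟨GLAction.single_one_injective hA, GLAction.single_one_injective hB⟩

theorem pTilde_eq (hk : k < n) (a : Vertex k n) {p₁ p₂ : Fin (k + 1)} (h : p₁ ≤ p₂) :
    (pTilde a p₁ p₂ : ℂ) = weightA hk a.1 p₁ - weightA hk a.1 p₂ + (p₂ - p₁) := by
  have h' : (p₁ : ℕ) ≤ p₂ := h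
  have hle : colIdx hk p₂ ≤ colIdx hk p₁ := by
    simp only [colIdx, Fin.le_def]; omega
  rw [weightA, weightA, neg_sub_neg, diagWeight_sub _ hle, pTilde]
  push_cast
  rfl

theorem qTilde_eq (a : Vertex k n) {q₁ q₂ : Fin (n - k)} (h : q₁ ≤ q₂) :
    (qTilde a q₁ q₂ : ℂ) = weightB a.1 q₁ - weightB a.1 q₂ + (q₂ - q₁) := by
  have h' : (q₁ : ℕ) ≤ q₂ := h
  have hle : rowIdx q₁ ≤ rowIdx q₂ := by
    simp only [rowIdx, Fin.le_def]; omega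
  rw [weightB, weightB, diagWeight_sub _ hle, qTilde]
  push_cast
  rfl

theorem pTilde_ge (a : Vertex k n) (p₁ p₂ : Fin (k + 1)) : (p₂ : ℤ) - p₁ ≤ pTilde a p₁ p₂ := by
  refine le_add_of_nonneg_left (Finset.sum_nonneg fun j hj => a.2 j ?_)
  simp only [Finset.mem_filter, Finset.mem_univ, true_and] at hj
  omega

theorem qTilde_ge (a : Vertex k n) (q₁ q₂ : Fin (n - k)) : (q₂ : ℤ) - q₁ ≤ qTilde a q₁ q₂ := by
  refine le_add_of_nonneg_left (Finset.sum_nonneg fun j hj => a.2 j ?_)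
  simp only [Finset.mem_filter, Finset.mem_univ, true_and] at hj
  omega

theorem pTilde_pos (a : Vertex k n) {p₁ p₂ : Fin (k + 1)} (h : p₁ < p₂) : 0 < pTilde a p₁ p₂ := by
  have h1 := pTilde_ge a p₁ p₂
  have h2 : (p₁ : ℕ) < p₂ := h
  omega

theorem qTilde_pos (a : Vertex k n) {q₁ q₂ : Fin (n - k)} (h : q₁ < q₂) : 0 < qTilde a q₁ q₂ := by
  have h1 := qTilde_ge a q₁ q₂
  have h2 : (q₁ : ℕ) < q₂ := h
  omega

theorem regular_weightA (hk : k < n) (a : Vertex k n) : Regular (weightA hk a.1) :=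
  fun i j hij h => by
    rw [← pTilde_eq hk a hij.le] at h
    exact (pTilde_pos a hij).ne' (by exact_mod_cast h)

theorem regular_weightB (a : Vertex k n) : Regular (weightB (k := k) a.1) :=
  fun i j hij h => by
    rw [← qTilde_eq a hij.le] at h
    exact (qTilde_pos a hij).ne' (by exact_mod_cast h)

/-- `p̃ = 1` means that the rows `p₁` and `p₂` are adjacent and of the same length. -/
theorem pTilde_eq_one_iff (a : Vertex k n) {p₁ p₂ : Fin (k + 1)} (h : p₁ < p₂) :
    pTilde a p₁ p₂ = 1 ↔ (p₂ : ℕ) = p₁ + 1 ∧ ∀ j : Fin n, (j : ℕ) = k - p₂ → a.1 j = 0 := by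
  have h2 : (p₁ : ℕ) < p₂ := h
  have hsum : (p₂ : ℕ) = p₁ + 1 → ∀ j : Fin n, (j : ℕ) = k - p₂ →
      pTilde a p₁ p₂ = a.1 j + 1 := by
    intro hp j hj
    rw [pTilde, Finset.sum_eq_single_of_mem j]
    · omega
    · simp only [Finset.mem_filter, Finset.mem_univ, true_and]; omega
    · intro b hb hbj
      simp only [Finset.mem_filter, Finset.mem_univ, true_and] at hb
      exact absurd (Fin.ext (by omega)) hbj
  constructor
  · intro h1
    have h3 := pTilde_ge a p₁ p₂
    have h4 : (p₂ : ℕ) = p₁ + 1 := by omega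
    refine ⟨h4, fun j hj => ?_⟩
    have := hsum h4 j hj
    omega
  · rintro ⟨h4, h5⟩
    by_cases hn : k - (p₂ : ℕ) < n
    · rw [hsum h4 ⟨_, hn⟩ rfl, h5 ⟨_, hn⟩ rfl, zero_add]
    · rw [pTilde, Finset.sum_eq_zero]
      · omega
      · intro j hj
        simp only [Finset.mem_filter, Finset.mem_univ, true_and] at hj
        omega

/-- `q̃ = 1` means that the rows `q₁` and `q₂` are adjacent and of the same length. -/
theorem qTilde_eq_one_iff (a : Vertex k n) {q₁ q₂ : Fin (n - k)} (h : q₁ < q₂) :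
    qTilde a q₁ q₂ = 1 ↔ (q₂ : ℕ) = q₁ + 1 ∧ ∀ j : Fin n, (j : ℕ) = k + q₂ → a.1 j = 0 := by
  have h2 : (q₁ : ℕ) < q₂ := h
  have hsum : (q₂ : ℕ) = q₁ + 1 → ∀ j : Fin n, (j : ℕ) = k + q₂ →
      qTilde a q₁ q₂ = a.1 j + 1 := by
    intro hp j hj
    rw [qTilde, Finset.sum_eq_single_of_mem j]
    · omega
    · simp only [Finset.mem_filter, Finset.mem_univ, true_and]; omega
    · intro b hb hbj
      simp only [Finset.mem_filter, Finset.mem_univ, true_and] at hb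
      exact absurd (Fin.ext (by omega)) hbj
  constructor
  · intro h1
    have h3 := qTilde_ge a q₁ q₂
    have h4 : (q₂ : ℕ) = q₁ + 1 := by omega
    refine ⟨h4, fun j hj => ?_⟩
    have := hsum h4 j hj
    omega
  · rintro ⟨h4, h5⟩
    have hn : k + (q₂ : ℕ) < n := by omega
    rw [hsum h4 ⟨_, hn⟩ rfl, h5 ⟨_, hn⟩ rfl, zero_add]

/-- The weight `n_{p,q}` in terms of the fundamental weights. -/
theorem rootWeight_eq (hk : k < n) (p : Fin (k + 1)) (q : Fin (n - k)) (j : Fin n) :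
    rootWeight k n p q j =
      ((if (j : ℕ) = k + 1 + q then 1 else 0) - (if (j : ℕ) = k + q then 1 else 0)) -
        ((if (j : ℕ) = k - p then 1 else 0) - (if (j : ℕ) + 1 = k - p then 1 else 0)) := by
  rw [rootWeight_apply hk]
  simp only [rowIdx, colIdx, Fin.ext_iff, Fin.val_castSucc, Fin.val_succ]
  split_ifs <;> omega

/-- The weight `λ_{p,q}` exists if and only if the rows `p` and `q` of the two Young diagrams are
shorter than the preceding ones. -/
theorem isDominant_add_iff (hk : k < n) (a : Vertex k n) (p : Fin (k + 1)) (q : Fin (n - k)) :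
    IsDominant k n (a.1 + rootWeight k n p q) ↔
      (∀ j : Fin n, (j : ℕ) < k → (j : ℕ) = k - p → 1 ≤ a.1 j) ∧
      (∀ j : Fin n, k < (j : ℕ) → (j : ℕ) = k + q → 1 ≤ a.1 j) := by
  constructor
  · intro h
    refine ⟨fun j hj hjp => ?_, fun j hj hjq => ?_⟩
    · have := h j hj.ne
      rw [Pi.add_apply, rootWeight_eq hk, if_neg (by omega), if_neg (by omega), if_pos hjp,
        if_neg (by omega)] at this
      omega
    · have := h j hj.ne'
      rw [Pi.add_apply, rootWeight_eq hk, if_neg (by omega), if_pos hjq, if_neg (by omega),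
        if_neg (by omega)] at this
      omega
  · rintro ⟨h1, h2⟩ j hj
    have h0 := a.2 j hj
    have h1 := h1 j
    have h2 := h2 j
    rw [Pi.add_apply, rootWeight_eq hk]
    split_ifs <;> omega

section

variable (hk : k < n) {E : Type*}
  [AddCommGroup E] [Module ℂ E] [LieRingModule (levi k n) E] [LieModule ℂ (levi k n) E]

theorem IsIrrepWithMaximalVector.lie_leviUnit_diag {c : Fin n → ℤ} {v : E}
    (h : IsIrrepWithMaximalVector k n c E v) (i : Fin (n + 1)) :
    ⁅leviUnit k n i i, v⁆ = diagWeight c i • v := by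
  rw [leviUnit_diag, LieModule.toEnd_apply_apply ℂ (levi k n) E _ v |>.symm, map_sum,
    LinearMap.sum_apply, diagWeight, Finset.sum_smul]
  refine Finset.sum_congr rfl fun j _ => ?_
  rw [map_smul, LinearMap.smul_apply, LieModule.toEnd_apply_apply, h.weight, smul_smul]

/-- The signs and the reversed order of the columns in `leviAction` turn the raising operators of the
two factors into positive root vectors of `𝓡`. -/
theorem IsIrrepWithMaximalVector.isHighest {c : Fin n → ℤ} {v : E}
    (h : IsIrrepWithMaximalVector k n c E v) :
    (leviAction hk E).IsHighest (weightA hk c) (weightB c) v where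
  wtA i := by rw [leviAction_A, h.lie_leviUnit_diag, weightA, neg_smul]
  wtB i := by rw [leviAction_B, h.lie_leviUnit_diag, weightB]
  raiseA i j hij := by
    rw [leviAction_A, h.maximal, neg_zero]
    intro l m hlm
    have hij' : (i : ℕ) < j := hij
    have hlm' : (m : ℕ) ≤ l := hlm
    rw [coe_leviUnit (colIdx_block hk j i), tracelessUnit,
      if_neg fun e => hij.ne' ((colIdx_inj hk).1 e), zero_smul, sub_zero,
      Matrix.single_apply_of_ne]
    rintro ⟨rfl, rfl⟩
    simp only [colIdx] at hlm'
    omega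
  raiseB i j hij := by
    rw [leviAction_B, h.maximal]
    intro l m hlm
    have hij' : (i : ℕ) < j := hij
    have hlm' : (m : ℕ) ≤ l := hlm
    rw [coe_leviUnit (rowIdx_block i j), tracelessUnit,
      if_neg fun e => hij.ne (rowIdx_inj.1 e), zero_smul, sub_zero, Matrix.single_apply_of_ne]
    rintro ⟨rfl, rfl⟩
    simp only [rowIdx] at hlm'
    omega
  ne_zero := h.ne_zero
  irred K hK := by
    have hS : ∀ y ∈ K, ∀ x : levi k n, ⁅x, y⁆ ∈ K := by
      intro y hy x
      have : K.comap ((LieModule.toEnd ℂ (levi k n) E : levi k n →ₗ[ℂ] Module.End ℂ E).flip y) =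
          ⊤ := by
        refine levi_submodule_eq_top hk _ (fun p p' => ?_) (fun q q' => hK.invB q q' y hy)
        have h1 := K.neg_mem (hK.invA p' p y hy)
        rwa [leviAction_A, neg_neg] at h1
      have hx : x ∈ K.comap
          ((LieModule.toEnd ℂ (levi k n) E : levi k n →ₗ[ℂ] Module.End ℂ E).flip y) :=
        this ▸ Submodule.mem_top
      exact hx
    let N : LieSubmodule ℂ (levi k n) E := { K with lie_mem := fun {x y} hy => hS y hy x }
    have := h.irreducible
    rcases IsSimpleOrder.eq_bot_or_eq_top N with hN | hN
    · left
      have := congrArg LieSubmodule.toSubmodule hN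
      simpa [N] using this
    · right
      have := congrArg LieSubmodule.toSubmodule hN
      simpa [N] using this

end

/-! ### Values of the products of two equivariant maps -/

namespace GLAction

variable {a b : ℕ} {E F G : Type*} [AddCommGroup E] [Module ℂ E] [AddCommGroup F] [Module ℂ F]
  [AddCommGroup G] [Module ℂ G]
  {ρ : GLAction a b E} {σ : GLAction a b F} {τ : GLAction a b G}
  {α α' : Fin a → ℂ} {β β' : Fin b → ℂ} {v : E} {w : F} {z : G}
  {φ : Fin a → Fin b → E →ₗ[ℂ] F} {ψ : Fin a → Fin b → F →ₗ[ℂ] G}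
  {p₁ p₂ : Fin a} {q₁ q₂ : Fin b} {P Q : ℂ}

/-- `two_step`, solved for the left hand side. -/
theorem IsFamily.two_step' (h : IsFamily ρ σ φ) (h' : IsFamily σ τ ψ) (hv : ρ.IsSingular α β v)
    {q : Fin b} (hw : σ.IsHighest (α + Pi.single p₁ 1) (β + Pi.single q 1) w)
    (hz : τ.IsHighest (α + Pi.single p₁ 1 + Pi.single p₂ 1) β' z) (hp : p₁ < p₂)
    (hP : P = α p₁ - α p₂ + (p₂ - p₁)) (hP0 : P ≠ 0) (u u' : Fin b) :
    ψ p₁ u' (φ p₂ u v) = (-(1 / P)) • ψ p₂ u' (φ p₁ u v) := by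
  have h1 := h.two_step h' hv hw hz hp u u'
  rw [← hP] at h1
  rw [neg_smul, ← smul_neg, ← h1, smul_smul, one_div, inv_mul_cancel₀ hP0, one_smul]

/-- Equivariant maps `φ : (ℂ^a ⊗ ℂ^b) ⊗ E → F` and `ψ : (ℂ^a ⊗ ℂ^b) ⊗ F → G` between irreducible
modules with maximal vectors `v`, `w`, `z`, where the weights of `F` and `G` arise by adding the
`(r, t)`-th and then the `(r', t')`-th basis weight, and where these basis vectors take `v` to `w`
and `w` to `z`. -/
structure IsPath (ρ : GLAction a b E) (σ : GLAction a b F) (τ : GLAction a b G)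
    (α : Fin a → ℂ) (β : Fin b → ℂ) (r r' : Fin a) (t t' : Fin b) (v : E) (w : F) (z : G)
    (φ : Fin a → Fin b → E →ₗ[ℂ] F) (ψ : Fin a → Fin b → F →ₗ[ℂ] G) : Prop where
  fam : IsFamily ρ σ φ
  fam' : IsFamily σ τ ψ
  sing : ρ.IsSingular α β v
  highest : σ.IsHighest (α + Pi.single r 1) (β + Pi.single t 1) w
  highest' : τ.IsHighest (α + Pi.single r 1 + Pi.single r' 1) (β + Pi.single t 1 + Pi.single t' 1) z
  apply_eq : ψ r' t' (φ r t v) = z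

namespace IsPath

variable {r r' : Fin a} {t t' : Fin b}

theorem swap (h : IsPath ρ σ τ α β r r' t t' v w z φ ψ) :
    IsPath ρ.swap σ.swap τ.swap β α t t' r r' v w z (fun q p => φ p q) fun q p => ψ p q :=
  ⟨h.fam.swap, h.fam'.swap, h.sing.swap, h.highest.swap, h.highest'.swap, h.apply_eq⟩

theorem apply_eq_zero (h : IsPath ρ σ τ α β r r' t t' v w z φ ψ) {x : Fin a} (hx : x < r)
    (u : Fin b) : φ x u v = 0 :=
  h.fam.apply_eq_zero h.sing.toIsWeight h.highest hx u

theorem step (h : IsPath ρ σ τ α β r r' t t' v w z φ ψ) (hr : r < r')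
    (hP : P = α r - α r' + (r' - r)) (hP0 : P ≠ 0) (u u' : Fin b) :
    ψ r u' (φ r' u v) = (-(1 / P)) • ψ r' u' (φ r u v) :=
  h.fam.two_step' h.fam' h.sing h.highest h.highest' hr hP hP0 u u'

/-! The names of the following lemmas tell whether the first step of the path is the upper (`u`) or
lower (`l`) one of the two rows on each of the two factors. -/

theorem diag_uu (h : IsPath ρ σ τ α β r r' t t' v w z φ ψ) (hr : r < r') (ht : t < t')
    (hP : P = α r - α r' + (r' - r)) (hP0 : P ≠ 0) (hQ : Q = β t - β t' + (t' - t)) (hQ0 : Q ≠ 0) :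
    ψ r t (φ r' t' v) - ψ r' t' (φ r t v) = (1 / (P * Q) - 1) • z := by
  rw [h.step hr hP hP0, h.swap.step ht hQ hQ0, h.apply_eq]
  match_scalars
  field_simp

theorem anti_uu (h : IsPath ρ σ τ α β r r' t t' v w z φ ψ) (hr : r < r') (ht : t < t')
    (hP : P = α r - α r' + (r' - r)) (hP0 : P ≠ 0) (hQ : Q = β t - β t' + (t' - t)) (hQ0 : Q ≠ 0) :
    ψ r t' (φ r' t v) - ψ r' t (φ r t' v) = (1 / Q - 1 / P) • z := by
  rw [h.step hr hP hP0, h.swap.step ht hQ hQ0, h.apply_eq]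
  module

theorem diag_ul (h : IsPath ρ σ τ α β r r' t t' v w z φ ψ) (hr : r < r') (ht : t' < t)
    (hP : P = α r - α r' + (r' - r)) (hP0 : P ≠ 0) :
    ψ r t' (φ r' t v) - ψ r' t (φ r t' v) = (-(1 / P)) • z := by
  rw [h.step hr hP hP0, h.swap.apply_eq_zero ht, h.apply_eq, map_zero, sub_zero]

theorem anti_ul (h : IsPath ρ σ τ α β r r' t t' v w z φ ψ) (ht : t' < t) :
    ψ r t (φ r' t' v) - ψ r' t' (φ r t v) = (-1 : ℂ) • z := by
  rw [h.swap.apply_eq_zero ht, h.apply_eq, map_zero, zero_sub, neg_smul, one_smul]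

theorem diag_lu (h : IsPath ρ σ τ α β r r' t t' v w z φ ψ) (hr : r' < r) (ht : t < t')
    (hQ : Q = β t - β t' + (t' - t)) (hQ0 : Q ≠ 0) :
    ψ r' t (φ r t' v) - ψ r t' (φ r' t v) = (-(1 / Q)) • z :=
  h.swap.diag_ul ht hr hQ hQ0

theorem anti_lu (h : IsPath ρ σ τ α β r r' t t' v w z φ ψ) (hr : r' < r) :
    ψ r' t' (φ r t v) - ψ r t (φ r' t' v) = (1 : ℂ) • z := by
  rw [h.apply_eq_zero hr, h.apply_eq, map_zero, sub_zero, one_smul]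

theorem diag_ll (h : IsPath ρ σ τ α β r r' t t' v w z φ ψ) (hr : r' < r) :
    ψ r' t' (φ r t v) - ψ r t (φ r' t' v) = (1 : ℂ) • z :=
  h.anti_lu hr

theorem anti_ll (h : IsPath ρ σ τ α β r r' t t' v w z φ ψ) (hr : r' < r) (ht : t' < t) :
    ψ r' t (φ r t' v) - ψ r t' (φ r' t v) = (0 : ℂ) • z := by
  rw [h.apply_eq_zero hr, h.swap.apply_eq_zero ht, map_zero, map_zero, sub_zero, zero_smul]

/-- The value in the case that both steps add to the same row of the second factor. -/
theorem row_u (h : IsPath ρ σ τ α β r r' t t' v w z φ ψ) (hr : r < r')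
    (hP : P = α r - α r' + (r' - r)) (hP0 : P ≠ 0) (hu : t' = t) :
    ψ r t (φ r' t v) - ψ r' t (φ r t v) = (-((1 + P) / P)) • z := by
  subst hu
  rw [h.step hr hP hP0, h.apply_eq]
  match_scalars
  field_simp
  ring

end IsPath

end GLAction

/-! ### Linear algebra -/

/-- An equation in `X ⊗ M` can be checked after applying functionals on `M` that separate points. -/
theorem sum_tmul_eq_zero_iff {X M ι : Type*} [AddCommMonoid X] [Module ℂ X] [Module.Flat ℂ X]
    [AddCommMonoid M] [Module ℂ M] {f₁ f₂ : M →ₗ[ℂ] ℂ} (hf : Function.Injective (f₁.prod f₂))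
    (s : Finset ι) (x : ι → X) (y : ι → M) :
    ∑ i ∈ s, x i ⊗ₜ[ℂ] y i = 0 ↔
      ∑ i ∈ s, f₁ (y i) • x i = 0 ∧ ∑ i ∈ s, f₂ (y i) • x i = 0 := by
  have h1 := Module.Flat.lTensor_preserves_injective_linearMap (M := X) (f₁.prod f₂) hf
  let e := (TensorProduct.prodRight ℂ ℂ X ℂ ℂ).trans
    ((TensorProduct.rid ℂ X).prodCongr (TensorProduct.rid ℂ X))
  have h2 : ∀ i, e (LinearMap.lTensor X (f₁.prod f₂) (x i ⊗ₜ y i)) =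
      (f₁ (y i) • x i, f₂ (y i) • x i) := by
    intro i
    simp [e]
  rw [← map_eq_zero_iff _ h1, ← map_eq_zero_iff e e.injective, map_sum, map_sum]
  simp only [h2]
  rw [Prod.ext_iff, Prod.fst_sum, Prod.snd_sum]
  rfl

theorem finrank_eq_one_of_functional {M : Type*} [AddCommGroup M] [Module ℂ M] {f : M →ₗ[ℂ] ℂ}
    (hf : ∀ y, f y = 0 → y = 0) {y : M} (hy : f y ≠ 0) : Module.finrank ℂ M = 1 := by
  have e := LinearEquiv.ofBijective f ⟨(injective_iff_map_eq_zero f).2 hf,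
    LinearMap.surjective (fun h => hy (by rw [h]; rfl))⟩
  rw [e.finrank_eq, Module.finrank_self]

theorem finrank_eq_two_of_functionals {M : Type*} [AddCommGroup M] [Module ℂ M]
    {f₁ f₂ : M →ₗ[ℂ] ℂ} (hf : ∀ y, f₁ y = 0 → f₂ y = 0 → y = 0) {y y' : M} (h1 : f₁ y = 1)
    (h2 : f₂ y = 0) (h2' : f₂ y' = -1) : Module.finrank ℂ M = 2 := by
  have e := LinearEquiv.ofBijective (f₁.prod f₂) ⟨(injective_iff_map_eq_zero _).2 fun y hy =>
    hf y (congrArg Prod.fst hy) (congrArg Prod.snd hy), fun x =>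
      ⟨(x.1 + x.2 * f₁ y') • y - x.2 • y', Prod.ext (by simp [h1]) (by simp [h2, h2'])⟩⟩
  rw [e.finrank_eq, Module.finrank_prod, Module.finrank_self]

theorem single_add_single_eq {a : ℕ} {p p' p₁ p₂ : Fin a}
    (h : (Pi.single p 1 + Pi.single p' 1 : Fin a → ℂ) = Pi.single p₁ 1 + Pi.single p₂ 1) :
    p = p₁ ∧ p' = p₂ ∨ p = p₂ ∧ p' = p₁ := by
  have h1 := congrFun h p
  have h2 := congrFun h p'
  simp only [Pi.add_apply, Pi.single_apply] at h1 h2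
  by_cases e1 : p = p₁
  · subst e1
    exact .inl ⟨rfl, GLAction.single_one_injective (add_left_cancel h)⟩
  · by_cases e2 : p = p₂
    · subst e2
      rw [add_comm (Pi.single p₁ 1)] at h
      exact .inr ⟨rfl, GLAction.single_one_injective (add_left_cancel h)⟩
    · exfalso
      simp only [if_true, e1, e2, if_false] at h1
      split_ifs at h1 <;> norm_num at h1

/-! ### `Ext¹` -/

section

variable {E : Vertex k n → Type*}
  [∀ a, AddCommGroup (E a)] [∀ a, Module ℂ (E a)]
  [∀ a, LieRingModule (levi k n) (E a)] [∀ a, LieModule ℂ (levi k n) (E a)]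
  {v : ∀ a, E a}

/-- `Ext¹` vanishes between points that are not joined by an arrow. -/
theorem ext1_eq_zero (hk : k < n) (hv : ∀ a, IsIrrepWithMaximalVector k n a.1 (E a) (v a))
    {a b : Vertex k n} (h : ∀ p q, b.1 ≠ a.1 + rootWeight k n p q) (m : Ext1 k n (E a) (E b)) :
    m = 0 := by
  refine ext1_ext hk fun p q => ?_
  by_contra h0
  obtain ⟨p', q', h1⟩ := (isFamily_ext1 hk m).exists_of_ne_zero ((hv a).isHighest hk)
    ((hv b).isHighest hk) ⟨p, q, h0⟩
  exact h p' q' ((eq_add_rootWeight_iff hk).2 h1)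

theorem isHighest_add (hk : k < n) (hv : ∀ a, IsIrrepWithMaximalVector k n a.1 (E a) (v a))
    {a b : Vertex k n} {p : Fin (k + 1)} {q : Fin (n - k)} (h : b.1 = a.1 + rootWeight k n p q) :
    (leviAction hk (E b)).IsHighest (weightA hk a.1 + Pi.single p 1) (weightB a.1 + Pi.single q 1)
      (v b) := by
  have := (hv b).isHighest hk
  rwa [h, weightA_add, weightB_add hk] at this

/-- Existence and uniqueness of the normalized generators. -/
theorem existsUnique_isNormalized (hk : k < n)
    (hv : ∀ a, IsIrrepWithMaximalVector k n a.1 (E a) (v a)) :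
    ∃! m : ∀ a b, Ext1 k n (E a) (E b), IsNormalized v m := by
  have key : ∀ a b : Vertex k n, ∃ m : Ext1 k n (E a) (E b),
      ∀ (p : Fin (k + 1)) (q : Fin (n - k)), b.1 = a.1 + rootWeight k n p q →
        m (rootVector k n p q) (v a) = v b := by
    intro a b
    by_cases h : ∃ p q, b.1 = a.1 + rootWeight k n p q
    · obtain ⟨p, q, hpq⟩ := h
      have := (hv b).finiteDimensional
      obtain ⟨φ, hφ, hφv⟩ := ((hv a).isHighest hk).exists_isFamily (isHighest_add hk hv hpq)
        (regular_weightA hk a) (regular_weightB a)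
        (by rw [← weightA_add hk a.1 p q, ← hpq]; exact regular_weightA hk b)
        (by rw [← weightB_add hk a.1 p q, ← hpq]; exact regular_weightB b)
      obtain ⟨m, hm⟩ := exists_ext1 hk hφ
      refine ⟨m, fun p' q' h' => ?_⟩
      obtain ⟨rfl, rfl⟩ := rootWeight_injective hk (hpq.symm.trans h')
      rw [hm, hφv]
    · exact ⟨0, fun p q hpq => absurd ⟨p, q, hpq⟩ h⟩
  choose m hm using key
  refine ⟨m, fun a b p q h => hm a b p q h, fun m' hm' => ?_⟩
  ext1 a
  ext1 b
  by_cases h : ∃ p q, b.1 = a.1 + rootWeight k n p q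
  · obtain ⟨p, q, hpq⟩ := h
    refine ext1_ext hk fun p' q' => sub_eq_zero.1 ?_
    refine ((isFamily_ext1 hk (m' a b)).sub (isFamily_ext1 hk (m a b))).eq_zero_of_apply
      ((hv a).isHighest hk) (isHighest_add hk hv hpq) ?_ p' q'
    rw [LinearMap.sub_apply, hm' a b p q hpq, hm a b p q hpq, sub_self]
  · push Not at h
    rw [ext1_eq_zero hk hv h (m' a b), ext1_eq_zero hk hv h (m a b)]

end

/-! ### `Ext²` -/

section

variable {E F H : Type*}
  [AddCommGroup E] [Module ℂ E] [LieRingModule (levi k n) E] [LieModule ℂ (levi k n) E]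
  [AddCommGroup F] [Module ℂ F] [LieRingModule (levi k n) F] [LieModule ℂ (levi k n) F]
  [AddCommGroup H] [Module ℂ H] [LieRingModule (levi k n) H] [LieModule ℂ (levi k n) H]

theorem ext2_swap (ω : Ext2 k n E F) (x y : nilradical k n) : ω.1 x y = -ω.1 y x := by
  have h0 : ∀ z, ω.1 z z = 0 := ω.2
  generalize ω.1 = f at h0 ⊢
  have h1 : f (x + y) = f x + f y :=
    (f : nilradical k n →ₗ[ℂ] nilradical k n →ₗ[ℂ] E →ₗ[ℂ] F).map_add x y
  have h := h0 (x + y)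
  rw [h1, LinearMap.map_add, LinearMap.add_apply, LinearMap.add_apply, h0, h0, zero_add,
    add_zero] at h
  exact eq_neg_of_add_eq_zero_right h

/-- The Leibniz rule for an equivariant bilinear map. -/
theorem lie_bilinear_apply (f : nilradical k n →ₗ⁅ℂ, levi k n⁆ nilradical k n →ₗ[ℂ] E →ₗ[ℂ] F)
    (r : levi k n) (x y : nilradical k n) (e : E) :
    ⁅r, f x y e⁆ = f x y ⁅r, e⁆ + (f ⁅r, x⁆ y e + f x ⁅r, y⁆ e) := by
  have h1 : f ⁅r, x⁆ = ⁅r, f x⁆ := f.map_lie r x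
  have h2 : ⁅r, f x⁆ y = ⁅r, f x y⁆ - f x ⁅r, y⁆ := LieHom.lie_apply _ _ _
  have h3 : ⁅r, f x y⁆ e = ⁅r, f x y e⁆ - f x y ⁅r, e⁆ := LieHom.lie_apply _ _ _
  rw [h1, h2, LinearMap.sub_apply, h3]
  abel

theorem isBiFamily_bilinear (hk : k < n)
    (f : nilradical k n →ₗ⁅ℂ, levi k n⁆ nilradical k n →ₗ[ℂ] E →ₗ[ℂ] F) :
    GLAction.IsBiFamily (leviAction hk E) (leviAction hk F) fun p q p' q' =>
      f (rootVector k n p q) (rootVector k n p' q') where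
  famA i j p q p' q' x := by
    have h1 : f (-(if p = j then rootVector k n i q else 0)) (rootVector k n p' q') x =
        -(if p = j then f (rootVector k n i q) (rootVector k n p' q') x else 0) := by
      split_ifs <;> simp
    have h2 : f (rootVector k n p q) (-(if p' = j then rootVector k n i q' else 0)) x =
        -(if p' = j then f (rootVector k n p q) (rootVector k n i q') x else 0) := by
      split_ifs <;> simp
    have h3 := lie_bilinear_apply f (leviUnit k n (colIdx hk j) (colIdx hk i)) (rootVector k n p q)
      (rootVector k n p' q') x
    rw [lie_leviUnit_col_rootVector, lie_leviUnit_col_rootVector, h1, h2] at h3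
    rw [leviAction_A, leviAction_A, h3, neg_add, neg_add, neg_neg, neg_neg, LinearMap.map_neg]
  famB i j p q p' q' x := by
    have h1 : f (if q = j then rootVector k n p i else 0) (rootVector k n p' q') x =
        if q = j then f (rootVector k n p i) (rootVector k n p' q') x else 0 := by
      split_ifs <;> simp
    have h2 : f (rootVector k n p q) (if q' = j then rootVector k n p' i else 0) x =
        if q' = j then f (rootVector k n p q) (rootVector k n p' i) x else 0 := by
      split_ifs <;> simp
    have h3 := lie_bilinear_apply f (leviUnit k n (rowIdx i) (rowIdx j)) (rootVector k n p q)
      (rootVector k n p' q') x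
    rw [lie_leviUnit_row_rootVector hk, lie_leviUnit_row_rootVector hk, h1, h2] at h3
    rw [leviAction_B, leviAction_B, h3]

theorem isBiFamily_ext2 (hk : k < n) (ω : Ext2 k n E F) :
    GLAction.IsBiFamily (leviAction hk E) (leviAction hk F) fun p q p' q' =>
      ω.1 (rootVector k n p q) (rootVector k n p' q') :=
  isBiFamily_bilinear hk ω.1

theorem ext2_ext (hk : k < n) {ω : Ext2 k n E F}
    (h : ∀ p q p' q', ω.1 (rootVector k n p q) (rootVector k n p' q') = 0) : ω = 0 := by
  apply Subtype.ext
  ext1 x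
  have h1 : ∀ p q, ω.1 (rootVector k n p q) = 0 := fun p q =>
    nilradical_linearMap_ext hk fun p' q' => h p q p' q'
  have := nilradical_linearMap_ext hk
    (f := (ω.1 : nilradical k n →ₗ[ℂ] nilradical k n →ₗ[ℂ] E →ₗ[ℂ] F)) (g := 0) h1
  exact LinearMap.congr_fun this x

theorem wedge_apply (m' : Ext1 k n F H) (m : Ext1 k n E F) (x y : nilradical k n) (e : E) :
    (wedge m' m).1 x y e = m' x (m y e) - m' y (m x e) := rfl

theorem wedge_zero_left (m : Ext1 k n E F) : wedge (0 : Ext1 k n F H) m = 0 := by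
  apply Subtype.ext
  ext x y e
  simp [wedge_apply]

theorem wedge_zero_right (m' : Ext1 k n F H) : wedge m' (0 : Ext1 k n E F) = 0 := by
  apply Subtype.ext
  ext x y e
  simp [wedge_apply]

/-- The functional on `Ext²` that evaluates a bilinear map at `x`, `y` and the vector `v`, and
applies the functional `f`. -/
@[simps] def evalAt (f : Module.Dual ℂ F) (v : E) (x y : nilradical k n) :
    Ext2 k n E F →ₗ[ℂ] ℂ where
  toFun ω := f (ω.1 x y v)
  map_add' _ _ := map_add f _ _
  map_smul' c _ := map_smul f c _

/-- An element of `Ext²` vanishes if it does so on the maximal vector and all pairs of root vectors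
whose weights have the right sum. -/
theorem ext2_eq_zero (hk : k < n) {a c : Vertex k n} {v : E} {z : F}
    (hv : IsIrrepWithMaximalVector k n a.1 E v) (hz : IsIrrepWithMaximalVector k n c.1 F z)
    {p₁ p₂ : Fin (k + 1)} {q₁ q₂ : Fin (n - k)}
    (hc : c.1 = a.1 + rootWeight k n p₁ q₁ + rootWeight k n p₂ q₂) {ω : Ext2 k n E F}
    (h1 : ω.1 (rootVector k n p₁ q₁) (rootVector k n p₂ q₂) v = 0)
    (h2 : ω.1 (rootVector k n p₁ q₂) (rootVector k n p₂ q₁) v = 0) : ω = 0 := by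
  refine ext2_ext hk fun p q p' q' => ?_
  by_contra hne
  obtain ⟨p, q, p', q', h0, hA, hB⟩ := (isBiFamily_ext2 hk ω).exists_of_ne_zero (hv.isHighest hk)
    (hz.isHighest hk) ⟨p, q, p', q', hne⟩
  rw [hc, weightA_add, weightA_add, add_assoc, add_assoc, add_right_inj] at hA
  rw [hc, weightB_add hk, weightB_add hk, add_assoc, add_assoc, add_right_inj] at hB
  rcases single_add_single_eq hA.symm with ⟨rfl, rfl⟩ | ⟨rfl, rfl⟩ <;>
    rcases single_add_single_eq hB.symm with ⟨rfl, rfl⟩ | ⟨rfl, rfl⟩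
  · exact h0 h1
  · exact h0 h2
  · exact h0 (by rw [ext2_swap, LinearMap.neg_apply, h2, neg_zero])
  · exact h0 (by rw [ext2_swap, LinearMap.neg_apply, h1, neg_zero])

/-- The pairs `(p, q)` found by `IsBiFamily.exists_of_ne_zero` are sorted by rows of each diagram
separately; they are distinct because the elements of `Ext²` are alternating. -/
theorem exists_of_ext2_ne_bot (hk : k < n) {a c : Vertex k n} {v : E} {z : F}
    (hv : IsIrrepWithMaximalVector k n a.1 E v) (hz : IsIrrepWithMaximalVector k n c.1 F z)
    (h : Ext2 k n E F ≠ ⊥) :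
    ∃ (p₁ p₂ : Fin (k + 1)) (q₁ q₂ : Fin (n - k)), p₁ ≤ p₂ ∧ q₁ ≤ q₂ ∧ (p₁ < p₂ ∨ q₁ < q₂) ∧
      c.1 = a.1 + rootWeight k n p₁ q₁ + rootWeight k n p₂ q₂ := by
  obtain ⟨ω, hω, hω0⟩ := Submodule.exists_mem_ne_zero_of_ne_bot h
  have hne : ∃ p q p' q', ω (rootVector k n p q) (rootVector k n p' q') ≠ 0 := by
    by_contra! h0
    exact hω0 (congrArg Subtype.val (ext2_ext hk (ω := ⟨ω, hω⟩) h0))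
  obtain ⟨p, q, p', q', h0, hA, hB⟩ := (isBiFamily_ext2 hk ⟨ω, hω⟩).exists_of_ne_zero
    (hv.isHighest hk) (hz.isHighest hk) hne
  have hdist : p = p' → q ≠ q' := by
    rintro rfl rfl
    refine h0 ?_
    have : ω (rootVector k n p q) (rootVector k n p q) = 0 := hω _
    change ω (rootVector k n p q) (rootVector k n p q) v = 0
    rw [this, LinearMap.zero_apply]
  refine ⟨min p p', max p p', min q q', max q q', min_le_max, min_le_max, ?_, ?_⟩
  · by_cases hp : p = p'
    · exact .inr (min_lt_max.2 (hdist hp))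
    · exact .inl (min_lt_max.2 hp)
  · refine weight_injective hk ?_ ?_
    · rw [hA, weightA_add, weightA_add]
      rcases le_total p p' with hp | hp <;> simp [hp, add_right_comm]
    · rw [hB, weightB_add hk, weightB_add hk]
      rcases le_total q q' with hq | hq <;> simp [hq, add_right_comm]

end

/-! ### Existence of the intermediate points -/

theorem rootWeight_exchange (hk : k < n) (p₁ p₂ : Fin (k + 1)) (q₁ q₂ : Fin (n - k)) :
    rootWeight k n p₁ q₁ + rootWeight k n p₂ q₂ = rootWeight k n p₁ q₂ + rootWeight k n p₂ q₁ := by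
  ext j
  simp only [Pi.add_apply, rootWeight_apply hk]
  ring

theorem Vertex.add_inj (hk : k < n) {a : Vertex k n} {p p' : Fin (k + 1)} {q q' : Fin (n - k)}
    {h : IsDominant k n (a.1 + rootWeight k n p q)}
    {h' : IsDominant k n (a.1 + rootWeight k n p' q')} :
    a.add p q h = a.add p' q' h' ↔ p = p' ∧ q = q' := by
  constructor
  · intro e
    exact rootWeight_injective hk (congrArg Subtype.val e)
  · rintro ⟨rfl, rfl⟩
    rfl

/-- The row `p` of the first Young diagram is shorter than the preceding one, if there is one: for
`p = 0` the conditions on `j` exclude each other. -/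
def CanAddA (a : Vertex k n) (p : Fin (k + 1)) : Prop :=
  ∀ j : Fin n, (j : ℕ) < k → (j : ℕ) = k - p → 1 ≤ a.1 j

/-- The row `q` of the second Young diagram is shorter than the preceding one, if there is one: for
`q = 0` the conditions on `j` exclude each other. -/
def CanAddB (a : Vertex k n) (q : Fin (n - k)) : Prop :=
  ∀ j : Fin n, k < (j : ℕ) → (j : ℕ) = k + q → 1 ≤ a.1 j

section

variable {a c : Vertex k n} {p₁ p₂ : Fin (k + 1)} {q₁ q₂ : Fin (n - k)}

/-- A box can be added to the upper one of the two rows, since the row has the added box in the Young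
diagram of the end point `c`, while the preceding row is unchanged. -/
theorem canAddA_upper (hk : k < n) (hc : c.1 = a.1 + rootWeight k n p₁ q₁ + rootWeight k n p₂ q₂)
    (hp : p₁ ≤ p₂) : CanAddA a p₁ := by
  intro j hj hjp
  have hp' : (p₁ : ℕ) ≤ p₂ := hp
  have h := c.2 j hj.ne
  rw [hc, Pi.add_apply, Pi.add_apply, rootWeight_eq hk, rootWeight_eq hk] at h
  split_ifs at h <;> omega

theorem canAddB_upper (hk : k < n) (hc : c.1 = a.1 + rootWeight k n p₁ q₁ + rootWeight k n p₂ q₂)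
    (hq : q₁ ≤ q₂) : CanAddB a q₁ := by
  intro j hj hjp
  have hq' : (q₁ : ℕ) ≤ q₂ := hq
  have h := c.2 j hj.ne'
  rw [hc, Pi.add_apply, Pi.add_apply, rootWeight_eq hk, rootWeight_eq hk] at h
  split_ifs at h <;> omega

/-- A box can be added to the lower one of the two rows unless it is adjacent to the upper one and
of the same length. -/
theorem canAddA_lower_iff (hk : k < n)
    (hc : c.1 = a.1 + rootWeight k n p₁ q₁ + rootWeight k n p₂ q₂) (hp : p₁ < p₂) :
    CanAddA a p₂ ↔ pTilde a p₁ p₂ ≠ 1 := by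
  have hp' : (p₁ : ℕ) < p₂ := hp
  rw [ne_eq, pTilde_eq_one_iff a hp]
  constructor
  · rintro h ⟨-, h2⟩
    have h3 := h ⟨k - p₂, by omega⟩ (by simp only; omega) rfl
    rw [h2 _ rfl] at h3
    omega
  · intro h1 j hj hjp
    by_contra h2
    refine h1 ⟨?_, fun j' hj' => ?_⟩
    · have h := c.2 j hj.ne
      rw [hc, Pi.add_apply, Pi.add_apply, rootWeight_eq hk, rootWeight_eq hk] at h
      split_ifs at h <;> omega
    · obtain rfl : j' = j := Fin.ext (by omega)
      have := a.2 j' hj.ne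
      omega

theorem canAddB_lower_iff (hk : k < n)
    (hc : c.1 = a.1 + rootWeight k n p₁ q₁ + rootWeight k n p₂ q₂) (hq : q₁ < q₂) :
    CanAddB a q₂ ↔ qTilde a q₁ q₂ ≠ 1 := by
  have hq' : (q₁ : ℕ) < q₂ := hq
  rw [ne_eq, qTilde_eq_one_iff a hq]
  constructor
  · rintro h ⟨-, h2⟩
    have h3 := h ⟨k + q₂, by omega⟩ (by simp only; omega) rfl
    rw [h2 _ rfl] at h3
    omega
  · intro h1 j hj hjp
    by_contra h2
    refine h1 ⟨?_, fun j' hj' => ?_⟩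
    · have h := c.2 j hj.ne'
      rw [hc, Pi.add_apply, Pi.add_apply, rootWeight_eq hk, rootWeight_eq hk] at h
      split_ifs at h <;> omega
    · obtain rfl : j' = j := Fin.ext (by omega)
      have := a.2 j' hj.ne'
      omega

end

/-! ### The relations -/

section

variable {E : Vertex k n → Type*}
  [∀ a, AddCommGroup (E a)] [∀ a, Module ℂ (E a)]
  [∀ a, LieRingModule (levi k n) (E a)] [∀ a, LieModule ℂ (levi k n) (E a)]
  {v : ∀ a, E a} {m : ∀ a b, Ext1 k n (E a) (E b)}
  {a c : Vertex k n} {p₁ p₂ : Fin (k + 1)} {q₁ q₂ : Fin (n - k)}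

/-- The normalized generators along the path `a → b → c`, for `b = λ_{r,t}` and `c = b_{r',t'}`. -/
theorem isPath_of_isNormalized (hk : k < n)
    (hv : ∀ a, IsIrrepWithMaximalVector k n a.1 (E a) (v a)) (hm : IsNormalized v m)
    {b : Vertex k n} {r r' : Fin (k + 1)} {t t' : Fin (n - k)}
    (hb : b.1 = a.1 + rootWeight k n r t)
    (hc : c.1 = a.1 + rootWeight k n r t + rootWeight k n r' t') :
    GLAction.IsPath (leviAction hk (E a)) (leviAction hk (E b)) (leviAction hk (E c))
      (weightA hk a.1) (weightB a.1) r r' t t' (v a) (v b) (v c)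
      (fun p q => m a b (rootVector k n p q)) (fun p q => m b c (rootVector k n p q)) where
  fam := isFamily_ext1 hk _
  fam' := isFamily_ext1 hk _
  sing := ((hv a).isHighest hk).toIsSingular
  highest := isHighest_add hk hv hb
  highest' := by
    rw [← hb] at hc
    have h := isHighest_add hk hv hc
    rwa [hb, weightA_add, weightB_add hk] at h
  apply_eq := by
    rw [← hb] at hc
    rw [hm a b r t hb, hm b c r' t' hc]

/-- The functional `evalAt` detects the vanishing of `ω` at the two root vectors and `v a`, since the
value there has the maximal weight of `E c` and hence is a multiple of `v c`. -/
theorem evalAt_eq_zero (hk : k < n) (hv : ∀ a, IsIrrepWithMaximalVector k n a.1 (E a) (v a))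
    {f : Module.Dual ℂ (E c)} (hf : f (v c) = 1)
    (hc : c.1 = a.1 + rootWeight k n p₁ q₁ + rootWeight k n p₂ q₂) {ω : Ext2 k n (E a) (E c)}
    (h : evalAt f (v a) (rootVector k n p₁ q₁) (rootVector k n p₂ q₂) ω = 0) :
    ω.1 (rootVector k n p₁ q₁) (rootVector k n p₂ q₂) (v a) = 0 := by
  have h1 := (isBiFamily_ext2 hk ω).isWeight ((hv a).isHighest hk).toIsWeight p₁ q₁ p₂ q₂
  have h2 := (hv c).isHighest hk
  rw [hc, weightA_add, weightA_add, weightB_add hk, weightB_add hk] at h2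
  obtain ⟨s, hs⟩ := h2.exists_eq_smul_of_isWeight h1
  rw [evalAt_apply, hs, map_smul, hf, smul_eq_mul, mul_one] at h
  rw [hs, h, zero_smul]

theorem evalAt_wedge {b : Vertex k n} {f : Module.Dual ℂ (E c)} (hf : f (v c) = 1)
    {x y : nilradical k n} {s : ℂ}
    (h : m b c x (m a b y (v a)) - m b c y (m a b x (v a)) = s • v c) :
    evalAt f (v a) x y (wedge (m b c) (m a b)) = s := by
  rw [evalAt_apply, wedge_apply, h, map_smul, hf, smul_eq_mul, mul_one]

/-- Only the points `λ_{p,q}` with `p ∈ {p₁, p₂}` and `q ∈ {q₁, q₂}` contribute to the relation. -/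
theorem exists_of_wedge_ne_zero (hk : k < n)
    (hv : ∀ a, IsIrrepWithMaximalVector k n a.1 (E a) (v a))
    (hc : c.1 = a.1 + rootWeight k n p₁ q₁ + rootWeight k n p₂ q₂) {b : Vertex k n}
    (h : wedge (m b c) (m a b) ≠ 0) :
    ∃ (p : Fin (k + 1)) (q : Fin (n - k)) (hd : IsDominant k n (a.1 + rootWeight k n p q)),
      (p = p₁ ∨ p = p₂) ∧ (q = q₁ ∨ q = q₂) ∧ b = a.add p q hd := by
  have h1 : ∃ p q, b.1 = a.1 + rootWeight k n p q := by
    by_contra! h0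
    exact h (by rw [ext1_eq_zero hk hv h0 (m a b), wedge_zero_right])
  have h2 : ∃ p q, c.1 = b.1 + rootWeight k n p q := by
    by_contra! h0
    exact h (by rw [ext1_eq_zero hk hv h0 (m b c), wedge_zero_left])
  obtain ⟨p, q, hpq⟩ := h1
  obtain ⟨p', q', hpq'⟩ := h2
  have hA := congrArg (weightA hk) (hc.symm.trans hpq')
  have hB := congrArg (weightB (k := k)) (hc.symm.trans hpq')
  rw [hpq, weightA_add, weightA_add, weightA_add, weightA_add, add_assoc, add_assoc,
    add_right_inj] at hA
  rw [hpq, weightB_add hk, weightB_add hk, weightB_add hk, weightB_add hk, add_assoc, add_assoc,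
    add_right_inj] at hB
  exact ⟨p, q, hpq ▸ b.2, (single_add_single_eq hA.symm).imp And.left And.left,
    (single_add_single_eq hB.symm).imp And.left And.left, Subtype.ext hpq⟩

variable {V : Vertex k n → Type*} [∀ a, AddCommGroup (V a)] [∀ a, Module ℂ (V a)]
  {g : ∀ a b, V a →ₗ[ℂ] V b}

/-- The relation in the coordinates of `Ext²` given by two functionals that separate points. -/
theorem relation_iff_sum (S : Finset (Vertex k n))
    (hS : ∀ b, wedge (m b c) (m a b) ≠ 0 → b ∈ S) {f₁ f₂ : Ext2 k n (E a) (E c) →ₗ[ℂ] ℂ}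
    (hf : ∀ ω, f₁ ω = 0 → f₂ ω = 0 → ω = 0) :
    Relation m g a c ↔ ∑ b ∈ S, f₁ (wedge (m b c) (m a b)) • path g a b c = 0 ∧
      ∑ b ∈ S, f₂ (wedge (m b c) (m a b)) • path g a b c = 0 := by
  have hinj : Function.Injective (f₁.prod f₂) :=
    (injective_iff_map_eq_zero _).2 fun ω h => hf ω (congrArg Prod.fst h) (congrArg Prod.snd h)
  have hS' : (Function.support fun b => path g a b c ⊗ₜ[ℂ] wedge (m b c) (m a b)) ⊆ ↑S := by
    intro b hb
    refine hS b fun h0 => hb ?_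
    simp only [h0, TensorProduct.tmul_zero]
  have : Module.Flat ℂ (V a →ₗ[ℂ] V c) := Module.Flat.of_free
  unfold Relation
  rw [finsum_eq_sum_of_support_subset _ hS']
  exact sum_tmul_eq_zero_iff hinj S _ _

theorem relation_of_eq_zero (h : ∀ ω : Ext2 k n (E a) (E c), ω = 0) : Relation m g a c :=
  (relation_iff_sum (f₁ := 0) (f₂ := 0) ∅ (fun _ hb => absurd (h _) hb)
    fun ω _ _ => h ω).2 ⟨by simp, by simp⟩

theorem finrank_ext2_eq_zero (h : ∀ ω : Ext2 k n (E a) (E c), ω = 0) :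
    Module.finrank ℂ (Ext2 k n (E a) (E c)) = 0 := by
  have : Subsingleton (Ext2 k n (E a) (E c)) := ⟨fun x y => (h x).trans (h y).symm⟩
  exact Module.finrank_zero_of_subsingleton

theorem sum_of_four {X ι : Type*} [AddCommMonoid X] [DecidableEq ι] {b₁ b₂ b₃ b₄ : ι}
    (h₁₂ : b₁ ≠ b₂) (h₁₃ : b₁ ≠ b₃) (h₁₄ : b₁ ≠ b₄) (h₂₃ : b₂ ≠ b₃) (h₂₄ : b₂ ≠ b₄) (h₃₄ : b₃ ≠ b₄)
    (F : ι → X) : ∑ b ∈ {b₁, b₂, b₃, b₄}, F b = F b₁ + (F b₂ + (F b₃ + F b₄)) := by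
  rw [Finset.sum_insert (by simp [*]), Finset.sum_insert (by simp [*]), Finset.sum_pair h₃₄]

/-- `relation_iff_sum` for four intermediate points, with named coefficients. -/
theorem relation_iff_of_four {L₁ L₂ : Ext2 k n (E a) (E c) →ₗ[ℂ] ℂ}
    (hL : ∀ ω, L₁ ω = 0 → L₂ ω = 0 → ω = 0) {b₁ b₂ b₃ b₄ : Vertex k n}
    (h₁₂ : b₁ ≠ b₂) (h₁₃ : b₁ ≠ b₃) (h₁₄ : b₁ ≠ b₄) (h₂₃ : b₂ ≠ b₃) (h₂₄ : b₂ ≠ b₄) (h₃₄ : b₃ ≠ b₄)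
    (hS : ∀ b, wedge (m b c) (m a b) ≠ 0 → b = b₁ ∨ b = b₂ ∨ b = b₃ ∨ b = b₄)
    {s₁ s₂ s₃ s₄ t₁ t₂ t₃ t₄ : ℂ}
    (e₁ : L₁ (wedge (m b₁ c) (m a b₁)) = s₁) (e₂ : L₁ (wedge (m b₂ c) (m a b₂)) = s₂)
    (e₃ : L₁ (wedge (m b₃ c) (m a b₃)) = s₃) (e₄ : L₁ (wedge (m b₄ c) (m a b₄)) = s₄)
    (d₁ : L₂ (wedge (m b₁ c) (m a b₁)) = t₁) (d₂ : L₂ (wedge (m b₂ c) (m a b₂)) = t₂)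
    (d₃ : L₂ (wedge (m b₃ c) (m a b₃)) = t₃) (d₄ : L₂ (wedge (m b₄ c) (m a b₄)) = t₄) :
    Relation m g a c ↔
      s₁ • path g a b₁ c + (s₂ • path g a b₂ c + (s₃ • path g a b₃ c + s₄ • path g a b₄ c)) = 0 ∧
      t₁ • path g a b₁ c + (t₂ • path g a b₂ c + (t₃ • path g a b₃ c + t₄ • path g a b₄ c)) = 0 := by
  classical
  subst e₁ e₂ e₃ e₄ d₁ d₂ d₃ d₄
  exact (relation_iff_sum {b₁, b₂, b₃, b₄} (fun b hb => by simpa using hS b hb) hL).trans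
    (and_congr (Eq.congr_left (sum_of_four h₁₂ h₁₃ h₁₄ h₂₃ h₂₄ h₃₄ _))
      (Eq.congr_left (sum_of_four h₁₂ h₁₃ h₁₄ h₂₃ h₂₄ h₃₄ _)))

/-- The relation in the case that `Ext²` is embedded into `ℂ` by a functional, for two intermediate
points. -/
theorem relation_iff_of_two {L : Ext2 k n (E a) (E c) →ₗ[ℂ] ℂ} (hL : ∀ ω, L ω = 0 → ω = 0)
    {b₁ b₂ : Vertex k n} (h₁₂ : b₁ ≠ b₂)
    (hS : ∀ b, wedge (m b c) (m a b) ≠ 0 → b = b₁ ∨ b = b₂) {s₁ s₂ : ℂ}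
    (e₁ : L (wedge (m b₁ c) (m a b₁)) = s₁) (e₂ : L (wedge (m b₂ c) (m a b₂)) = s₂) :
    Relation m g a c ↔ s₁ • path g a b₁ c + s₂ • path g a b₂ c = 0 := by
  classical
  subst e₁ e₂
  exact (relation_iff_sum {b₁, b₂} (fun b hb => by simpa using hS b hb) fun ω h _ => hL ω h).trans
    ((and_self_iff).trans (Eq.congr_left (Finset.sum_pair h₁₂)))

theorem relation_iff_of_one {L : Ext2 k n (E a) (E c) →ₗ[ℂ] ℂ} (hL : ∀ ω, L ω = 0 → ω = 0)
    {b : Vertex k n} (hS : ∀ b', wedge (m b' c) (m a b') ≠ 0 → b' = b)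
    (e : L (wedge (m b c) (m a b)) ≠ 0) : Relation m g a c ↔ path g a b c = 0 := by
  classical
  refine (relation_iff_sum {b} (fun b hb => by simpa using hS b hb) fun ω h _ => hL ω h).trans
    ((and_self_iff).trans ((Eq.congr_left (Finset.sum_singleton _ _)).trans ?_))
  rw [smul_eq_zero, or_iff_right e]

/-- The relation if all four intermediate points exist. The first equation is the coordinate at
`n_{p₁,q₂} ∧ n_{p₂,q₁}`, the second one that at `n_{p₁,q₁} ∧ n_{p₂,q₂}`. -/
theorem relation_iff_of_tilde_ne_one (hk : k < n)
    (hv : ∀ a, IsIrrepWithMaximalVector k n a.1 (E a) (v a))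
    (hm : IsNormalized v m) (hc : c.1 = a.1 + rootWeight k n p₁ q₁ + rootWeight k n p₂ q₂)
    (hp : p₁ < p₂) (hq : q₁ < q₂)
    (h₁₁ : IsDominant k n (a.1 + rootWeight k n p₁ q₁))
    (h₁₂ : IsDominant k n (a.1 + rootWeight k n p₁ q₂))
    (h₂₁ : IsDominant k n (a.1 + rootWeight k n p₂ q₁))
    (h₂₂ : IsDominant k n (a.1 + rootWeight k n p₂ q₂)) :
    (Relation m g a c ↔
      (1 / (qTilde a q₁ q₂ : ℂ) - 1 / (pTilde a p₁ p₂ : ℂ)) • path g a (a.add p₁ q₁ h₁₁) c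
          - path g a (a.add p₁ q₂ h₁₂) c + path g a (a.add p₂ q₁ h₂₁) c = 0 ∧
      (1 / ((pTilde a p₁ p₂ : ℂ) * (qTilde a q₁ q₂ : ℂ)) - 1) • path g a (a.add p₁ q₁ h₁₁) c
          - (1 / (pTilde a p₁ p₂ : ℂ)) • path g a (a.add p₁ q₂ h₁₂) c
          - (1 / (qTilde a q₁ q₂ : ℂ)) • path g a (a.add p₂ q₁ h₂₁) c
          + path g a (a.add p₂ q₂ h₂₂) c = 0) ∧
    Module.finrank ℂ (Ext2 k n (E a) (E c)) = 2 := by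
  obtain ⟨f, hf⟩ := Module.Projective.exists_dual_eq_one ℂ (hv c).ne_zero
  have hP : (pTilde a p₁ p₂ : ℂ) ≠ 0 := by exact_mod_cast (pTilde_pos a hp).ne'
  have hQ : (qTilde a q₁ q₂ : ℂ) ≠ 0 := by exact_mod_cast (qTilde_pos a hq).ne'
  have hP' := pTilde_eq hk a hp.le
  have hQ' := qTilde_eq a hq.le
  have hc₁₂ : c.1 = a.1 + rootWeight k n p₁ q₂ + rootWeight k n p₂ q₁ := by
    rw [hc, add_assoc, rootWeight_exchange hk, ← add_assoc]
  have hc₂₁ : c.1 = a.1 + rootWeight k n p₂ q₁ + rootWeight k n p₁ q₂ := by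
    rw [hc₁₂, add_right_comm]
  have hc₂₂ : c.1 = a.1 + rootWeight k n p₂ q₂ + rootWeight k n p₁ q₁ := by
    rw [hc, add_right_comm]
  have π₁₁ := isPath_of_isNormalized hk hv hm (b := a.add p₁ q₁ h₁₁) rfl hc
  have π₁₂ := isPath_of_isNormalized hk hv hm (b := a.add p₁ q₂ h₁₂) rfl hc₁₂
  have π₂₁ := isPath_of_isNormalized hk hv hm (b := a.add p₂ q₁ h₂₁) rfl hc₂₁
  have π₂₂ := isPath_of_isNormalized hk hv hm (b := a.add p₂ q₂ h₂₂) rfl hc₂₂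
  have hinj : ∀ ω : Ext2 k n (E a) (E c),
      evalAt f (v a) (rootVector k n p₁ q₂) (rootVector k n p₂ q₁) ω = 0 →
      evalAt f (v a) (rootVector k n p₁ q₁) (rootVector k n p₂ q₂) ω = 0 → ω = 0 := fun ω h2 h1 =>
    ext2_eq_zero hk (hv a) (hv c) hc (evalAt_eq_zero hk hv hf hc h1)
      (evalAt_eq_zero hk hv hf hc₁₂ h2)
  have a₁₂ := evalAt_wedge hf (π₁₂.anti_ul hq)
  have a₂₂ := evalAt_wedge hf (π₂₂.anti_ll hp hq)
  have d₂₂ := evalAt_wedge hf (π₂₂.diag_ll hp)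
  refine ⟨?_, finrank_eq_two_of_functionals (fun ω h1 h2 => hinj ω h2 h1) d₂₂ a₂₂ a₁₂⟩
  refine (relation_iff_of_four hinj (by simp [Vertex.add_inj hk, hq.ne])
    (by simp [Vertex.add_inj hk, hp.ne]) (by simp [Vertex.add_inj hk, hp.ne])
    (by simp [Vertex.add_inj hk, hp.ne]) (by simp [Vertex.add_inj hk, hp.ne])
    (by simp [Vertex.add_inj hk, hq.ne]) ?_
    (evalAt_wedge hf (π₁₁.anti_uu hp hq hP' hP hQ' hQ)) a₁₂
    (evalAt_wedge hf (π₂₁.anti_lu hp)) a₂₂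
    (evalAt_wedge hf (π₁₁.diag_uu hp hq hP' hP hQ' hQ))
    (evalAt_wedge hf (π₁₂.diag_ul hp hq hP' hP))
    (evalAt_wedge hf (π₂₁.diag_lu hp hq hQ' hQ)) d₂₂).trans ?_
  · intro b hb
    obtain ⟨p, q, hd, rfl | rfl, rfl | rfl, rfl⟩ := exists_of_wedge_ne_zero hk hv hc hb <;> simp
  · refine and_congr (Eq.congr_left ?_) (Eq.congr_left ?_) <;> module

end

section

variable {E : Vertex k n → Type*}
  [∀ a, AddCommGroup (E a)] [∀ a, Module ℂ (E a)]
  [∀ a, LieRingModule (levi k n) (E a)] [∀ a, LieModule ℂ (levi k n) (E a)]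
  {v : ∀ a, E a} {m : ∀ a b, Ext1 k n (E a) (E b)}
  {a c : Vertex k n} {p₁ p₂ : Fin (k + 1)} {q₁ q₂ : Fin (n - k)}
  {V : Vertex k n → Type*} [∀ a, AddCommGroup (V a)] [∀ a, Module ℂ (V a)]
  {g : ∀ a b, V a →ₗ[ℂ] V b}

theorem isHighest_add_add (hk : k < n) (hv : ∀ a, IsIrrepWithMaximalVector k n a.1 (E a) (v a))
    (hc : c.1 = a.1 + rootWeight k n p₁ q₁ + rootWeight k n p₂ q₂) :
    (leviAction hk (E c)).IsHighest (weightA hk a.1 + Pi.single p₁ 1 + Pi.single p₂ 1)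
      (weightB a.1 + Pi.single q₁ 1 + Pi.single q₂ 1) (v c) := by
  have := (hv c).isHighest hk
  rwa [hc, weightA_add, weightA_add, weightB_add hk, weightB_add hk] at this

/-! ### Linear constraints on `Ext²` -/

/-- If `p̃ = 1`, the lowering operator between the rows `p₁` and `p₂` kills the maximal vector;
applied to `ω(n_{p₁,q₂} ∧ n_{p₁,q₁} ⊗ v) = 0` it yields this linear relation. -/
theorem ext2_apply_of_pTilde_eq_one (hk : k < n)
    (hv : ∀ a, IsIrrepWithMaximalVector k n a.1 (E a) (v a))
    (hc : c.1 = a.1 + rootWeight k n p₁ q₁ + rootWeight k n p₂ q₂) (hp : p₁ < p₂)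
    (hP : pTilde a p₁ p₂ = 1) (ω : Ext2 k n (E a) (E c)) :
    ω.1 (rootVector k n p₁ q₂) (rootVector k n p₂ q₁) (v a) =
      ω.1 (rootVector k n p₁ q₁) (rootVector k n p₂ q₂) (v a) := by
  have h1 := ((pTilde_eq_one_iff a hp).1 hP).1
  have hα : weightA hk a.1 p₁ = weightA hk a.1 p₂ := by
    have h2 := pTilde_eq hk a hp.le
    have h3 : ((p₂ : ℕ) : ℂ) = (p₁ : ℕ) + 1 := by exact_mod_cast h1
    rw [hP, h3, Int.cast_one] at h2
    linear_combination -h2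
  rw [ext2_swap, LinearMap.neg_apply, neg_eq_iff_eq_neg]
  exact (isBiFamily_ext2 hk ω).swap_first ((hv a).isHighest hk) (isHighest_add_add hk hv hc) h1 hα
    q₁ q₂

theorem ext2_apply_of_qTilde_eq_one (hk : k < n)
    (hv : ∀ a, IsIrrepWithMaximalVector k n a.1 (E a) (v a))
    (hc : c.1 = a.1 + rootWeight k n p₁ q₁ + rootWeight k n p₂ q₂) (hq : q₁ < q₂)
    (hQ : qTilde a q₁ q₂ = 1) (ω : Ext2 k n (E a) (E c)) :
    ω.1 (rootVector k n p₁ q₂) (rootVector k n p₂ q₁) (v a) =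
      -ω.1 (rootVector k n p₁ q₁) (rootVector k n p₂ q₂) (v a) := by
  have h1 := ((qTilde_eq_one_iff a hq).1 hQ).1
  have hβ : weightB a.1 q₁ = weightB a.1 q₂ := by
    have h2 := qTilde_eq a hq.le
    have h3 : ((q₂ : ℕ) : ℂ) = (q₁ : ℕ) + 1 := by exact_mod_cast h1
    rw [hQ, h3, Int.cast_one] at h2
    linear_combination -h2
  exact (isBiFamily_ext2 hk ω).swap.swap_first ((hv a).isHighest hk).swap
    (isHighest_add_add hk hv hc).swap h1 hβ p₁ p₂

/-! ### The relations for two rows of equal length -/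

/-- The relation if a box can be added only to the upper one of the rows `p₁`, `p₂`. By
`ext2_apply_of_pTilde_eq_one` the coordinate at `n_{p₁,q₂} ∧ n_{p₂,q₁}` suffices. -/
theorem relation_iff_of_pTilde_eq_one (hk : k < n)
    (hv : ∀ a, IsIrrepWithMaximalVector k n a.1 (E a) (v a))
    (hm : IsNormalized v m) (hc : c.1 = a.1 + rootWeight k n p₁ q₁ + rootWeight k n p₂ q₂)
    (hp : p₁ < p₂) (hq : q₁ < q₂) (hP1 : pTilde a p₁ p₂ = 1)
    (h₁₁ : IsDominant k n (a.1 + rootWeight k n p₁ q₁))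
    (h₁₂ : IsDominant k n (a.1 + rootWeight k n p₁ q₂))
    (h₂₁ : ¬IsDominant k n (a.1 + rootWeight k n p₂ q₁))
    (h₂₂ : ¬IsDominant k n (a.1 + rootWeight k n p₂ q₂)) :
    (Relation m g a c ↔
      (1 / (qTilde a q₁ q₂ : ℂ) - 1) • path g a (a.add p₁ q₁ h₁₁) c
          - path g a (a.add p₁ q₂ h₁₂) c = 0) ∧
    Module.finrank ℂ (Ext2 k n (E a) (E c)) = 1 := by
  obtain ⟨f, hf⟩ := Module.Projective.exists_dual_eq_one ℂ (hv c).ne_zero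
  have hQ : (qTilde a q₁ q₂ : ℂ) ≠ 0 := by exact_mod_cast (qTilde_pos a hq).ne'
  have hP' := pTilde_eq hk a hp.le
  rw [hP1, Int.cast_one] at hP'
  have hQ' := qTilde_eq a hq.le
  have hc₁₂ : c.1 = a.1 + rootWeight k n p₁ q₂ + rootWeight k n p₂ q₁ := by
    rw [hc, add_assoc, rootWeight_exchange hk, ← add_assoc]
  have π₁₁ := isPath_of_isNormalized hk hv hm (b := a.add p₁ q₁ h₁₁) rfl hc
  have π₁₂ := isPath_of_isNormalized hk hv hm (b := a.add p₁ q₂ h₁₂) rfl hc₁₂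
  have hinj : ∀ ω : Ext2 k n (E a) (E c),
      evalAt f (v a) (rootVector k n p₁ q₂) (rootVector k n p₂ q₁) ω = 0 → ω = 0 := by
    intro ω h
    have h2 := evalAt_eq_zero hk hv hf hc₁₂ h
    exact ext2_eq_zero hk (hv a) (hv c) hc
      (by rw [← ext2_apply_of_pTilde_eq_one hk hv hc hp hP1, h2]) h2
  have e := evalAt_wedge hf (π₁₂.anti_ul hq)
  refine ⟨?_, finrank_eq_one_of_functional hinj (e.trans_ne (neg_ne_zero.2 one_ne_zero))⟩
  refine (relation_iff_of_two hinj (by simp [Vertex.add_inj hk, hq.ne]) ?_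
    (evalAt_wedge hf (π₁₁.anti_uu hp hq hP' one_ne_zero hQ' hQ)) e).trans ?_
  · intro b hb
    obtain ⟨p, q, hd, rfl | rfl, rfl | rfl, rfl⟩ := exists_of_wedge_ne_zero hk hv hc hb
    · exact .inl rfl
    · exact .inr rfl
    · exact absurd hd h₂₁
    · exact absurd hd h₂₂
  · refine Eq.congr_left ?_
    module

/-- The relation if a box can be added only to the upper one of the rows `q₁`, `q₂`. By
`ext2_apply_of_qTilde_eq_one` the coordinate at `n_{p₁,q₂} ∧ n_{p₂,q₁}` suffices. -/
theorem relation_iff_of_qTilde_eq_one (hk : k < n)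
    (hv : ∀ a, IsIrrepWithMaximalVector k n a.1 (E a) (v a))
    (hm : IsNormalized v m) (hc : c.1 = a.1 + rootWeight k n p₁ q₁ + rootWeight k n p₂ q₂)
    (hp : p₁ < p₂) (hq : q₁ < q₂) (hQ1 : qTilde a q₁ q₂ = 1)
    (h₁₁ : IsDominant k n (a.1 + rootWeight k n p₁ q₁))
    (h₁₂ : ¬IsDominant k n (a.1 + rootWeight k n p₁ q₂))
    (h₂₁ : IsDominant k n (a.1 + rootWeight k n p₂ q₁))
    (h₂₂ : ¬IsDominant k n (a.1 + rootWeight k n p₂ q₂)) :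
    (Relation m g a c ↔
      (1 - 1 / (pTilde a p₁ p₂ : ℂ)) • path g a (a.add p₁ q₁ h₁₁) c
          + path g a (a.add p₂ q₁ h₂₁) c = 0) ∧
    Module.finrank ℂ (Ext2 k n (E a) (E c)) = 1 := by
  obtain ⟨f, hf⟩ := Module.Projective.exists_dual_eq_one ℂ (hv c).ne_zero
  have hP : (pTilde a p₁ p₂ : ℂ) ≠ 0 := by exact_mod_cast (pTilde_pos a hp).ne'
  have hP' := pTilde_eq hk a hp.le
  have hQ' := qTilde_eq a hq.le
  rw [hQ1, Int.cast_one] at hQ'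
  have hc₁₂ : c.1 = a.1 + rootWeight k n p₁ q₂ + rootWeight k n p₂ q₁ := by
    rw [hc, add_assoc, rootWeight_exchange hk, ← add_assoc]
  have hc₂₁ : c.1 = a.1 + rootWeight k n p₂ q₁ + rootWeight k n p₁ q₂ := by
    rw [hc₁₂, add_right_comm]
  have π₁₁ := isPath_of_isNormalized hk hv hm (b := a.add p₁ q₁ h₁₁) rfl hc
  have π₂₁ := isPath_of_isNormalized hk hv hm (b := a.add p₂ q₁ h₂₁) rfl hc₂₁
  have hinj : ∀ ω : Ext2 k n (E a) (E c),
      evalAt f (v a) (rootVector k n p₁ q₂) (rootVector k n p₂ q₁) ω = 0 → ω = 0 := by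
    intro ω h
    have h2 := evalAt_eq_zero hk hv hf hc₁₂ h
    exact ext2_eq_zero hk (hv a) (hv c) hc
      (neg_eq_zero.1 (by rw [← ext2_apply_of_qTilde_eq_one hk hv hc hq hQ1, h2])) h2
  have e := evalAt_wedge hf (π₂₁.anti_lu hp)
  refine ⟨?_, finrank_eq_one_of_functional hinj (e.trans_ne one_ne_zero)⟩
  refine (relation_iff_of_two hinj (by simp [Vertex.add_inj hk, hp.ne]) ?_
    (evalAt_wedge hf (π₁₁.anti_uu hp hq hP' hP hQ' one_ne_zero)) e).trans ?_
  · intro b hb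
    obtain ⟨p, q, hd, rfl | rfl, rfl | rfl, rfl⟩ := exists_of_wedge_ne_zero hk hv hc hb
    · exact .inl rfl
    · exact absurd hd h₁₂
    · exact .inr rfl
    · exact absurd hd h₂₂
  · refine Eq.congr_left ?_
    module

/-! ### Vanishing of `Ext²` -/

/-- If `p̃ = q̃ = 1`, the two values that determine an element of `Ext²` are both equal and opposite. -/
theorem ext2_eq_zero_of_tilde_eq_one (hk : k < n)
    (hv : ∀ a, IsIrrepWithMaximalVector k n a.1 (E a) (v a))
    (hc : c.1 = a.1 + rootWeight k n p₁ q₁ + rootWeight k n p₂ q₂) (hp : p₁ < p₂) (hq : q₁ < q₂)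
    (hP : pTilde a p₁ p₂ = 1) (hQ : qTilde a q₁ q₂ = 1) (ω : Ext2 k n (E a) (E c)) : ω = 0 := by
  have h1 := ext2_apply_of_pTilde_eq_one hk hv hc hp hP ω
  have h2 := ext2_apply_of_qTilde_eq_one hk hv hc hq hQ ω
  have : IsAddTorsionFree (E c) := .of_isTorsionFree ℂ _
  have h3 := self_eq_neg.1 (h1.symm.trans h2)
  exact ext2_eq_zero hk (hv a) (hv c) hc h3 (h1.trans h3)

theorem ext2_eq_zero_of_eq (hk : k < n)
    (hv : ∀ a, IsIrrepWithMaximalVector k n a.1 (E a) (v a)) {p : Fin (k + 1)} {q : Fin (n - k)}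
    (hc : c.1 = a.1 + rootWeight k n p q + rootWeight k n p q) (ω : Ext2 k n (E a) (E c)) :
    ω = 0 := by
  have h : ω.1 (rootVector k n p q) (rootVector k n p q) = 0 := ω.2 _
  have h' : ω.1 (rootVector k n p q) (rootVector k n p q) (v a) = 0 := by
    rw [h, LinearMap.zero_apply]
  exact ext2_eq_zero hk (hv a) (hv c) hc h' h'

/-! ### Two boxes in the same row of one of the diagrams -/

section Row

variable {p : Fin (k + 1)} {q : Fin (n - k)} {f : Module.Dual ℂ (E c)}

theorem eq_zero_of_evalAt_row (hk : k < n)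
    (hv : ∀ a, IsIrrepWithMaximalVector k n a.1 (E a) (v a)) (hf : f (v c) = 1)
    (hc : c.1 = a.1 + rootWeight k n p q₁ + rootWeight k n p q₂) (ω : Ext2 k n (E a) (E c))
    (h : evalAt f (v a) (rootVector k n p q₁) (rootVector k n p q₂) ω = 0) : ω = 0 := by
  have h1 := evalAt_eq_zero hk hv hf hc h
  exact ext2_eq_zero hk (hv a) (hv c) hc h1
    (by rw [ext2_swap, LinearMap.neg_apply, h1, neg_zero])

theorem eq_zero_of_evalAt_col (hk : k < n)
    (hv : ∀ a, IsIrrepWithMaximalVector k n a.1 (E a) (v a)) (hf : f (v c) = 1)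
    (hc : c.1 = a.1 + rootWeight k n p₁ q + rootWeight k n p₂ q) (ω : Ext2 k n (E a) (E c))
    (h : evalAt f (v a) (rootVector k n p₁ q) (rootVector k n p₂ q) ω = 0) : ω = 0 :=
  have h1 := evalAt_eq_zero hk hv hf hc h
  ext2_eq_zero hk (hv a) (hv c) hc h1 h1

/-- The coefficient of the path through `λ_{p,q₁}`, two boxes being added to the row `p` of the first
diagram. -/
theorem evalAt_wedge_row (hk : k < n)
    (hv : ∀ a, IsIrrepWithMaximalVector k n a.1 (E a) (v a)) (hm : IsNormalized v m)
    (hf : f (v c) = 1) (hc : c.1 = a.1 + rootWeight k n p q₁ + rootWeight k n p q₂) (hq : q₁ < q₂)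
    (h₁ : IsDominant k n (a.1 + rootWeight k n p q₁)) :
    evalAt f (v a) (rootVector k n p q₁) (rootVector k n p q₂)
      (wedge (m (a.add p q₁ h₁) c) (m a (a.add p q₁ h₁))) =
      -((1 + (qTilde a q₁ q₂ : ℂ)) / (qTilde a q₁ q₂ : ℂ)) :=
  evalAt_wedge hf ((isPath_of_isNormalized hk hv hm (b := a.add p q₁ h₁) rfl hc).swap.row_u hq
    (qTilde_eq a hq.le) (by exact_mod_cast (qTilde_pos a hq).ne') rfl)

/-- The coefficient of the path through `λ_{p₁,q}`, two boxes being added to the row `q` of the second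
diagram. -/
theorem evalAt_wedge_col (hk : k < n)
    (hv : ∀ a, IsIrrepWithMaximalVector k n a.1 (E a) (v a)) (hm : IsNormalized v m)
    (hf : f (v c) = 1) (hc : c.1 = a.1 + rootWeight k n p₁ q + rootWeight k n p₂ q) (hp : p₁ < p₂)
    (h₁ : IsDominant k n (a.1 + rootWeight k n p₁ q)) :
    evalAt f (v a) (rootVector k n p₁ q) (rootVector k n p₂ q)
      (wedge (m (a.add p₁ q h₁) c) (m a (a.add p₁ q h₁))) =
      -((1 + (pTilde a p₁ p₂ : ℂ)) / (pTilde a p₁ p₂ : ℂ)) :=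
  evalAt_wedge hf ((isPath_of_isNormalized hk hv hm (b := a.add p₁ q h₁) rfl hc).row_u hp
    (pTilde_eq hk a hp.le) (by exact_mod_cast (pTilde_pos a hp).ne') rfl)

theorem neg_one_add_div_ne_zero {x : ℤ} (hx : 0 < x) : -((1 + (x : ℂ)) / (x : ℂ)) ≠ 0 := by
  have h1 : (1 + (x : ℂ)) ≠ 0 := by exact_mod_cast (show (1 + x : ℤ) ≠ 0 by omega)
  have h2 : (x : ℂ) ≠ 0 := by exact_mod_cast hx.ne'
  exact neg_ne_zero.2 (div_ne_zero h1 h2)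

theorem finrank_ext2_row (hk : k < n)
    (hv : ∀ a, IsIrrepWithMaximalVector k n a.1 (E a) (v a)) (hm : IsNormalized v m)
    (hc : c.1 = a.1 + rootWeight k n p q₁ + rootWeight k n p q₂) (hq : q₁ < q₂)
    (h₁ : IsDominant k n (a.1 + rootWeight k n p q₁)) :
    Module.finrank ℂ (Ext2 k n (E a) (E c)) = 1 := by
  obtain ⟨f, hf⟩ := Module.Projective.exists_dual_eq_one ℂ (hv c).ne_zero
  exact finrank_eq_one_of_functional (eq_zero_of_evalAt_row hk hv hf hc)
    ((evalAt_wedge_row hk hv hm hf hc hq h₁).trans_ne (neg_one_add_div_ne_zero (qTilde_pos a hq)))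

theorem finrank_ext2_col (hk : k < n)
    (hv : ∀ a, IsIrrepWithMaximalVector k n a.1 (E a) (v a)) (hm : IsNormalized v m)
    (hc : c.1 = a.1 + rootWeight k n p₁ q + rootWeight k n p₂ q) (hp : p₁ < p₂)
    (h₁ : IsDominant k n (a.1 + rootWeight k n p₁ q)) :
    Module.finrank ℂ (Ext2 k n (E a) (E c)) = 1 := by
  obtain ⟨f, hf⟩ := Module.Projective.exists_dual_eq_one ℂ (hv c).ne_zero
  exact finrank_eq_one_of_functional (eq_zero_of_evalAt_col hk hv hf hc)
    ((evalAt_wedge_col hk hv hm hf hc hp h₁).trans_ne (neg_one_add_div_ne_zero (pTilde_pos a hp)))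

theorem relation_iff_row (hk : k < n)
    (hv : ∀ a, IsIrrepWithMaximalVector k n a.1 (E a) (v a)) (hm : IsNormalized v m)
    (hc : c.1 = a.1 + rootWeight k n p q₁ + rootWeight k n p q₂) (hq : q₁ < q₂)
    (h₁ : IsDominant k n (a.1 + rootWeight k n p q₁))
    (h₂ : IsDominant k n (a.1 + rootWeight k n p q₂)) :
    Relation m g a c ↔
      ((1 + (qTilde a q₁ q₂ : ℂ)) / (qTilde a q₁ q₂ : ℂ)) • path g a (a.add p q₁ h₁) c
        - path g a (a.add p q₂ h₂) c = 0 := by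
  obtain ⟨f, hf⟩ := Module.Projective.exists_dual_eq_one ℂ (hv c).ne_zero
  have hc' : c.1 = a.1 + rootWeight k n p q₂ + rootWeight k n p q₁ := by rw [hc, add_right_comm]
  have π₂ := isPath_of_isNormalized hk hv hm (b := a.add p q₂ h₂) rfl hc'
  refine (relation_iff_of_two (eq_zero_of_evalAt_row hk hv hf hc)
    (by simp [Vertex.add_inj hk, hq.ne]) ?_ (evalAt_wedge_row hk hv hm hf hc hq h₁)
    (evalAt_wedge hf (π₂.swap.anti_lu hq))).trans ?_
  · intro b hb
    obtain ⟨p, q, hd, rfl | rfl, rfl | rfl, rfl⟩ := exists_of_wedge_ne_zero hk hv hc hb <;> simp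
  · rw [← neg_eq_zero]
    refine Eq.congr_left ?_
    module

theorem relation_iff_col (hk : k < n)
    (hv : ∀ a, IsIrrepWithMaximalVector k n a.1 (E a) (v a)) (hm : IsNormalized v m)
    (hc : c.1 = a.1 + rootWeight k n p₁ q + rootWeight k n p₂ q) (hp : p₁ < p₂)
    (h₁ : IsDominant k n (a.1 + rootWeight k n p₁ q))
    (h₂ : IsDominant k n (a.1 + rootWeight k n p₂ q)) :
    Relation m g a c ↔
      ((1 + (pTilde a p₁ p₂ : ℂ)) / (pTilde a p₁ p₂ : ℂ)) • path g a (a.add p₁ q h₁) c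
        - path g a (a.add p₂ q h₂) c = 0 := by
  obtain ⟨f, hf⟩ := Module.Projective.exists_dual_eq_one ℂ (hv c).ne_zero
  have hc' : c.1 = a.1 + rootWeight k n p₂ q + rootWeight k n p₁ q := by rw [hc, add_right_comm]
  have π₂ := isPath_of_isNormalized hk hv hm (b := a.add p₂ q h₂) rfl hc'
  refine (relation_iff_of_two (eq_zero_of_evalAt_col hk hv hf hc)
    (by simp [Vertex.add_inj hk, hp.ne]) ?_ (evalAt_wedge_col hk hv hm hf hc hp h₁)
    (evalAt_wedge hf (π₂.anti_lu hp))).trans ?_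
  · intro b hb
    obtain ⟨p, q, hd, rfl | rfl, rfl | rfl, rfl⟩ := exists_of_wedge_ne_zero hk hv hc hb <;> simp
  · rw [← neg_eq_zero]
    refine Eq.congr_left ?_
    module

theorem relation_iff_row_of_not_isDominant (hk : k < n)
    (hv : ∀ a, IsIrrepWithMaximalVector k n a.1 (E a) (v a)) (hm : IsNormalized v m)
    (hc : c.1 = a.1 + rootWeight k n p q₁ + rootWeight k n p q₂) (hq : q₁ < q₂)
    (h₁ : IsDominant k n (a.1 + rootWeight k n p q₁))
    (h₂ : ¬IsDominant k n (a.1 + rootWeight k n p q₂)) :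
    Relation m g a c ↔ path g a (a.add p q₁ h₁) c = 0 := by
  obtain ⟨f, hf⟩ := Module.Projective.exists_dual_eq_one ℂ (hv c).ne_zero
  refine relation_iff_of_one (eq_zero_of_evalAt_row hk hv hf hc) ?_
    ((evalAt_wedge_row hk hv hm hf hc hq h₁).trans_ne (neg_one_add_div_ne_zero (qTilde_pos a hq)))
  intro b hb
  obtain ⟨p, q, hd, rfl | rfl, rfl | rfl, rfl⟩ := exists_of_wedge_ne_zero hk hv hc hb <;>
    first | rfl | exact absurd hd h₂

theorem relation_iff_col_of_not_isDominant (hk : k < n)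
    (hv : ∀ a, IsIrrepWithMaximalVector k n a.1 (E a) (v a)) (hm : IsNormalized v m)
    (hc : c.1 = a.1 + rootWeight k n p₁ q + rootWeight k n p₂ q) (hp : p₁ < p₂)
    (h₁ : IsDominant k n (a.1 + rootWeight k n p₁ q))
    (h₂ : ¬IsDominant k n (a.1 + rootWeight k n p₂ q)) :
    Relation m g a c ↔ path g a (a.add p₁ q h₁) c = 0 := by
  obtain ⟨f, hf⟩ := Module.Projective.exists_dual_eq_one ℂ (hv c).ne_zero
  refine relation_iff_of_one (eq_zero_of_evalAt_col hk hv hf hc) ?_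
    ((evalAt_wedge_col hk hv hm hf hc hp h₁).trans_ne (neg_one_add_div_ne_zero (pTilde_pos a hp)))
  intro b hb
  obtain ⟨p, q, hd, rfl | rfl, rfl | rfl, rfl⟩ := exists_of_wedge_ne_zero hk hv hc hb <;>
    first | rfl | exact absurd hd h₂

end Row

end

end GrassmannQuiver

theorem proposition8p4 (k n : ℕ) (hk : k < n)
    (E : GrassmannQuiver.Vertex k n → Type*)
    [∀ a, AddCommGroup (E a)] [∀ a, Module ℂ (E a)]
    [∀ a, LieRingModule (GrassmannQuiver.levi k n) (E a)]
    [∀ a, LieModule ℂ (GrassmannQuiver.levi k n) (E a)]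
    (v : ∀ a, E a)
    (hv : ∀ a, GrassmannQuiver.IsIrrepWithMaximalVector k n a.1 (E a) (v a))
    (V : GrassmannQuiver.Vertex k n → Type*)
    [∀ a, AddCommGroup (V a)] [∀ a, Module ℂ (V a)]
    (g : ∀ a b, V a →ₗ[ℂ] V b) :
    open GrassmannQuiver in
    -- the normalized generators `m_{μλ}` exist and are unique
    (∃! m : ∀ a b, Ext1 k n (E a) (E b), IsNormalized v m) ∧
    -- there are relations only between `λ` and `λ''` as considered below
    (∀ a c : Vertex k n, Ext2 k n (E a) (E c) ≠ ⊥ →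
      ∃ (p₁ p₂ : Fin (k + 1)) (q₁ q₂ : Fin (n - k)), p₁ ≤ p₂ ∧ q₁ ≤ q₂ ∧ (p₁ < p₂ ∨ q₁ < q₂) ∧
        c.1 = a.1 + rootWeight k n p₁ q₁ + rootWeight k n p₂ q₂) ∧
    -- the relations from `λ = a` to `λ'' = c`
    ∀ m : (∀ a b, Ext1 k n (E a) (E b)), IsNormalized v m →
      ∀ (a c : Vertex k n) (p₁ p₂ : Fin (k + 1)) (q₁ q₂ : Fin (n - k)),
        c.1 = a.1 + rootWeight k n p₁ q₁ + rootWeight k n p₂ q₂ →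
        -- (i)
        (p₁ < p₂ → q₁ < q₂ →
          -- (i1)
          (pTilde a p₁ p₂ ≠ 1 → qTilde a q₁ q₂ ≠ 1 →
            ∃ (h₁₁ : IsDominant k n (a.1 + rootWeight k n p₁ q₁))
              (h₁₂ : IsDominant k n (a.1 + rootWeight k n p₁ q₂))
              (h₂₁ : IsDominant k n (a.1 + rootWeight k n p₂ q₁))
              (h₂₂ : IsDominant k n (a.1 + rootWeight k n p₂ q₂)),
              (Relation m g a c ↔
                (1 / (qTilde a q₁ q₂ : ℂ) - 1 / (pTilde a p₁ p₂ : ℂ)) •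
                      path g a (a.add p₁ q₁ h₁₁) c
                    - path g a (a.add p₁ q₂ h₁₂) c
                    + path g a (a.add p₂ q₁ h₂₁) c = 0 ∧
                (1 / ((pTilde a p₁ p₂ : ℂ) * (qTilde a q₁ q₂ : ℂ)) - 1) •
                      path g a (a.add p₁ q₁ h₁₁) c
                    - (1 / (pTilde a p₁ p₂ : ℂ)) • path g a (a.add p₁ q₂ h₁₂) c
                    - (1 / (qTilde a q₁ q₂ : ℂ)) • path g a (a.add p₂ q₁ h₂₁) c
                    + path g a (a.add p₂ q₂ h₂₂) c = 0) ∧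
              Module.finrank ℂ (Ext2 k n (E a) (E c)) = 2) ∧
          -- (i2)
          (pTilde a p₁ p₂ = 1 → qTilde a q₁ q₂ ≠ 1 →
            ¬ IsDominant k n (a.1 + rootWeight k n p₂ q₁) ∧
            ¬ IsDominant k n (a.1 + rootWeight k n p₂ q₂) ∧
            ∃ (h₁₁ : IsDominant k n (a.1 + rootWeight k n p₁ q₁))
              (h₁₂ : IsDominant k n (a.1 + rootWeight k n p₁ q₂)),
              (Relation m g a c ↔
                (1 / (qTilde a q₁ q₂ : ℂ) - 1) • path g a (a.add p₁ q₁ h₁₁) c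
                    - path g a (a.add p₁ q₂ h₁₂) c = 0) ∧
              Module.finrank ℂ (Ext2 k n (E a) (E c)) = 1) ∧
          -- (i3)
          (pTilde a p₁ p₂ ≠ 1 → qTilde a q₁ q₂ = 1 →
            ¬ IsDominant k n (a.1 + rootWeight k n p₁ q₂) ∧
            ¬ IsDominant k n (a.1 + rootWeight k n p₂ q₂) ∧
            ∃ (h₁₁ : IsDominant k n (a.1 + rootWeight k n p₁ q₁))
              (h₂₁ : IsDominant k n (a.1 + rootWeight k n p₂ q₁)),
              (Relation m g a c ↔
                (1 - 1 / (pTilde a p₁ p₂ : ℂ)) • path g a (a.add p₁ q₁ h₁₁) c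
                    + path g a (a.add p₂ q₁ h₂₁) c = 0) ∧
              Module.finrank ℂ (Ext2 k n (E a) (E c)) = 1) ∧
          -- (i4)
          (pTilde a p₁ p₂ = 1 → qTilde a q₁ q₂ = 1 →
            IsDominant k n (a.1 + rootWeight k n p₁ q₁) ∧
            ¬ IsDominant k n (a.1 + rootWeight k n p₁ q₂) ∧
            ¬ IsDominant k n (a.1 + rootWeight k n p₂ q₁) ∧
            ¬ IsDominant k n (a.1 + rootWeight k n p₂ q₂) ∧
            Relation m g a c ∧
            Module.finrank ℂ (Ext2 k n (E a) (E c)) = 0)) ∧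
        -- (ii)
        (p₁ = p₂ → q₁ < q₂ →
          -- (ii1)
          (qTilde a q₁ q₂ ≠ 1 →
            ∃ (h₁₁ : IsDominant k n (a.1 + rootWeight k n p₁ q₁))
              (h₁₂ : IsDominant k n (a.1 + rootWeight k n p₁ q₂)),
              (Relation m g a c ↔
                ((1 + (qTilde a q₁ q₂ : ℂ)) / (qTilde a q₁ q₂ : ℂ)) •
                      path g a (a.add p₁ q₁ h₁₁) c
                    - path g a (a.add p₁ q₂ h₁₂) c = 0) ∧
              Module.finrank ℂ (Ext2 k n (E a) (E c)) = 1) ∧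
          -- (ii2)
          (qTilde a q₁ q₂ = 1 →
            ¬ IsDominant k n (a.1 + rootWeight k n p₁ q₂) ∧
            ∃ h₁₁ : IsDominant k n (a.1 + rootWeight k n p₁ q₁),
              (Relation m g a c ↔ path g a (a.add p₁ q₁ h₁₁) c = 0) ∧
              Module.finrank ℂ (Ext2 k n (E a) (E c)) = 1)) ∧
        -- (iii), symmetric to (ii)
        (p₁ < p₂ → q₁ = q₂ →
          (pTilde a p₁ p₂ ≠ 1 →
            ∃ (h₁₁ : IsDominant k n (a.1 + rootWeight k n p₁ q₁))
              (h₂₁ : IsDominant k n (a.1 + rootWeight k n p₂ q₁)),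
              (Relation m g a c ↔
                ((1 + (pTilde a p₁ p₂ : ℂ)) / (pTilde a p₁ p₂ : ℂ)) •
                      path g a (a.add p₁ q₁ h₁₁) c
                    - path g a (a.add p₂ q₁ h₂₁) c = 0) ∧
              Module.finrank ℂ (Ext2 k n (E a) (E c)) = 1) ∧
          (pTilde a p₁ p₂ = 1 →
            ¬ IsDominant k n (a.1 + rootWeight k n p₂ q₁) ∧
            ∃ h₁₁ : IsDominant k n (a.1 + rootWeight k n p₁ q₁),
              (Relation m g a c ↔ path g a (a.add p₁ q₁ h₁₁) c = 0) ∧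
              Module.finrank ℂ (Ext2 k n (E a) (E c)) = 1)) ∧
        -- two boxes in the same row of each diagram
        (p₁ = p₂ → q₁ = q₂ → Module.finrank ℂ (Ext2 k n (E a) (E c)) = 0) := by
  refine ⟨GrassmannQuiver.existsUnique_isNormalized hk hv, fun a c h =>
    GrassmannQuiver.exists_of_ext2_ne_bot hk (hv a) (hv c) h, ?_⟩
  intro m hm a c p₁ p₂ q₁ q₂ hc
  have dom : ∀ p q, GrassmannQuiver.IsDominant k n (a.1 + GrassmannQuiver.rootWeight k n p q) ↔
      GrassmannQuiver.CanAddA a p ∧ GrassmannQuiver.CanAddB a q :=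
    GrassmannQuiver.isDominant_add_iff hk a
  refine ⟨fun hp hq => ?_, ?_, ?_, ?_⟩
  · have uA := GrassmannQuiver.canAddA_upper hk hc hp.le
    have uB := GrassmannQuiver.canAddB_upper hk hc hq.le
    have lA := GrassmannQuiver.canAddA_lower_iff hk hc hp
    have lB := GrassmannQuiver.canAddB_lower_iff hk hc hq
    have h₁₁ := (dom p₁ q₁).2 ⟨uA, uB⟩
    refine ⟨fun hP hQ => ?_, fun hP hQ => ?_, fun hP hQ => ?_, fun hP hQ => ?_⟩
    · have h₁₂ := (dom p₁ q₂).2 ⟨uA, lB.2 hQ⟩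
      have h₂₁ := (dom p₂ q₁).2 ⟨lA.2 hP, uB⟩
      have h₂₂ := (dom p₂ q₂).2 ⟨lA.2 hP, lB.2 hQ⟩
      exact ⟨h₁₁, h₁₂, h₂₁, h₂₂,
        GrassmannQuiver.relation_iff_of_tilde_ne_one hk hv hm hc hp hq h₁₁ h₁₂ h₂₁ h₂₂⟩
    · have h₁₂ := (dom p₁ q₂).2 ⟨uA, lB.2 hQ⟩
      have h₂ : ∀ q, ¬GrassmannQuiver.IsDominant k n (a.1 + GrassmannQuiver.rootWeight k n p₂ q) :=
        fun q h => lA.1 ((dom p₂ q).1 h).1 hP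
      exact ⟨h₂ q₁, h₂ q₂, h₁₁, h₁₂,
        GrassmannQuiver.relation_iff_of_pTilde_eq_one hk hv hm hc hp hq hP h₁₁ h₁₂ (h₂ q₁) (h₂ q₂)⟩
    · have h₂₁ := (dom p₂ q₁).2 ⟨lA.2 hP, uB⟩
      have h₂ : ∀ p, ¬GrassmannQuiver.IsDominant k n (a.1 + GrassmannQuiver.rootWeight k n p q₂) :=
        fun p h => lB.1 ((dom p q₂).1 h).2 hQ
      exact ⟨h₂ p₁, h₂ p₂, h₁₁, h₂₁,
        GrassmannQuiver.relation_iff_of_qTilde_eq_one hk hv hm hc hp hq hQ h₁₁ (h₂ p₁) h₂₁ (h₂ p₂)⟩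
    · have h0 := GrassmannQuiver.ext2_eq_zero_of_tilde_eq_one hk hv hc hp hq hP hQ
      exact ⟨h₁₁, fun h => lB.1 ((dom p₁ q₂).1 h).2 hQ, fun h => lA.1 ((dom p₂ q₁).1 h).1 hP,
        fun h => lA.1 ((dom p₂ q₂).1 h).1 hP, GrassmannQuiver.relation_of_eq_zero h0,
        GrassmannQuiver.finrank_ext2_eq_zero h0⟩
  · rintro rfl hq
    have uA := GrassmannQuiver.canAddA_upper hk hc le_rfl
    have lB := GrassmannQuiver.canAddB_lower_iff hk hc hq
    have h₁ := (dom p₁ q₁).2 ⟨uA, GrassmannQuiver.canAddB_upper hk hc hq.le⟩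
    have hdim := GrassmannQuiver.finrank_ext2_row hk hv hm hc hq h₁
    refine ⟨fun hQ => ?_, fun hQ => ?_⟩
    · have h₂ := (dom p₁ q₂).2 ⟨uA, lB.2 hQ⟩
      exact ⟨h₁, h₂, GrassmannQuiver.relation_iff_row hk hv hm hc hq h₁ h₂, hdim⟩
    · have h₂ := fun h => lB.1 ((dom p₁ q₂).1 h).2 hQ
      exact ⟨h₂, h₁, GrassmannQuiver.relation_iff_row_of_not_isDominant hk hv hm hc hq h₁ h₂, hdim⟩
  · rintro hp rfl
    have uB := GrassmannQuiver.canAddB_upper hk hc le_rfl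
    have lA := GrassmannQuiver.canAddA_lower_iff hk hc hp
    have h₁ := (dom p₁ q₁).2 ⟨GrassmannQuiver.canAddA_upper hk hc hp.le, uB⟩
    have hdim := GrassmannQuiver.finrank_ext2_col hk hv hm hc hp h₁
    refine ⟨fun hP => ?_, fun hP => ?_⟩
    · have h₂ := (dom p₂ q₁).2 ⟨lA.2 hP, uB⟩
      exact ⟨h₁, h₂, GrassmannQuiver.relation_iff_col hk hv hm hc hp h₁ h₂, hdim⟩
    · have h₂ := fun h => lA.1 ((dom p₂ q₁).1 h).1 hP
      exact ⟨h₂, h₁, GrassmannQuiver.relation_iff_col_of_not_isDominant hk hv hm hc hp h₁ h₂, hdim⟩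
  · rintro rfl rfl
    exact GrassmannQuiver.finrank_ext2_eq_zero (GrassmannQuiver.ext2_eq_zero_of_eq hk hv hc)
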